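/- Conventions. For $z\in\mathbb{C}^\times$ and $p\in\mathbb{Z}$ let $l_p(z)=\log|z|+i\arg z+2\pi p i$ with $0\le\arg z<2\pi$. For $f(x)=\sum_{k=0}^{K}\sum_{n\in\mathbb{C}}a_{n,k}x^n(\log x)^k\in W\{x\}[\log x]$ put $f^p(z)=\sum_{k,n}a_{n,k}e^{n l_p(z)}l_p(z)^k$ and $f(z)=f^0(z)$. For a graded space $W=\coprod_n W_{[n]}$, $W'=\coprod_n W_{[n]}^*$ is the graded dual and $\pi_n$ the projection to $W_{[n]}$; values $f^p(z)$ of vertex operators and intertwining operators are required to lie in the completion $\prod_n W_{[n]}$ (each component receives only finitely many nonzero terms). Absolute convergence of a series such as $\sum_n\langle w',A(z_1)\pi_nB(z_2)w\rangle$ means absolute convergence of the series of all its monomial terms. Let $V$ be a vertex operator algebra over $\mathbb{C}$ with conformal vector $\omega$; automorphisms of $V$ fix $\mathbf 1$ and $\omega$. For an automorphism $g$, a generalized $g$-twisted $V$-module is a $\mathbb{C}$-graded space $W=\coprod_{n\in\mathbb{C}}W_{[n]}$ with a linear map $Y_W^g:V\otimes W\to W\{x\}[\log x]$ such that: * $(Y_W^g)^{p+1}(gv,z)w=(Y_W^g)^p(v,z)w$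 for all $p\in\mathbb{Z}$, $z\in\mathbb{C}^\times$, and $Y_W^g(\mathbf 1,x)w=w$; * for $u,v\in V$, $w\in W$, $w'\in W'$ there are finitely many $a_{ijkl},m_i,n_j\in\mathbb{C}$ and $t\in\mathbb{N}$ such that, for all $p\in\mathbb{Z}$, the series $\langle w',(Y_W^g)^p(u,z_1)(Y_W^g)^p(v,z_2)w\rangle$, $\langle w',(Y_W^g)^p(v,z_2)(Y_W^g)^p(u,z_1)w\rangle$, $\langle w',(Y_W^g)^p(Y_V(u,z_1-z_2)v,z_2)w\rangle$ converge absolutely for $|z_1|>|z_2|>0$, $|z_2|>|z_1|>0$, $|z_2|>|z_1-z_2|>0$, respectively, and have the sum $\sum_{i,j,k,l}a_{ijkl}e^{m_il_p(z_1)}e^{n_jl_p(z_2)}l_p(z_1)^kl_p(z_2)^l(z_1-z_2)^{-t}$ on the first two regions and on the part $|\arg z_1-\arg z_2|<\frac{\pi}{2}$ of the third; * for $w\in W_{[n]}$ there is $K\ge 1$ with $(L(0)-n)^Kw=0$, where $Y_W^g(\omega,x)w$ has the coefficients $L(m)w$ at $x^{-m-2}$; and $\frac{d}{dx}Y_W^g(v,x)=Y_W^g(L_V(-1)v,x)$.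 Let $g_1,g_2,g_3$ be automorphisms of $V$ and $W_1,W_2,W_3$ generalized $g_1$-, $g_2$-, $g_3$-twisted $V$-modules. Let $M^n=\{z\in\mathbb{C}^n\mid z_i\ne0,\ z_i\ne z_j\ (i\neq j)\}$, and let $M^2_0$ be $M^2$ cut along $z_1\in\mathbb{R}_+$, $z_2\in\mathbb{R}_+$ and $z_1-z_2\in\mathbb{R}_+$, the cuts being attached to the upper half planes. A twisted intertwining operator of type $\binom{W_3}{W_1W_2}$ is a linear map $\mathcal{Y}:W_1\otimes W_2\to W_3\{x\}[\log x]$, $\mathcal{Y}(w_1,x)w_2=\sum_{k,n}\mathcal{Y}_{n,k}(w_1)w_2\,x^{-n-1}(\log x)^k$, such that: 1. for all $w_1,w_2,n,k$, $\mathcal{Y}_{n+l,k}(w_1)w_2=0$ for $l\in\mathbb{N}$ sufficiently large; 2. for $u\in V$, $w_1\in W_1$, $w_2\in W_2$, $w_3'\in W_3'$ there is a multivalued analytic function on $M^2$ (one that continues analytically along all paths in $M^2$) with a single-valued branch $f^e$ on $M^2_0$ such that $\langle w_3',Y_{W_3}^{g_3}(u,z_1)\mathcal{Y}(w_1,z_2)w_2\rangle$,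 $\langle w_3',\mathcal{Y}(w_1,z_2)Y_{W_2}^{g_2}(u,z_1)w_2\rangle$, $\langle w_3',\mathcal{Y}(Y_{W_1}^{g_1}(u,z_1-z_2)w_1,z_2)w_2\rangle$ converge absolutely for $|z_1|>|z_2|>0$, $|z_2|>|z_1|>0$, $|z_2|>|z_1-z_2|>0$, respectively, with sum $f^e(z_1,z_2)$ on the parts of these regions given by $|\arg(z_1-z_2)-\arg z_1|<\frac{\pi}{2}$, by $-\frac{3\pi}{2}<\arg(z_1-z_2)-\arg z_2<-\frac{\pi}{2}$, and by $|\arg z_1-\arg z_2|<\frac{\pi}{2}$, respectively; 3. for $k\ge3$ the series $\langle w_3',Y_{W_3}^{g_3}(u_1,z_1)\cdots Y_{W_3}^{g_3}(u_{k-1},z_{k-1})\mathcal{Y}(w_1,z_k)w_2\rangle$ converges absolutely for $|z_1|>\cdots>|z_k|>0$ and extends to a multivalued analytic function on $M^k$ all of whose component-isolated singularities are regular. That is: let $\zeta=zA-\beta$ with $A\in GL(k,\mathbb{C})$, $\beta\in\mathbb{C}^k$, let $\delta\in\{0,\infty\}^k$, and suppose that some domain $\{0<|\zeta_i|<r_i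 \text{ if }\delta_i=0,\ |\zeta_i|>r_i\text{ if }\delta_i=\infty\}$ lies in $M^k$. Then all single-valued branches near $\zeta=\delta$ with cuts $\zeta_i\in\mathbb{R}_+$ are, near $\delta$, sums of absolutely convergent series in $\zeta_1^{a_1}(\log\zeta_1)^{j_1}\cdots\zeta_k^{a_k}(\log\zeta_k)^{j_k}$ with $0\le j_i\le K$ and $a_i\in R_i+\mathbb{N}$ (if $\delta_i=0$) or $a_i\in R_i-\mathbb{N}$ (if $\delta_i=\infty$), where $K\in\mathbb{N}$ and the finite sets $R_i\subset\mathbb{C}$ do not depend on the branch; 4. $\frac{d}{dx}\mathcal{Y}(w_1,x)=\mathcal{Y}(L(-1)w_1,x)$. Proposition. Let $\mathcal{Y}$ be a twisted intertwining operator of type $\binom{W_3}{W_1W_2}$. Assume that the map $u\mapsto Y_{W_3}^{g_3}(u,x)$ is injective on $V$ and that $\mathcal{Y}$ is surjective in the sense that the coefficients of the series $\mathcal{Y}(w_1,x)w_2$ for $w_1\in W_1$, $w_2\in W_2$ span $W_3$. Then $g_3=g_1g_2$. -/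

import Mathlib

open Filter Topology

noncomputable section

/-! ## Graded vector spaces -/

section Graded

variable {ι W : Type*} [DecidableEq ι] [AddCommGroup W] [Module ℂ W]

/-- The projection `π_n` of `W = ∐ W_n` onto its homogeneous component `W_n`. -/
def gradedProj (𝒲 : ι → Submodule ℂ W) (h : DirectSum.IsInternal 𝒲) (n : ι) : W →ₗ[ℂ] W :=
  (𝒲 n).subtype ∘ₗ DirectSum.component ℂ ι (fun i => 𝒲 i) n ∘ₗ
    (LinearEquiv.ofBijective (DirectSum.coeLinearMap 𝒲) h).symm.toLinearMap

/-- The graded dual `W' = ∐ (W_n)^*`: the functionals on `W = ∐ W_n` that vanish on all but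
finitely many `W_n`. -/
def gradedDual (𝒲 : ι → Submodule ℂ W) : Set (Module.Dual ℂ W) :=
  {φ | {n | ∃ w ∈ 𝒲 n, φ w ≠ 0}.Finite}

end Graded

/-! ## Branches of the logarithm and logarithmic formal series -/

/-- The argument normalized by `0 ≤ arg z < 2π`. -/
def arg₀ (z : ℂ) : ℝ := if 0 ≤ z.arg then z.arg else z.arg + 2 * Real.pi

/-- The branch `l_p(z) = log |z| + i arg z + 2πpi` of the logarithm, with `0 ≤ arg z < 2π`. -/
def logBranch (p : ℤ) (z : ℂ) : ℂ :=
  (Real.log ‖z‖ : ℂ) + (arg₀ z : ℂ) * Complex.I + 2 * (Real.pi : ℂ) * (p : ℂ) * Complex.I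

/-- The space `W{x}[log x]`: polynomials in `log x` whose coefficients are series with arbitrary
complex powers of `x`. The coefficient of `x ^ n (log x) ^ k` in `f` is `f k n`. -/
abbrev LogSeries (W : Type*) [AddCommGroup W] := ℕ →₀ (ℂ → W)

section LogSeries

variable {A B C : Type*} [AddCommGroup A] [Module ℂ A] [AddCommGroup B] [Module ℂ B]
  [AddCommGroup C] [Module ℂ C]

/-- The term of index `(k, n)` of the `p`-th analytic branch `f^p(z)` of `f`, namely
`f_{n,k} e^{n l_p(z)} l_p(z)^k`. -/
def logTerm (p : ℤ) (z : ℂ) (f : LogSeries A) (i : ℕ × ℂ) : A :=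
  (Complex.exp (i.2 * logBranch p z) * logBranch p z ^ i.1) • f i.1 i.2

/-- The formal derivative `d/dx` of a series in `W{x}[log x]` has the coefficient
`(n + 1) f_{n+1,k} + (k + 1) f_{n+1,k+1}` at `x ^ n (log x) ^ k`. -/
def IsLogDeriv (f' f : LogSeries A) : Prop :=
  ∀ (k : ℕ) (n : ℂ), f' k n = (n + 1) • f k (n + 1) + ((k : ℂ) + 1) • f (k + 1) (n + 1)

/-- The coefficient of `x ^ n (log x) ^ k` in an operator with values in `C{x}[log x]`. -/
def logCoeff (Y : B →ₗ[ℂ] LogSeries C) (k : ℕ) (n : ℂ) : B →ₗ[ℂ] C :=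
  LinearMap.proj n ∘ₗ Finsupp.lapply k ∘ₗ Y

/-- The terms of the series `∑ₙ ⟨φ, Y^{p₁}(z₁) πₙ s^{p₂}(z₂)⟩`, where both `Y` and `s` are expanded
in powers of the variables and their logarithms. The index is `(n, (k₂, m₂), (k₁, m₁))`. -/
def productTerm (φ : Module.Dual ℂ C) (Y : B →ₗ[ℂ] LogSeries C) (p₁ : ℤ) (z₁ : ℂ)
    (π : ℂ → B →ₗ[ℂ] B) (s : LogSeries B) (p₂ : ℤ) (z₂ : ℂ)
    (i : ℂ × (ℕ × ℂ) × (ℕ × ℂ)) : ℂ :=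
  φ (logTerm p₁ z₁ (Y (π i.1 (logTerm p₂ z₂ s i.2.1))) i.2.2)

/-- The terms of the series
`∑ ⟨φ, Y₁(z₁) π_{n₁} Y₂(z₂) π_{n₂} ⋯ Y_m(z_m) π_{n_m} s(z_{m+1})⟩` (preferred branches), where all
factors are expanded in powers of the variables and their logarithms. -/
def multiProductTerm {m : ℕ} (φ : Module.Dual ℂ B) (Y : Fin m → B →ₗ[ℂ] LogSeries B)
    (π : ℂ → B →ₗ[ℂ] B) (s : LogSeries B) (z : Fin (m + 1) → ℂ)
    (i : (Fin m → ℂ × (ℕ × ℂ)) × (ℕ × ℂ)) : ℂ :=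
  φ (Fin.foldr m
    (fun j x => logTerm 0 (z j.castSucc) (Y j (π (i.1 j).1 x)) (i.1 j).2)
    (logTerm 0 (z (Fin.last m)) s i.2))

end LogSeries

/-! ## Vertex operator algebras -/

/-- A vertex operator algebra (in the sense of Frenkel, Lepowsky and Meurman) on the complex vector
space `V`. The coefficient `u_n` of `x ^ (-n-1)` in `Y(u, x)` is `VertexOperator.ncoeff (Y u) n`,
and `L(n) = ω_{n+1}`. The Jacobi identity is given by its components. -/
structure VertexOperatorAlgebra (V : Type*) [AddCommGroup V] [Module ℂ V] where
  grading : ℤ → Submodule ℂ V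
  isInternal : DirectSum.IsInternal grading
  finiteDimensional : ∀ n, FiniteDimensional ℂ (grading n)
  lowerBounded : ∃ N : ℤ, ∀ n < N, grading n = ⊥
  Y : V →ₗ[ℂ] VertexOperator ℂ V
  vacuum : V
  conformal : V
  centralCharge : ℂ
  vacuum_mem : vacuum ∈ grading 0
  conformal_mem : conformal ∈ grading 2
  vacuum_mode : ∀ (n : ℤ) (v : V),
    VertexOperator.ncoeff (Y vacuum) n v = if n = -1 then v else 0
  creation : ∀ (v : V) (n : ℤ), 0 ≤ n → VertexOperator.ncoeff (Y v) n vacuum = 0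
  creation_neg_one : ∀ v : V, VertexOperator.ncoeff (Y v) (-1) vacuum = v
  jacobi : ∀ (l m n : ℤ) (u v w : V),
    ∑ᶠ i : ℕ, (((-1 : ℤ) ^ i * Ring.choose l i : ℤ) : ℂ) •
        (VertexOperator.ncoeff (Y u) (m + l - i) (VertexOperator.ncoeff (Y v) (n + i) w)
          - ((-1 : ℂ) ^ l) •
            VertexOperator.ncoeff (Y v) (n + l - i) (VertexOperator.ncoeff (Y u) (m + i) w))
      = ∑ᶠ i : ℕ, ((Ring.choose m i : ℤ) : ℂ) •
          VertexOperator.ncoeff (Y (VertexOperator.ncoeff (Y u) (l + i) v)) (m + n - i) w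
  virasoro : ∀ (m n : ℤ) (v : V),
    VertexOperator.ncoeff (Y conformal) (m + 1) (VertexOperator.ncoeff (Y conformal) (n + 1) v)
      - VertexOperator.ncoeff (Y conformal) (n + 1)
          (VertexOperator.ncoeff (Y conformal) (m + 1) v)
      = ((m : ℂ) - n) • VertexOperator.ncoeff (Y conformal) (m + n + 1) v
        + (if m + n = 0 then ((m : ℂ) ^ 3 - m) / 12 * centralCharge else 0) • v
  L_zero : ∀ (n : ℤ), ∀ v ∈ grading n, VertexOperator.ncoeff (Y conformal) 1 v = (n : ℂ) • v
  L_neg_one : ∀ (v w : V) (n : ℤ),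
    VertexOperator.ncoeff (Y (VertexOperator.ncoeff (Y conformal) 0 v)) n w
      = -(n : ℂ) • VertexOperator.ncoeff (Y v) (n - 1) w

namespace VertexOperatorAlgebra

variable {V : Type*} [AddCommGroup V] [Module ℂ V] (𝒱 : VertexOperatorAlgebra V)

/-- The mode `u_n`, that is, the coefficient of `x ^ (-n-1)` in `Y(u, x)`. -/
def mode (u : V) (n : ℤ) : V →ₗ[ℂ] V := VertexOperator.ncoeff (𝒱.Y u) n

/-- The group of automorphisms of a vertex operator algebra: the linear automorphisms that fix the
vacuum and the conformal element and satisfy `g Y(u, x) v = Y(g u, x) g v`. (They preserve the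
grading, which is given by the eigenvalues of `L(0)`.) The product is composition. -/
def Aut : Subgroup (V ≃ₗ[ℂ] V) where
  carrier := {g | g 𝒱.vacuum = 𝒱.vacuum ∧ g 𝒱.conformal = 𝒱.conformal ∧
    ∀ (u : V) (n : ℤ) (v : V), g (𝒱.mode u n v) = 𝒱.mode (g u) n (g v)}
  mul_mem' := by
    rintro g h ⟨g1, g2, g3⟩ ⟨h1, h2, h3⟩
    refine ⟨?_, ?_, fun u n v => ?_⟩
    · rw [LinearEquiv.mul_apply, h1, g1]
    · rw [LinearEquiv.mul_apply, h2, g2]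
    · simp only [LinearEquiv.mul_apply, h3, g3]
  one_mem' := ⟨rfl, rfl, fun _ _ _ => rfl⟩
  inv_mem' := by
    rintro g ⟨g1, g2, g3⟩
    have hg : ∀ x, g (g⁻¹ x) = x := fun x => LinearEquiv.apply_symm_apply g x
    refine ⟨?_, ?_, fun u n v => ?_⟩
    · apply g.injective; rw [hg, g1]
    · apply g.injective; rw [hg, g2]
    · apply g.injective; rw [g3, hg, hg, hg]

end VertexOperatorAlgebra

/-! ## Twisted modules -/

/-- The structure of a generalized `g`-twisted module (without a `g`-action) on `W`.
The field `finite_components` says that for all `z` and `p` the branch `Y^p(v, z) w` is a well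
defined element of the algebraic completion `∏ W_[n]`. -/
structure TwistedModule {V : Type*} [AddCommGroup V] [Module ℂ V] (𝒱 : VertexOperatorAlgebra V)
    (g : 𝒱.Aut) (W : Type*) [AddCommGroup W] [Module ℂ W] where
  grading : ℂ → Submodule ℂ W
  isInternal : DirectSum.IsInternal grading
  Y : V →ₗ[ℂ] W →ₗ[ℂ] LogSeries W
  finite_components : ∀ (v : V) (w : W) (n : ℂ),
    {i : ℕ × ℂ | gradedProj grading isInternal n (Y v w i.1 i.2) ≠ 0}.Finite
  /-- `Y^{p+1}(g v, z) w = Y^p(v, z) w` in the algebraic completion of `W`. -/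
  equivariance : ∀ (p : ℤ) (z : ℂ), z ≠ 0 → ∀ (v : V) (w : W) (n : ℂ),
    ∑ᶠ i, gradedProj grading isInternal n (logTerm (p + 1) z (Y (g.1 v) w) i)
      = ∑ᶠ i, gradedProj grading isInternal n (logTerm p z (Y v w) i)
  identity : ∀ (w : W) (k : ℕ) (n : ℂ), Y 𝒱.vacuum w k n = if k = 0 ∧ n = 0 then w else 0
  duality : ∀ (u v : V) (w : W), ∀ w' ∈ gradedDual grading,
    ∃ (N : ℕ) (a : ℕ → ℕ → ℕ → ℕ → ℂ) (r s : ℕ → ℂ) (t : ℕ),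
      ∀ (p : ℤ) (z₁ z₂ : ℂ),
        let fpp : ℂ := ∑ i ∈ Finset.range (N + 1), ∑ j ∈ Finset.range (N + 1),
          ∑ k ∈ Finset.range (N + 1), ∑ l ∈ Finset.range (N + 1),
            a i j k l * Complex.exp (r i * logBranch p z₁) * Complex.exp (s j * logBranch p z₂)
              * logBranch p z₁ ^ k * logBranch p z₂ ^ l * ((z₁ - z₂) ^ t)⁻¹
        let iterateTerm : ℤ × ℤ × (ℕ × ℂ) → ℂ := fun i =>
          w' (logTerm p z₂ (Y (gradedProj 𝒱.grading 𝒱.isInternal i.1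
            ((z₁ - z₂) ^ (-i.2.1 - 1) • 𝒱.mode u i.2.1 v)) w) i.2.2)
        (‖z₂‖ < ‖z₁‖ → 0 < ‖z₂‖ →
          HasSum (productTerm w' (Y u) p z₁ (gradedProj grading isInternal) (Y v w) p z₂) fpp) ∧
        (‖z₁‖ < ‖z₂‖ → 0 < ‖z₁‖ →
          HasSum (productTerm w' (Y v) p z₂ (gradedProj grading isInternal) (Y u w) p z₁) fpp) ∧
        (‖z₁ - z₂‖ < ‖z₂‖ → 0 < ‖z₁ - z₂‖ →
          Summable iterateTerm ∧
          (|arg₀ z₁ - arg₀ z₂| < Real.pi / 2 → HasSum iterateTerm fpp))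
  L_zero : ∀ (n : ℂ), ∀ w ∈ grading n, ∃ K : ℕ, 0 < K ∧
    ((logCoeff (Y 𝒱.conformal) 0 (-2) - n • LinearMap.id : Module.End ℂ W) ^ K) w = 0
  L_neg_one : ∀ (v : V) (w : W), IsLogDeriv (Y (𝒱.mode 𝒱.conformal 0 v) w) (Y v w)

namespace TwistedModule

variable {V : Type*} [AddCommGroup V] [Module ℂ V] {𝒱 : VertexOperatorAlgebra V}
  {g : 𝒱.Aut} {W : Type*} [AddCommGroup W] [Module ℂ W] (M : TwistedModule 𝒱 g W)

/-- The projection `π_n : W → W_[n]`. -/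
def proj (n : ℂ) : W →ₗ[ℂ] W := gradedProj M.grading M.isInternal n

/-- The operator `L(-1)`, the coefficient of `x ^ (-1)` in `Y(ω, x)`. -/
def LNegOne : W →ₗ[ℂ] W := logCoeff (M.Y 𝒱.conformal) 0 (-1)

end TwistedModule

/-! ## Multivalued analytic functions -/

section Multivalued

variable {E : Type*} [NormedAddCommGroup E] [NormedSpace ℂ E]

/-- `F` is an analytic continuation along the path `γ`: a family of germs, `F t` at `γ t`, that is
locally constant along `γ`. -/
def IsContinuationAlong {x y : E} (γ : Path x y) (F : unitInterval → E → ℂ) : Prop :=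
  ∀ t, AnalyticAt ℂ (F t) (γ t) ∧ ∀ᶠ s in 𝓝 t, F s =ᶠ[𝓝 (γ s)] F t

/-- The germ of `f` at each point of `D` has an analytic continuation along every path in `Ω`
that starts at that point; for a connected open set `D` on which `f` is analytic this says that `f`
is a branch on `D` of a (maximally extended) multivalued analytic function on `Ω`. -/
def ExtendsToMultivalued (Ω D : Set E) (f : E → ℂ) : Prop :=
  ∀ (x y : E) (γ : Path x y), x ∈ D → (∀ t, γ t ∈ Ω) →
    ∃ F, IsContinuationAlong γ F ∧ F 0 =ᶠ[𝓝 x] f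

/-- `h` is a single-valued branch on `U` of the multivalued analytic function on `Ω` that is
obtained from its branch `f` on `D` by analytic continuation along paths in `Ω`. -/
def IsBranchOn (Ω D : Set E) (f : E → ℂ) (U : Set E) (h : E → ℂ) : Prop :=
  AnalyticOnNhd ℂ h U ∧ ∀ y ∈ U, ∃ x ∈ D, ∃ (γ : Path x y) (F : unitInterval → E → ℂ),
    (∀ t, γ t ∈ Ω) ∧ IsContinuationAlong γ F ∧ F 0 =ᶠ[𝓝 x] f ∧ F 1 =ᶠ[𝓝 y] h

end Multivalued

/-- The region `M² = {(z₁, z₂) | z₁ ≠ 0, z₂ ≠ 0, z₁ ≠ z₂}`. -/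
def pairRegion : Set (ℂ × ℂ) := {z | z.1 ≠ 0 ∧ z.2 ≠ 0 ∧ z.1 ≠ z.2}

/-- The interior of the region `M²₀`: the points of `M²` that do not lie on the cuts
`z₁ ∈ ℝ₊`, `z₂ ∈ ℝ₊`, `z₁ - z₂ ∈ ℝ₊`. -/
def cutPairRegion : Set (ℂ × ℂ) :=
  {z | -z.1 ∈ Complex.slitPlane ∧ -z.2 ∈ Complex.slitPlane ∧ -(z.1 - z.2) ∈ Complex.slitPlane}

/-- `f` is a single-valued analytic function on `M²₀`, the region `M²` cut along the positive real
lines in the `z₁`-, `z₂`- and `(z₁ - z₂)`-planes, with the cuts attached to the upper half planes: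
near each point of `M²`, on the part where the three arguments stay close to their values at that
point (and do not jump by `2π`), `f` is equal to an analytic function. -/
def IsSingleValuedBranch (f : ℂ × ℂ → ℂ) : Prop :=
  ∀ z ∈ pairRegion, ∃ F : ℂ × ℂ → ℂ, AnalyticAt ℂ F z ∧ ∀ᶠ y in 𝓝 z,
    |arg₀ y.1 - arg₀ z.1| < Real.pi → |arg₀ y.2 - arg₀ z.2| < Real.pi →
      |arg₀ (y.1 - y.2) - arg₀ (z.1 - z.2)| < Real.pi → f y = F y

/-- The region `Mⁿ = {(z₁, …, zₙ) | zᵢ ≠ 0, zᵢ ≠ zⱼ for i ≠ j}`. -/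
def configRegion (n : ℕ) : Set (Fin n → ℂ) :=
  {z | (∀ i, z i ≠ 0) ∧ ∀ i j, i ≠ j → z i ≠ z j}

/-- The region `|z₁| > ⋯ > |zₙ| > 0`. -/
def orderedRegion (n : ℕ) : Set (Fin n → ℂ) :=
  {z | (∀ i, 0 < ‖z i‖) ∧ ∀ i j, i < j → ‖z j‖ < ‖z i‖}

/-- The points of `ℂⁿ` without coordinates in `[0, ∞)`. -/
def slitRegion (n : ℕ) : Set (Fin n → ℂ) := {z | ∀ i, -z i ∈ Complex.slitPlane}

/-- The polycircular domain `Δ^×(δ, r)` for `δ ∈ {0, ∞}ⁿ`, where `J = {i | δᵢ = ∞}`. -/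
def punctPolydisc {n : ℕ} (J : Set (Fin n)) (r : Fin n → ℝ) : Set (Fin n → ℂ) :=
  {ζ | ∀ i, (i ∈ J → r i < ‖ζ i‖) ∧ (i ∉ J → 0 < ‖ζ i‖ ∧ ‖ζ i‖ < r i)}

/-- The coordinates `z = ζ A⁻¹ + β A⁻¹`, inverse to `ζ = z A - β`. -/
def fromZeta {n : ℕ} (A : Matrix (Fin n) (Fin n) ℂ) (β ζ : Fin n → ℂ) : Fin n → ℂ :=
  Matrix.vecMul (ζ + β) A⁻¹

/-- `ζ = z A - β = δ` is a component-isolated singularity of multivalued functions on `Ω`. -/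
def IsComponentIsolated {n : ℕ} (Ω : Set (Fin n → ℂ)) (A : Matrix (Fin n) (Fin n) ℂ)
    (β : Fin n → ℂ) (J : Set (Fin n)) : Prop :=
  ∃ r : Fin n → ℝ, (∀ i, 0 < r i) ∧ ∀ ζ ∈ punctPolydisc J r, fromZeta A β ζ ∈ Ω

/-- `ζ = z A - β = δ` is a regular singularity of the multivalued analytic function on `Ω` obtained
from its branch `f` on `D`: with a common bound `K` for the powers of the logarithms and common
finite sets `R i` such that the exponents of `ζᵢ` lie in `R i + ℕ` (for `δᵢ = 0`) or in `R i - ℕ`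
(for `δᵢ = ∞`), every single-valued branch near `δ` with cuts at `ζᵢ ∈ ℝ₊` is the sum of an
absolutely convergent series in powers of the `ζᵢ` and of the `log ζᵢ`. -/
def IsRegularSingularity {n : ℕ} (Ω D : Set (Fin n → ℂ)) (f : (Fin n → ℂ) → ℂ)
    (A : Matrix (Fin n) (Fin n) ℂ) (β : Fin n → ℂ) (J : Set (Fin n)) : Prop :=
  ∃ (K : ℕ) (R : Fin n → Finset ℂ),
    ∀ (r₀ : Fin n → ℝ) (h : (Fin n → ℂ) → ℂ), (∀ i, 0 < r₀ i) →
      (∀ ζ ∈ punctPolydisc J r₀, fromZeta A β ζ ∈ Ω) →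
      IsBranchOn Ω D f (fromZeta A β '' (punctPolydisc J r₀ ∩ slitRegion n)) h →
      ∃ (r : Fin n → ℝ) (α : (Fin n → ℂ) × (Fin n → Fin (K + 1)) → ℂ), (∀ i, 0 < r i) ∧
        punctPolydisc J r ⊆ punctPolydisc J r₀ ∧
        (∀ a j, α (a, j) ≠ 0 → ∀ i, ∃ ρ ∈ R i, ∃ l : ℕ,
          (i ∈ J → a i = ρ - l) ∧ (i ∉ J → a i = ρ + l)) ∧
        ∀ ζ ∈ punctPolydisc J r ∩ slitRegion n,
          HasSum (fun b : (Fin n → ℂ) × (Fin n → Fin (K + 1)) =>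
            α b * ∏ i, (Complex.exp (b.1 i * logBranch 0 (ζ i))
              * logBranch 0 (ζ i) ^ (b.2 i : ℕ))) (h (fromZeta A β ζ))

/-! ## Twisted intertwining operators -/

/-- A twisted intertwining operator of type `(W₃; W₁ W₂)` among a `g₁`-, a `g₂`- and a `g₃`-twisted
module. The field `finite_components` says that `𝒴(w₁, z) w₂` is a well defined element of the
algebraic completion of `W₃`. -/
structure TwistedIntertwiningOperator {V W₁ W₂ W₃ : Type*} [AddCommGroup V] [Module ℂ V]
    [AddCommGroup W₁] [Module ℂ W₁] [AddCommGroup W₂] [Module ℂ W₂]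
    [AddCommGroup W₃] [Module ℂ W₃] {𝒱 : VertexOperatorAlgebra V} {g₁ g₂ g₃ : 𝒱.Aut}
    (M₁ : TwistedModule 𝒱 g₁ W₁) (M₂ : TwistedModule 𝒱 g₂ W₂) (M₃ : TwistedModule 𝒱 g₃ W₃) where
  Y : W₁ →ₗ[ℂ] W₂ →ₗ[ℂ] LogSeries W₃
  finite_components : ∀ (w₁ : W₁) (w₂ : W₂) (n : ℂ),
    {i : ℕ × ℂ | M₃.proj n (Y w₁ w₂ i.1 i.2) ≠ 0}.Finite
  lower_truncation : ∀ (w₁ : W₁) (w₂ : W₂) (n : ℂ) (k : ℕ),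
    ∃ L : ℕ, ∀ l : ℕ, L ≤ l → Y w₁ w₂ k (-(n + l) - 1) = 0
  duality : ∀ (u : V) (w₁ : W₁) (w₂ : W₂), ∀ w₃' ∈ gradedDual M₃.grading,
    ∃ f : ℂ × ℂ → ℂ, IsSingleValuedBranch f ∧ ExtendsToMultivalued pairRegion cutPairRegion f ∧
      ∀ z₁ z₂ : ℂ,
        let product := productTerm w₃' (M₃.Y u) 0 z₁ M₃.proj (Y w₁ w₂) 0 z₂
        let reverseProduct := productTerm w₃' (Y w₁) 0 z₂ M₂.proj (M₂.Y u w₂) 0 z₁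
        let iterate := productTerm w₃' (Y.flip w₂) 0 z₂ M₁.proj (M₁.Y u w₁) 0 (z₁ - z₂)
        (‖z₂‖ < ‖z₁‖ → 0 < ‖z₂‖ →
          Summable product ∧
          (|arg₀ (z₁ - z₂) - arg₀ z₁| < Real.pi / 2 → HasSum product (f (z₁, z₂)))) ∧
        (‖z₁‖ < ‖z₂‖ → 0 < ‖z₁‖ →
          Summable reverseProduct ∧
          (-(3 * Real.pi / 2) < arg₀ (z₁ - z₂) - arg₀ z₂ →
            arg₀ (z₁ - z₂) - arg₀ z₂ < -(Real.pi / 2) →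
              HasSum reverseProduct (f (z₁, z₂)))) ∧
        (‖z₁ - z₂‖ < ‖z₂‖ → 0 < ‖z₁ - z₂‖ →
          Summable iterate ∧
          (|arg₀ z₁ - arg₀ z₂| < Real.pi / 2 → HasSum iterate (f (z₁, z₂))))
  /-- Products of `m ≥ 2` twisted vertex operators and the intertwining operator. -/
  products : ∀ (m : ℕ), 2 ≤ m → ∀ (u : Fin m → V) (w₁ : W₁) (w₂ : W₂),
    ∀ w₃' ∈ gradedDual M₃.grading,
      let term := multiProductTerm w₃' (fun j => M₃.Y (u j)) M₃.proj (Y w₁ w₂)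
      let S : (Fin (m + 1) → ℂ) → ℂ := fun z => ∑' i, term z i
      let D := orderedRegion (m + 1) ∩ slitRegion (m + 1)
      (∀ z ∈ orderedRegion (m + 1), Summable (term z)) ∧
      AnalyticOnNhd ℂ S D ∧
      ExtendsToMultivalued (configRegion (m + 1)) D S ∧
      ∀ (A : Matrix (Fin (m + 1)) (Fin (m + 1)) ℂ) (β : Fin (m + 1) → ℂ) (J : Set (Fin (m + 1))),
        IsUnit A.det → IsComponentIsolated (configRegion (m + 1)) A β J →
          IsRegularSingularity (configRegion (m + 1)) D S A β J
  L_neg_one : ∀ (w₁ : W₁) (w₂ : W₂), IsLogDeriv (Y (M₁.LNegOne w₁) w₂) (Y w₁ w₂)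

namespace TwistedIntertwiningOperator

variable {V W₁ W₂ W₃ : Type*} [AddCommGroup V] [Module ℂ V]
  [AddCommGroup W₁] [Module ℂ W₁] [AddCommGroup W₂] [Module ℂ W₂]
  [AddCommGroup W₃] [Module ℂ W₃] {𝒱 : VertexOperatorAlgebra V} {g₁ g₂ g₃ : 𝒱.Aut}
  {M₁ : TwistedModule 𝒱 g₁ W₁} {M₂ : TwistedModule 𝒱 g₂ W₂} {M₃ : TwistedModule 𝒱 g₃ W₃}

/-- `𝒴` is surjective: the coefficients of the series `𝒴(w₁, x) w₂` span `W₃`. -/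
def IsSurjective (𝒴 : TwistedIntertwiningOperator M₁ M₂ M₃) : Prop :=
  Submodule.span ℂ {w : W₃ | ∃ (w₁ : W₁) (w₂ : W₂) (k : ℕ) (n : ℂ), w = 𝒴.Y w₁ w₂ k n} = ⊤

end TwistedIntertwiningOperator

end

/-! Fix `z₂ = ζ = -it` and a homogeneous `u`, and follow the correlation function as a function of
`z = z₁`. For `|z| > t` it is the product series in `log z`, for `|z| < t` the reversed product in
`log z`, and for `|z - ζ| < t` the iterate in `log (z - ζ)`. Translating the logarithm by `2πi` in
these three expansions is compensated by replacing `u` with `g₃ u`, `g₂ u` and `g₁ u`, respectively.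
A large circle around `0` and `ζ` is the composite of a loop around `0` and a loop around `ζ`, so
the product series of `g₁ g₂ u` at `s + 2πi` equals that of `u` at `s` (`monodromy_comparison`,
`productSeries_monodromy`). By definition the same holds with `g₃ u` in place of `g₁ g₂ u`. Hence
all products of `v = g₃⁻¹ g₁ g₂ u - u` with `𝒴` vanish (`sub_mem_productKernel`).

Convergence is assumed for the preferred branch only, while monodromy needs all values of the
logarithm. The bridge is `exists_equivariant_bound`. On the finite-dimensional space of weight `N`,
equivariance ties the exponents to the eigenvalues of the automorphism, which bounds the powers of
the logarithm and the imaginary parts of the exponents uniformly. Absolute convergence at one point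
of a circle then gives it over the whole vertical line of logarithms (`coeffSeries_continuation`).

It remains to see that vanishing products force `v = 0`. The vectors of weight `N` with vanishing
products form a `g₃`-stable space of finite dimension. If it is nonzero, it contains an eigenvector
`v`, and `Y(v, x)` then has no logarithms and exponents in a single class modulo `ℤ`. Its modes can
be extracted as Laurent coefficients. What is left is a sum over all intermediate weights;
homogeneity of the modes (`Y_mem_grading`) reduces it to one weight, hence to a finite exponential
polynomial in `log z₂`, whose coefficients must vanish. So `Y(v, x)` kills all coefficients of `𝒴`,
hence `W₃`, and `v = 0` by injectivity. Homogeneity comes from the commutator with `L(0)`, which is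
derived from duality for `ω` by comparing residues (`LZero_commutator`). -/

/-! ## Exponential polynomials -/

/-- The exponential monomial `e ^ {m s} s ^ k` of index `(k, m)`. -/
noncomputable def expMonomial (i : ℕ × ℂ) (s : ℂ) : ℂ := Complex.exp (i.2 * s) * s ^ i.1

section ExponentialPolynomials

open Polynomial

/-- Differentiation lowers the degree, so it cannot cancel `a q`. -/
theorem Polynomial.eq_zero_of_derivative_add_C_mul_eq_zero {q : ℂ[X]} {a : ℂ} (ha : a ≠ 0)
    (h : derivative q + C a * q = 0) : q = 0 := by
  by_contra hq
  have h1 : (C a * q).degree = q.degree := degree_C_mul ha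
  have h2 : C a * q = -derivative q := by linear_combination h
  rw [h2, degree_neg] at h1
  exact (degree_derivative_lt hq).ne h1

theorem sum_exp_mul_derivative_add_eq_zero {S : Finset ℂ} {q : ℂ → ℂ[X]}
    (h : ∀ s : ℂ, ∑ a ∈ S, Complex.exp (a * s) * (q a).eval s = 0) (s : ℂ) :
    ∑ a ∈ S, Complex.exp (a * s) * (derivative (q a) + C a * q a).eval s = 0 := by
  have h1 : HasDerivAt (fun s : ℂ => ∑ a ∈ S, Complex.exp (a * s) * (q a).eval s)
      (∑ a ∈ S, Complex.exp (a * s) * (derivative (q a) + C a * q a).eval s) s := by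
    refine HasDerivAt.fun_sum fun a _ => ?_
    have h2 : HasDerivAt (fun s : ℂ => Complex.exp (a * s)) (Complex.exp (a * s) * a) s := by
      simpa using ((hasDerivAt_id s).const_mul a).cexp
    refine (h2.mul ((q a).hasDerivAt s)).congr_deriv ?_
    simp only [eval_add, eval_mul, eval_C]
    ring
  simp only [h] at h1
  exact (h1.unique (hasDerivAt_const s 0))

/-- Exponentials with distinct frequencies are linearly independent over the polynomials. -/
theorem eq_zero_of_sum_exp_mul_eval_eq_zero (S : Finset ℂ) : ∀ (p : ℂ → ℂ[X]),
    (∀ s : ℂ, ∑ m ∈ S, Complex.exp (m * s) * (p m).eval s = 0) → ∀ m ∈ S, p m = 0 := by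
  classical
  induction S using Finset.induction_on with
  | empty => simp
  | insert m₀ S hm₀ ih =>
    intro p hp
    -- `d/ds - m₀` sends `e^{as} q` to `e^{as} (D a q)`. For `a = m₀` this is plain differentiation,
    -- hence nilpotent on each polynomial. For `a ≠ m₀` it is injective.
    let D : ℂ → ℂ[X] → ℂ[X] := fun a q => derivative q + C (a - m₀) * q
    have hD : ∀ N : ℕ, ∀ s : ℂ,
        ∑ m ∈ insert m₀ S, Complex.exp (m * s) * ((D m)^[N] (p m)).eval s = 0 := by
      intro N
      induction N with
      | zero => simpa using hp
      | succ N ihN =>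
        intro s
        -- Applying `d/ds - m₀` amounts to multiplying by `e^{-m₀ s}`, differentiating, and
        -- multiplying back.
        have h1 : ∀ s : ℂ, ∑ a ∈ (insert m₀ S).image (fun m => m - m₀),
            Complex.exp (a * s) * ((D (a + m₀))^[N] (p (a + m₀))).eval s = 0 := by
          intro s
          rw [Finset.sum_image (fun x _ y _ h => by simpa using h)]
          have h2 := congrArg (fun x => Complex.exp (-m₀ * s) * x) (ihN s)
          simp only [Finset.mul_sum, mul_zero] at h2
          rw [← h2]
          refine Finset.sum_congr rfl fun m _ => ?_
          rw [← mul_assoc, ← Complex.exp_add, sub_add_cancel]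
          congr 2
          ring
        have h3 := sum_exp_mul_derivative_add_eq_zero h1 s
        rw [Finset.sum_image (fun x _ y _ h => by simpa using h)] at h3
        have h4 := congrArg (fun x => Complex.exp (m₀ * s) * x) h3
        simp only [Finset.mul_sum, mul_zero] at h4
        rw [← h4]
        refine Finset.sum_congr rfl fun m _ => ?_
        rw [← mul_assoc, ← Complex.exp_add, sub_add_cancel, Function.iterate_succ_apply']
        congr 2
        ring
    set N := (p m₀).natDegree + 1 with hN
    have hm₀D : (D m₀)^[N] (p m₀) = 0 := by
      have : D m₀ = derivative := by
        funext q
        simp [D]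
      rw [this]
      exact iterate_derivative_eq_zero (by omega)
    have hS : ∀ m ∈ S, (D m)^[N] (p m) = 0 := by
      refine ih _ fun s => ?_
      have := hD N s
      rwa [Finset.sum_insert hm₀, hm₀D, eval_zero, mul_zero, zero_add] at this
    have hS' : ∀ m ∈ S, p m = 0 := by
      intro m hm
      have hne : m - m₀ ≠ 0 := sub_ne_zero.2 fun h => hm₀ (h ▸ hm)
      have : ∀ (N : ℕ) (q : ℂ[X]), (D m)^[N] q = 0 → q = 0 := by
        intro N
        induction N with
        | zero => simp
        | succ N ihN =>
          intro q hq
          rw [Function.iterate_succ_apply] at hq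
          exact eq_zero_of_derivative_add_C_mul_eq_zero hne (ihN _ hq)
      exact this N _ (hS m hm)
    have h0 : p m₀ = 0 := by
      refine Polynomial.funext fun s => ?_
      have := hp s
      rw [Finset.sum_insert hm₀, Finset.sum_eq_zero (fun m hm => by rw [hS' m hm]; simp),
        add_zero] at this
      simpa [Complex.exp_ne_zero] using this
    intro m hm
    rcases Finset.mem_insert.1 hm with rfl | hm
    · exact h0
    · exact hS' m hm

/-- A periodic polynomial takes the value `r(0)` at all the infinitely many points `n a`. -/
theorem Polynomial.natDegree_eq_zero_of_comp_X_add_C_eq {r : ℂ[X]} {a : ℂ} (ha : a ≠ 0)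
    (h : r.comp (X + C a) = r) : r.natDegree = 0 := by
  have h1 : ∀ n : ℕ, r.eval (n * a) = r.eval 0 := by
    intro n
    induction n with
    | zero => simp
    | succ n ih =>
      rw [← ih]
      conv_rhs => rw [← h]
      simp only [eval_comp, eval_add, eval_X, eval_C]
      congr 1
      push_cast
      ring
  have h2 : r = C (r.eval 0) := by
    refine eq_of_infinite_eval_eq _ _ ((Set.infinite_range_of_injective
      (f := fun n : ℕ => (n : ℂ) * a) fun m n hmn => ?_).mono ?_)
    · simpa [ha] using hmn
    · rintro _ ⟨n, rfl⟩
      simpa using h1 n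
  rw [h2, natDegree_C]

theorem Polynomial.iterate_derivative_comp_X_add_C (p : ℂ[X]) (a : ℂ) (n : ℕ) :
    derivative^[n] (p.comp (X + C a)) = (derivative^[n] p).comp (X + C a) := by
  induction n with
  | zero => rfl
  | succ n ih =>
    rw [Function.iterate_succ_apply', ih, Function.iterate_succ_apply', derivative_comp]
    simp

theorem Polynomial.degree_lt_of_iterate_derivative_eq_zero {p : ℂ[X]} {n : ℕ}
    (h : derivative^[n] p = 0) : p.degree < n := by
  rw [degree_lt_iff_coeff_zero]
  intro m hm
  have h1 := congrArg (fun q => q.coeff (m - n)) h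
  simp only [coeff_iterate_derivative, coeff_zero, Nat.sub_add_cancel hm] at h1
  rw [nsmul_eq_mul, mul_eq_zero] at h1
  rcases h1 with h1 | h1
  · exact absurd h1 (Nat.cast_ne_zero.2 (Nat.descFactorial_pos.2 hm |>.ne'))
  · exact h1

/-- The `n`-th derivative of `p` is invariant under translation by `a`, hence constant. -/
theorem Polynomial.degree_lt_of_degree_comp_sub_lt {p : ℂ[X]} {a : ℂ} (ha : a ≠ 0) {n : ℕ}
    (h : (p.comp (X + C a) - p).degree < n) : p.degree < (n + 1 : ℕ) := by
  have h1 := iterate_derivative_eq_zero_of_degree_lt h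
  rw [iterate_derivative_sub, iterate_derivative_comp_X_add_C, sub_eq_zero] at h1
  refine degree_lt_of_iterate_derivative_eq_zero ?_
  rw [Function.iterate_succ_apply', derivative_eq_zero]
  exact natDegree_eq_zero_of_comp_X_add_C_eq ha h1

/-- Translation does not change the leading coefficient, so the factor `c` would have to be `1`. -/
theorem Polynomial.eq_zero_of_eq_C_mul_comp {p : ℂ[X]} {a c : ℂ} (hc : c ≠ 1)
    (h : p = C c * p.comp (X + C a)) : p = 0 := by
  by_contra hp
  have h1 := congrArg leadingCoeff h
  rw [leadingCoeff_mul, leadingCoeff_C, leadingCoeff_comp (by simp), leadingCoeff_X_add_C, one_pow,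
    mul_one] at h1
  have h2 : (c - 1) * p.leadingCoeff = 0 := by linear_combination -h1
  rcases mul_eq_zero.1 h2 with h2 | h2
  · exact hc (sub_eq_zero.1 h2)
  · exact hp (leadingCoeff_eq_zero.1 h2)

/-- The polynomial `∑ₖ c (k, m) X ^ k` that multiplies `e ^ {m s}` in the exponential polynomial with
the coefficients `c`. -/
noncomputable def expCoeff (c : ℕ × ℂ → ℂ) (K : ℕ) (m : ℂ) : ℂ[X] :=
  ∑ k ∈ Finset.range K, monomial k (c (k, m))

theorem exists_support_subset {c : ℕ × ℂ → ℂ} (hc : c.support.Finite) :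
    ∃ (K : ℕ) (S : Finset ℂ), ∀ i, c i ≠ 0 → i.1 < K ∧ i.2 ∈ S := by
  classical
  obtain ⟨K, hK⟩ := (hc.image Prod.fst).bddAbove
  refine ⟨K + 1, (hc.image Prod.snd).toFinset, fun i hi => ⟨?_, ?_⟩⟩
  · exact Nat.lt_succ_of_le (hK ⟨i, hi, rfl⟩)
  · simp only [Set.Finite.mem_toFinset]
    exact ⟨i, hi, rfl⟩

theorem finsum_mul_expMonomial {c : ℕ × ℂ → ℂ} {K : ℕ} {S : Finset ℂ}
    (h : ∀ i, c i ≠ 0 → i.1 < K ∧ i.2 ∈ S) (s : ℂ) :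
    ∑ᶠ i, c i * expMonomial i s = ∑ m ∈ S, Complex.exp (m * s) * (expCoeff c K m).eval s := by
  classical
  rw [finsum_eq_sum_of_support_subset (s := Finset.range K ×ˢ S), Finset.sum_product_right]
  · refine Finset.sum_congr rfl fun m _ => ?_
    rw [expCoeff, eval_finsetSum, Finset.mul_sum]
    refine Finset.sum_congr rfl fun k _ => ?_
    rw [eval_monomial, expMonomial]
    ring
  · intro i hi
    have := h i (left_ne_zero_of_mul hi)
    simpa using this

theorem expCoeff_coeff {c : ℕ × ℂ → ℂ} {K : ℕ} (m : ℂ) (h : ∀ i, c i ≠ 0 → i.1 < K) (k : ℕ) :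
    (expCoeff c K m).coeff k = c (k, m) := by
  simp only [expCoeff, finsetSum_coeff, coeff_monomial]
  rw [Finset.sum_ite_eq']
  split_ifs with hk
  · rfl
  · by_contra h1
    exact hk (Finset.mem_range.2 (h (k, m) (Ne.symm h1)))

theorem expCoeff_eq_zero {c : ℕ × ℂ → ℂ} {K : ℕ} {S : Finset ℂ}
    (h : ∀ i, c i ≠ 0 → i.1 < K ∧ i.2 ∈ S) {m : ℂ} (hm : m ∉ S) : expCoeff c K m = 0 := by
  refine Finset.sum_eq_zero fun k _ => ?_
  have : c (k, m) = 0 := by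
    by_contra h1
    exact hm (h _ h1).2
  rw [this, monomial_zero_right]

/-- The coefficients of an exponential polynomial are determined by its values. -/
theorem eq_zero_of_finsum_mul_expMonomial_eq_zero {c : ℕ × ℂ → ℂ} (hc : c.support.Finite)
    (h : ∀ s, ∑ᶠ i, c i * expMonomial i s = 0) : c = 0 := by
  obtain ⟨K, S, hKS⟩ := exists_support_subset hc
  simp only [finsum_mul_expMonomial hKS] at h
  funext ⟨k, m⟩
  rw [← expCoeff_coeff m (fun i hi => (hKS i hi).1) k]
  by_cases hm : m ∈ S
  · rw [eq_zero_of_sum_exp_mul_eval_eq_zero S _ h m hm]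
    simp
  · rw [expCoeff_eq_zero hKS hm]
    simp

/-- Translation by `a` acts on each frequency separately: `e^{ms}` acquires the factor `e^{ma}` and
its polynomial is translated. Linear independence allows comparison frequency by frequency. -/
theorem expCoeff_eq_of_shift {c c' : ℕ × ℂ → ℂ} {K : ℕ} {S : Finset ℂ} {a : ℂ}
    (h : ∀ i, c i ≠ 0 → i.1 < K ∧ i.2 ∈ S) (h' : ∀ i, c' i ≠ 0 → i.1 < K ∧ i.2 ∈ S)
    (heq : ∀ s, ∑ᶠ i, c' i * expMonomial i (s + a) = ∑ᶠ i, c i * expMonomial i s) (m : ℂ) :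
    expCoeff c K m = C (Complex.exp (m * a)) * (expCoeff c' K m).comp (X + C a) := by
  by_cases hm : m ∈ S
  · have h1 := eq_zero_of_sum_exp_mul_eval_eq_zero S
      (fun m => expCoeff c K m - C (Complex.exp (m * a)) * (expCoeff c' K m).comp (X + C a)) ?_ m hm
    · exact sub_eq_zero.1 h1
    · intro s
      have := heq s
      rw [finsum_mul_expMonomial h, finsum_mul_expMonomial h'] at this
      rw [← sub_eq_zero.2 this.symm, ← Finset.sum_sub_distrib]
      refine Finset.sum_congr rfl fun m _ => ?_
      simp only [eval_sub, eval_mul, eval_C, eval_comp, eval_add, eval_X, mul_add,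
        Complex.exp_add]
      ring
  · rw [expCoeff_eq_zero h hm, expCoeff_eq_zero h' hm]
    simp

end ExponentialPolynomials

/-! ### Exponents and logarithms allowed by equivariance under `s ↦ s + 2πi` -/

section Equivariant

variable {V : Type*} [AddCommGroup V] [Module ℂ V]

open Polynomial in
/-- If a family of exponential polynomials is equivariant under translation by `2πi`, then
generalized eigenvectors determine the frequencies modulo `ℤ` and bound the degrees. -/
theorem equivariant_support {g : Module.End ℂ V} {c : V →ₗ[ℂ] (ℕ × ℂ → ℂ)}
    (hfin : ∀ u, (c u).support.Finite)
    (heq : ∀ u s, ∑ᶠ i, c (g u) i * expMonomial i (s + 2 * Real.pi * Complex.I)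
      = ∑ᶠ i, c u i * expMonomial i s) {l : ℂ} (N : ℕ) :
    ∀ u, ((g - l • LinearMap.id : Module.End ℂ V) ^ N) u = 0 → ∀ i, c u i ≠ 0 →
      i.1 < N ∧ Complex.exp (i.2 * (2 * Real.pi * Complex.I)) * l = 1 := by
  classical
  induction N with
  | zero =>
    intro u hu i hi
    simp only [pow_zero, Module.End.one_apply] at hu
    simp [hu] at hi
  | succ N ih =>
    intro u hu ⟨k, m⟩ hi
    set a : ℂ := 2 * Real.pi * Complex.I with ha
    have ha0 : a ≠ 0 := Complex.two_pi_I_ne_zero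
    -- `u'` is killed by one power less of `g - l`, so the induction hypothesis controls its
    -- coefficients.
    set u' := g u - l • u with hu'
    have hgu : g u = u' + l • u := by rw [hu']; abel
    have ih' := ih u' (by
      rw [pow_succ, Module.End.mul_apply] at hu
      simpa [hu'] using hu)
    obtain ⟨K₁, S₁, h1⟩ := exists_support_subset (hfin u)
    obtain ⟨K₂, S₂, h2⟩ := exists_support_subset (hfin u')
    set K := max K₁ K₂
    set S := S₁ ∪ S₂
    have hc : ∀ i, c u i ≠ 0 → i.1 < K ∧ i.2 ∈ S := fun i hi =>
      ⟨lt_max_of_lt_left (h1 i hi).1, Finset.mem_union_left _ (h1 i hi).2⟩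
    have hc' : ∀ i, c u' i ≠ 0 → i.1 < K ∧ i.2 ∈ S := fun i hi =>
      ⟨lt_max_of_lt_right (h2 i hi).1, Finset.mem_union_right _ (h2 i hi).2⟩
    have hcg : ∀ i, c (g u) i ≠ 0 → i.1 < K ∧ i.2 ∈ S := by
      intro i hi
      by_cases h3 : c u i = 0
      · refine hc' i fun h4 => hi ?_
        rw [hgu, map_add, map_smul]
        simp [h3, h4]
      · exact hc i h3
    -- With `hlin` this becomes `p = κ (q + l p)(X + a)`, where `p` and `q` belong to `u` and `u'`
    -- and `κ = e^{ma}`.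
    have key := expCoeff_eq_of_shift hc hcg (heq u) m
    have hlin : expCoeff (c (g u)) K m = expCoeff (c u') K m + C l * expCoeff (c u) K m := by
      rw [hgu, map_add, map_smul]
      simp only [expCoeff, Finset.mul_sum, C_mul_monomial, ← Finset.sum_add_distrib]
      refine Finset.sum_congr rfl fun k _ => ?_
      rw [← map_add]
      rfl
    set p := expCoeff (c u) K m
    set q := expCoeff (c u') K m
    set κ := Complex.exp (m * a)
    have hpk : p.coeff k ≠ 0 := by
      rw [expCoeff_coeff m fun i hi => (hc i hi).1]
      exact hi
    have hκ0 : κ ≠ 0 := Complex.exp_ne_zero _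
    have hqdeg : q.degree < N := by
      rw [degree_lt_iff_coeff_zero]
      intro k hk
      rw [expCoeff_coeff m fun i hi => (hc' i hi).1]
      by_contra h3
      exact absurd (ih' _ h3).1 (by simpa using hk)
    rw [hlin] at key
    -- Off resonance the induction hypothesis gives `q = 0`, and `p = κ l p(X + a)` is then
    -- impossible for `p ≠ 0`.
    have hκl : κ * l = 1 := by
      by_contra h3
      have hq0 : q = 0 := by
        ext k
        rw [expCoeff_coeff m fun i hi => (hc' i hi).1]
        by_contra h4
        exact h3 (ih' _ h4).2
      refine hpk ?_
      rw [hq0, zero_add, mul_comp, C_comp, ← mul_assoc, ← C_mul] at key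
      rw [eq_zero_of_eq_C_mul_comp h3 key, coeff_zero]
    refine ⟨?_, hκl⟩
    -- At resonance the difference of `p` under translation is governed by `q`, whose degree is
    -- below `N`, so the degree of `p` is at most one larger.
    have h4 : p.comp (X + C a) - p = -(C κ * q.comp (X + C a)) := by
      have h5 : C κ * C l = (1 : ℂ[X]) := by rw [← C_mul, hκl, C_1]
      rw [add_comp, mul_comp, C_comp] at key
      linear_combination (-1 : ℂ[X]) * key - p.comp (X + C a) * h5
    have h5 : (p.comp (X + C a) - p).degree < N := by
      rw [h4, degree_neg, degree_C_mul hκ0, ← taylor_apply, degree_taylor]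
      exact hqdeg
    have h6 := degree_lt_of_degree_comp_sub_lt ha0 h5
    rw [degree_lt_iff_coeff_zero] at h6
    by_contra h7
    exact hpk (h6 k (by simpa using h7))

/-- For a finite-dimensional invariant subspace, the degrees and the imaginary parts of the
frequencies of equivariant exponential polynomials are uniformly bounded. -/
theorem exists_equivariant_bound {g : Module.End ℂ V} {U : Submodule ℂ V} [FiniteDimensional ℂ U]
    (hU : ∀ u ∈ U, g u ∈ U) :
    ∃ (K : ℕ) (B : ℝ), ∀ (c : V →ₗ[ℂ] (ℕ × ℂ → ℂ)), (∀ u, (c u).support.Finite) →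
      (∀ u s, ∑ᶠ i, c (g u) i * expMonomial i (s + 2 * Real.pi * Complex.I)
        = ∑ᶠ i, c u i * expMonomial i s) →
      ∀ u ∈ U, ∀ i, c u i ≠ 0 → i.1 < K ∧ |i.2.im| ≤ B := by
  set f : Module.End ℂ U := g.restrict hU
  have hfinE : {l : ℂ | f.HasEigenvalue l}.Finite := Module.End.finite_hasEigenvalue f
  -- Absolute values in `e^{2πi m} l = 1` give `Im m = log |l| / 2π`, and only finitely many
  -- eigenvalues `l` occur on `U`.
  obtain ⟨B, hB⟩ := (hfinE.image fun l => |Real.log ‖l‖ / (2 * Real.pi)|).bddAbove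
  refine ⟨Module.finrank ℂ U, B, fun c hfin heq => ?_⟩
  have key : ∀ i : ℕ × ℂ, ¬ (i.1 < Module.finrank ℂ U ∧ |i.2.im| ≤ B) →
      ∀ u : U, c u i = 0 := by
    intro i hi
    -- For a forbidden index the coefficient is a linear functional on `U`, so it suffices that it
    -- vanishes on each generalized eigenspace.
    have h1 : (⊤ : Submodule ℂ U) ≤ LinearMap.ker (LinearMap.proj i ∘ₗ c ∘ₗ U.subtype) := by
      rw [← Module.End.iSup_maxGenEigenspace_eq_top f, iSup_le_iff]
      intro l u hu
      rw [LinearMap.mem_ker]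
      simp only [LinearMap.comp_apply, Submodule.subtype_apply, LinearMap.proj_apply]
      by_contra h2
      rw [Module.End.maxGenEigenspace_eq_genEigenspace_finrank,
        Module.End.mem_genEigenspace_nat] at hu
      have h3 : ∀ (N : ℕ) (u : U), (((f - l • (1 : Module.End ℂ U)) ^ N) u : V)
          = ((g - l • LinearMap.id : Module.End ℂ V) ^ N) u := by
        intro N
        induction N with
        | zero => simp
        | succ N ih =>
          intro u
          rw [pow_succ, pow_succ, Module.End.mul_apply, Module.End.mul_apply, ih]
          simp [f]
      have h4 := equivariant_support hfin heq (l := l) (Module.finrank ℂ U) u (by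
        rw [← h3, LinearMap.mem_ker.1 hu, Submodule.coe_zero]) i h2
      refine hi ⟨h4.1, ?_⟩
      have hl : f.HasEigenvalue l := by
        refine Module.End.hasEigenvalue_of_hasGenEigenvalue (k := Module.finrank ℂ U) ?_
        intro h5
        rw [← Module.End.mem_genEigenspace_nat] at hu
        rw [h5, Submodule.mem_bot] at hu
        rw [hu] at h2
        simp at h2
      have h6 : |Real.log ‖l‖ / (2 * Real.pi)| ≤ B := hB ⟨l, hl, rfl⟩
      refine le_of_eq_of_le ?_ h6
      have h7 := congrArg norm h4.2
      rw [norm_mul, Complex.norm_exp, norm_one] at h7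
      have h8 : (i.2 * (2 * Real.pi * Complex.I)).re = -(2 * Real.pi * i.2.im) := by
        simp; ring
      rw [h8] at h7
      have h9 : ‖l‖ = Real.exp (2 * Real.pi * i.2.im) := by
        rw [Real.exp_neg] at h7
        field_simp at h7
        exact h7
      rw [h9, Real.log_exp]
      congr 1
      field_simp
    intro u
    have := h1 (Submodule.mem_top : u ∈ ⊤)
    simpa using this
  intro u hu i hi
  by_contra h
  exact hi (key i h ⟨u, hu⟩)

end Equivariant

/-! ## Projections of graded spaces -/

section GradedProj

variable {ι W : Type*} [DecidableEq ι] [AddCommGroup W] [Module ℂ W]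
  {𝒲 : ι → Submodule ℂ W} (h : DirectSum.IsInternal 𝒲)

theorem gradedProj_coeLinearMap (n : ι) (x : DirectSum ι fun i => 𝒲 i) :
    gradedProj 𝒲 h n (DirectSum.coeLinearMap 𝒲 x) = x n := by
  have : (LinearEquiv.ofBijective (DirectSum.coeLinearMap 𝒲) h).symm
      (DirectSum.coeLinearMap 𝒲 x) = x :=
    (LinearEquiv.ofBijective (DirectSum.coeLinearMap 𝒲) h).symm_apply_apply x
  simp only [gradedProj, LinearMap.comp_apply, LinearEquiv.coe_coe, this]
  rfl

theorem gradedProj_mem (n : ι) (w : W) : gradedProj 𝒲 h n w ∈ 𝒲 n := Subtype.coe_prop _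

theorem gradedProj_of_mem {n : ι} {w : W} (hw : w ∈ 𝒲 n) (m : ι) :
    gradedProj 𝒲 h m w = if m = n then w else 0 := by
  have h1 : w = DirectSum.coeLinearMap 𝒲 (DirectSum.lof ℂ ι (fun i => 𝒲 i) n ⟨w, hw⟩) := by
    rw [DirectSum.coeLinearMap_lof]
  conv_lhs => rw [h1, gradedProj_coeLinearMap]
  rw [DirectSum.lof_eq_of]
  split_ifs with hmn
  · subst hmn
    rw [DirectSum.of_eq_same]
  · rw [DirectSum.of_eq_of_ne _ _ _ hmn]
    rfl

theorem gradedProj_gradedProj (m n : ι) (w : W) :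
    gradedProj 𝒲 h m (gradedProj 𝒲 h n w) = if m = n then gradedProj 𝒲 h n w else 0 :=
  gradedProj_of_mem h (gradedProj_mem h n w) m

theorem gradedProj_eq_sum (w : W) :
    ∃ F : Finset ι, (∀ n ∉ F, gradedProj 𝒲 h n w = 0) ∧ w = ∑ n ∈ F, gradedProj 𝒲 h n w := by
  classical
  obtain ⟨x, rfl⟩ := h.2 w
  refine ⟨DFinsupp.support x, fun n hn => ?_, ?_⟩
  · change gradedProj 𝒲 h n (DirectSum.coeLinearMap 𝒲 x) = 0
    rw [gradedProj_coeLinearMap]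
    have : x n = 0 := by simpa using hn
    rw [this]
    rfl
  · change DirectSum.coeLinearMap 𝒲 x
      = ∑ n ∈ DFinsupp.support x, gradedProj 𝒲 h n (DirectSum.coeLinearMap 𝒲 x)
    simp only [gradedProj_coeLinearMap]
    exact DirectSum.coeLinearMap_eq_dfinsuppSum 𝒲 x

theorem eq_zero_of_gradedProj_eq_zero {w : W} (hw : ∀ n, gradedProj 𝒲 h n w = 0) : w = 0 := by
  obtain ⟨F, -, hF⟩ := gradedProj_eq_sum h w
  rw [hF]
  exact Finset.sum_eq_zero fun n _ => hw n

theorem dual_comp_gradedProj_mem (ψ : Module.Dual ℂ W) (n : ι) :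
    ψ ∘ₗ gradedProj 𝒲 h n ∈ gradedDual 𝒲 := by
  refine (Set.finite_singleton n).subset ?_
  rintro m ⟨w, hw, h1⟩
  by_contra hmn
  rw [LinearMap.comp_apply, gradedProj_of_mem h hw, if_neg (fun h => hmn h.symm), map_zero] at h1
  exact h1 rfl

theorem gradedDual_apply_eq_sum {φ : Module.Dual ℂ W} (hφ : φ ∈ gradedDual 𝒲) :
    ∃ F : Finset ι, (∀ n ∉ F, ∀ w, φ (gradedProj 𝒲 h n w) = 0) ∧
      ∀ w, φ w = ∑ n ∈ F, φ (gradedProj 𝒲 h n w) := by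
  classical
  have h1 : ∀ n ∉ hφ.toFinset, ∀ w, φ (gradedProj 𝒲 h n w) = 0 := by
    intro n hn w
    by_contra h2
    exact hn (hφ.mem_toFinset.2 ⟨_, gradedProj_mem h n w, h2⟩)
  refine ⟨hφ.toFinset, h1, fun w => ?_⟩
  obtain ⟨G, hG, hw⟩ := gradedProj_eq_sum h w
  conv_lhs => rw [hw, map_sum]
  refine (Finset.sum_subset Finset.subset_union_left fun n _ hn => ?_).trans
    (Finset.sum_subset Finset.subset_union_right fun n _ hn => h1 n hn w).symm
  rw [hG n hn, map_zero]

end GradedProj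

/-! ## Branches of the logarithm -/

section LogBranch

theorem arg₀_eq_of_im_nonneg {z : ℂ} (hz : 0 ≤ z.im) : arg₀ z = z.arg :=
  if_pos (Complex.arg_nonneg_iff.2 hz)

theorem arg₀_eq_of_im_neg {z : ℂ} (hz : z.im < 0) : arg₀ z = z.arg + 2 * Real.pi :=
  if_neg (not_le.2 (Complex.arg_neg_iff.2 hz))

theorem logBranch_re (p : ℤ) (z : ℂ) : (logBranch p z).re = Real.log ‖z‖ := by
  simp [logBranch]

theorem logBranch_add_one (p : ℤ) (z : ℂ) :
    logBranch (p + 1) z = logBranch p z + 2 * Real.pi * Complex.I := by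
  simp only [logBranch, Int.cast_add, Int.cast_one]
  ring

theorem logBranch_zero_of_im_nonneg {z : ℂ} (hz : 0 ≤ z.im) : logBranch 0 z = Complex.log z := by
  simp [logBranch, arg₀_eq_of_im_nonneg hz, Complex.log]

theorem logBranch_zero_of_im_neg {z : ℂ} (hz : z.im < 0) :
    logBranch 0 z = Complex.log z + 2 * Real.pi * Complex.I := by
  simp only [logBranch, arg₀_eq_of_im_neg hz, Complex.log]
  push_cast
  ring

theorem exp_logBranch (p : ℤ) {z : ℂ} (hz : z ≠ 0) : Complex.exp (logBranch p z) = z := by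
  have h1 : ∀ z : ℂ, z ≠ 0 → Complex.exp (logBranch 0 z) = z := by
    intro z hz
    rcases le_or_gt 0 z.im with h | h
    · rw [logBranch_zero_of_im_nonneg h, Complex.exp_log hz]
    · rw [logBranch_zero_of_im_neg h, Complex.exp_add, Complex.exp_two_pi_mul_I, mul_one,
        Complex.exp_log hz]
  have h2 : logBranch p z = logBranch 0 z + p * (2 * Real.pi * Complex.I) := by
    simp only [logBranch, Int.cast_zero]
    ring
  rw [h2, Complex.exp_add, Complex.exp_int_mul_two_pi_mul_I, mul_one, h1 z hz]

/-- Identities for all branches `p` thereby become identities in one complex variable `s = log z`.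
-/
theorem exists_eq_logBranch (s : ℂ) : ∃ p : ℤ, s = logBranch p (Complex.exp s) := by
  obtain ⟨n, hn⟩ := Complex.exp_eq_exp_iff_exists_int.1
    (exp_logBranch 0 (Complex.exp_ne_zero s)).symm
  refine ⟨n, ?_⟩
  conv_lhs => rw [hn]
  simp only [logBranch, Int.cast_zero]
  ring

theorem logBranch_zero_neg_exp (ρ : ℝ) :
    logBranch 0 (-(Real.exp ρ : ℂ)) = ρ + Real.pi * Complex.I := by
  rw [logBranch_zero_of_im_nonneg (by simp [Complex.exp_ofReal_im]), ← Complex.ofReal_neg,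
    Complex.log, Complex.arg_ofReal_of_neg (by simpa using Real.exp_pos ρ)]
  simp

theorem logTerm_eq {A : Type*} [AddCommGroup A] [Module ℂ A] (p : ℤ) (z : ℂ) (f : LogSeries A)
    (i : ℕ × ℂ) : logTerm p z f i = expMonomial i (logBranch p z) • f i.1 i.2 := rfl

end LogBranch

/-! ## Series of exponential monomials -/

section ExpSeries

variable {ι : Type*} {a : ι → ℂ} {e : ι → ℕ × ℂ} {K : ℕ} {B : ℝ} {I : Set ℝ}

/-- A real exponential is monotone, so on `[α, β]` it is dominated by the sum of its values at the
endpoints, whatever the sign of the exponent. The remaining factors are bounded independently of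
`x`. -/
theorem norm_mul_expMonomial_le (hb : ∀ x, a x ≠ 0 → (e x).1 < K ∧ |(e x).2.im| ≤ B) {M : ℝ}
    (hM : 1 ≤ M) {α β : ℝ} {s : ℂ} (hsM : ‖s‖ ≤ M) (hα : α ≤ s.re) (hβ : s.re ≤ β) (x : ι) :
    ‖a x * expMonomial (e x) s‖ ≤ (‖a x‖ * Real.exp ((e x).2.re * α)
      + ‖a x‖ * Real.exp ((e x).2.re * β)) * (Real.exp (B * M) * M ^ K) := by
  by_cases hx : a x = 0
  · simp [hx]
  obtain ⟨h1, h2⟩ := hb x hx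
  rw [expMonomial, norm_mul, norm_mul, norm_pow, Complex.norm_exp, ← mul_add, mul_assoc]
  gcongr ?_ * ?_
  have h3 : Real.exp ((e x).2.re * s.re) ≤
      Real.exp ((e x).2.re * α) + Real.exp ((e x).2.re * β) := by
    rcases le_total 0 (e x).2.re with h | h
    · have := Real.exp_le_exp.2 (mul_le_mul_of_nonneg_left hβ h)
      linarith [Real.exp_pos ((e x).2.re * α)]
    · have := Real.exp_le_exp.2 (mul_le_mul_of_nonpos_left hα h)
      linarith [Real.exp_pos ((e x).2.re * β)]
  have h4 : -((e x).2.im * s.im) ≤ B * M := by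
    refine (neg_le_abs _).trans ?_
    rw [abs_mul]
    exact mul_le_mul h2 ((Complex.abs_im_le_norm s).trans hsM) (abs_nonneg _)
      ((abs_nonneg _).trans h2)
  have h5 : ‖s‖ ^ (e x).1 ≤ M ^ K :=
    (pow_le_pow_left₀ (norm_nonneg s) hsM _).trans (pow_le_pow_right₀ hM h1.le)
  rw [Complex.mul_re, sub_eq_add_neg, Real.exp_add, mul_assoc]
  gcongr

/-- A series of exponential monomials with bounded degrees and bounded imaginary parts of the
frequencies that converges absolutely for all real parts in the open set `I` is analytic. -/
theorem expSeries_summable_and_differentiableOn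
    (hb : ∀ x, a x ≠ 0 → (e x).1 < K ∧ |(e x).2.im| ≤ B) (hI : IsOpen I)
    (hs : ∀ ρ ∈ I, Summable fun x => ‖a x‖ * Real.exp ((e x).2.re * ρ)) :
    (∀ s : ℂ, s.re ∈ I → Summable fun x => a x * expMonomial (e x) s) ∧
      DifferentiableOn ℂ (fun s => ∑' x, a x * expMonomial (e x) s) {s | s.re ∈ I} := by
  refine ⟨fun s hsI => ?_, fun s₀ hs₀ => ?_⟩
  · refine Summable.of_norm_bounded (((hs s.re hsI).add (hs s.re hsI)).mul_right _) fun x =>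
      norm_mul_expMonomial_le hb (M := ‖s‖ + 1) ?_ ?_ le_rfl le_rfl x
    · linarith [norm_nonneg s]
    · linarith
  · obtain ⟨ε, hε, hεI⟩ := Metric.isOpen_iff.1 hI _ hs₀
    have hmem : ∀ ρ, |ρ - s₀.re| ≤ ε / 2 → ρ ∈ I := fun ρ hρ => hεI (by
      rw [Metric.mem_ball, Real.dist_eq]
      linarith)
    have h1 : s₀.re - ε / 2 ∈ I := hmem _ (by
      rw [sub_sub_cancel_left, abs_neg, abs_of_pos (by linarith)])
    have h2 : s₀.re + ε / 2 ∈ I := hmem _ (by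
      rw [add_sub_cancel_left, abs_of_pos (by linarith)])
    set δ := min (ε / 2) 1 with hδ
    have hδ0 : 0 < δ := lt_min (by linarith) one_pos
    have h3 : DifferentiableOn ℂ (fun s => ∑' x, a x * expMonomial (e x) s)
        (Metric.ball s₀ δ) := by
      refine Complex.differentiableOn_tsum_of_summable_norm
        (((hs _ h1).add (hs _ h2)).mul_right (Real.exp (B * (‖s₀‖ + 1)) * (‖s₀‖ + 1) ^ K))
        (fun x => ?_) Metric.isOpen_ball fun x s hs' => ?_
      · unfold expMonomial
        fun_prop
      · rw [Metric.mem_ball, dist_eq_norm] at hs'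
        have h4 : |s.re - s₀.re| ≤ ε / 2 := by
          have := Complex.abs_re_le_norm (s - s₀)
          rw [Complex.sub_re] at this
          linarith [min_le_left (ε / 2) 1]
        rw [abs_le] at h4
        refine norm_mul_expMonomial_le hb (by linarith [norm_nonneg s₀]) ?_ (by linarith)
          (by linarith) x
        have := norm_add_le s₀ (s - s₀)
        rw [add_sub_cancel] at this
        linarith [min_le_right (ε / 2) 1]
    exact (h3.differentiableAt (Metric.ball_mem_nhds s₀ hδ0)).differentiableWithinAt

/-- At `s = ρ + πi` we have `|s| ≥ π > 1`, so discarding the powers of `s` only decreases the terms.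
The imaginary parts of the exponents cost at most the factor `e^{Bπ}`. -/
theorem summable_norm_mul_exp_of_summable
    (hb : ∀ x, a x ≠ 0 → (e x).1 < K ∧ |(e x).2.im| ≤ B) {ρ : ℝ}
    (hs : Summable fun x => a x * expMonomial (e x) (ρ + Real.pi * Complex.I)) :
    Summable fun x => ‖a x‖ * Real.exp ((e x).2.re * ρ) := by
  refine Summable.of_nonneg_of_le (fun x => by positivity) (fun x => ?_)
    (hs.norm.mul_left (Real.exp (B * Real.pi)))
  by_cases hx : a x = 0
  · simp [hx]
  obtain ⟨-, h2⟩ := hb x hx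
  have h3 : 1 ≤ ‖(ρ + Real.pi * Complex.I : ℂ)‖ ^ (e x).1 := by
    refine one_le_pow₀ ?_
    have := Complex.abs_im_le_norm (ρ + Real.pi * Complex.I : ℂ)
    simp only [Complex.add_im, Complex.ofReal_im, Complex.mul_im, Complex.I_im, mul_one,
      Complex.ofReal_re, Complex.I_re, mul_zero, zero_add, add_zero] at this
    rw [abs_of_pos Real.pi_pos] at this
    linarith [Real.pi_gt_three]
  have h4 : 1 ≤ Real.exp (B * Real.pi - (e x).2.im * Real.pi) := by
    rw [Real.one_le_exp_iff, ← sub_mul]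
    have := le_abs_self (e x).2.im
    exact mul_nonneg (by linarith) Real.pi_pos.le
  rw [expMonomial, norm_mul, norm_mul, norm_pow, Complex.norm_exp]
  have h5 : ((e x).2 * (ρ + Real.pi * Complex.I)).re
      = (e x).2.re * ρ - (e x).2.im * Real.pi := by
    simp
  rw [h5]
  calc ‖a x‖ * Real.exp ((e x).2.re * ρ)
      ≤ ‖a x‖ * Real.exp ((e x).2.re * ρ) * (Real.exp (B * Real.pi - (e x).2.im * Real.pi)
        * ‖(ρ + Real.pi * Complex.I : ℂ)‖ ^ (e x).1) :=
        le_mul_of_one_le_right (by positivity) (one_le_mul_of_one_le_of_one_le h4 h3)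
    _ = _ := by
      rw [Real.exp_sub, Real.exp_sub]
      field_simp

end ExpSeries

/-! ## Analytic continuation of twisted vertex operators -/

namespace TwistedModule

variable {V : Type*} [AddCommGroup V] [Module ℂ V] {𝒱 : VertexOperatorAlgebra V}
  {g : 𝒱.Aut} {W : Type*} [AddCommGroup W] [Module ℂ W] (M : TwistedModule 𝒱 g W)

/-- The matrix coefficients `⟨φ, Y(u, x) w⟩`. -/
noncomputable def matrixCoeff (φ : Module.Dual ℂ W) (w : W) : V →ₗ[ℂ] (ℕ × ℂ → ℂ) where
  toFun u i := φ (M.Y u w i.1 i.2)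
  map_add' u v := by
    funext i
    simp
  map_smul' r u := by
    funext i
    simp

theorem matrixCoeff_apply (φ : Module.Dual ℂ W) (w : W) (u : V) (i : ℕ × ℂ) :
    M.matrixCoeff φ w u i = φ (M.Y u w i.1 i.2) := rfl

theorem finite_matrixCoeff {φ : Module.Dual ℂ W} (hφ : φ ∈ gradedDual M.grading) (w : W) (u : V) :
    (M.matrixCoeff φ w u).support.Finite := by
  obtain ⟨F, -, hF⟩ := gradedDual_apply_eq_sum M.isInternal hφ
  refine (F.finite_toSet.biUnion fun n _ => M.finite_components u w n).subset fun i hi => ?_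
  rw [Function.mem_support, matrixCoeff_apply, hF] at hi
  obtain ⟨n, hn, h1⟩ := Finset.exists_ne_zero_of_sum_ne_zero hi
  simp only [Set.mem_iUnion]
  exact ⟨n, hn, fun h2 => h1 (by rw [h2, map_zero])⟩

theorem matrixCoeff_equivariant {φ : Module.Dual ℂ W} (hφ : φ ∈ gradedDual M.grading) (w : W)
    (u : V) (s : ℂ) :
    ∑ᶠ i, M.matrixCoeff φ w (g.1 u) i * expMonomial i (s + 2 * Real.pi * Complex.I)
      = ∑ᶠ i, M.matrixCoeff φ w u i * expMonomial i s := by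
  obtain ⟨F, -, hF⟩ := gradedDual_apply_eq_sum M.isInternal hφ
  obtain ⟨p, hp⟩ := exists_eq_logBranch s
  have key : ∀ (p : ℤ) (z : ℂ) (v : V),
      ∑ᶠ i, M.matrixCoeff φ w v i * expMonomial i (logBranch p z)
        = ∑ n ∈ F, φ (∑ᶠ i, gradedProj M.grading M.isInternal n (logTerm p z (M.Y v w) i)) := by
    intro p z v
    have h1 : ∀ n, (Function.support fun i =>
        gradedProj M.grading M.isInternal n (logTerm p z (M.Y v w) i)).Finite := by
      intro n
      refine (M.finite_components v w n).subset fun i hi => ?_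
      rw [Function.mem_support, logTerm_eq, map_smul] at hi
      exact right_ne_zero_of_smul hi
    simp_rw [fun n => map_finsum φ (h1 n)]
    rw [← finsum_sum_comm]
    · refine finsum_congr fun i => ?_
      simp only [logTerm_eq, map_smul]
      rw [← Finset.smul_sum, ← hF, matrixCoeff_apply, smul_eq_mul, mul_comm]
    · intro n _
      exact (h1 n).subset fun i hi h2 => hi (by simp only [h2, map_zero])
  have h2 : s + 2 * Real.pi * Complex.I = logBranch (p + 1) (Complex.exp s) := by
    rw [logBranch_add_one, ← hp]
  rw [h2, key]
  conv_rhs => rw [hp, key]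
  simp_rw [M.equivariance p _ (Complex.exp_ne_zero s) u w]

variable {β : Type*}

/-- The series `∑ ⟨φ_b, Y(u, z) w_b⟩`, expanded in monomials, at `z = e ^ s`. -/
noncomputable def coeffSeries (φ : β → Module.Dual ℂ W) (w : β → W) (u : V) (s : ℂ) : ℂ :=
  ∑' x : β × (ℕ × ℂ), M.matrixCoeff (φ x.1) (w x.1) u x.2 * expMonomial x.2 s

variable {M} {φ : β → Module.Dual ℂ W} {w : β → W} {U : Submodule ℂ V}
  {I : Set ℝ}

/-- If `∑ ⟨φ_b, Y(u, z) w_b⟩` converges absolutely for `log ‖z‖ ∈ I`, for the preferred branch and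
for all `u` in a finite-dimensional `g`-invariant subspace, then it has an analytic continuation
with the monodromy `g⁻¹`. -/
theorem coeffSeries_continuation [FiniteDimensional ℂ U] (hU : ∀ u ∈ U, g.1 u ∈ U)
    (hφ : ∀ b, φ b ∈ gradedDual M.grading) (hI : IsOpen I)
    (hs : ∀ u ∈ U, ∀ z : ℂ, z ≠ 0 → Real.log ‖z‖ ∈ I →
      Summable fun x : β × (ℕ × ℂ) =>
        M.matrixCoeff (φ x.1) (w x.1) u x.2 * expMonomial x.2 (logBranch 0 z)) :
    (∀ u ∈ U, ∀ s : ℂ, s.re ∈ I → Summable fun x : β × (ℕ × ℂ) =>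
        M.matrixCoeff (φ x.1) (w x.1) u x.2 * expMonomial x.2 s) ∧
      (∀ u ∈ U, DifferentiableOn ℂ (M.coeffSeries φ w u) {s | s.re ∈ I}) ∧
      ∀ u ∈ U, ∀ s : ℂ, s.re ∈ I →
        M.coeffSeries φ w (g.1 u) (s + 2 * Real.pi * Complex.I) = M.coeffSeries φ w u s := by
  obtain ⟨K, B, hKB⟩ := exists_equivariant_bound (g := (g.1 : V →ₗ[ℂ] V)) hU
  have hb : ∀ u ∈ U, ∀ x : β × (ℕ × ℂ), M.matrixCoeff (φ x.1) (w x.1) u x.2 ≠ 0 →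
      x.2.1 < K ∧ |x.2.2.im| ≤ B := fun u hu x hx =>
    hKB (M.matrixCoeff (φ x.1) (w x.1)) (M.finite_matrixCoeff (hφ _) _)
      (M.matrixCoeff_equivariant (hφ _) _) u hu x.2 hx
  have hs' : ∀ u ∈ U, ∀ ρ ∈ I, Summable fun x : β × (ℕ × ℂ) =>
      ‖M.matrixCoeff (φ x.1) (w x.1) u x.2‖ * Real.exp (x.2.2.re * ρ) := by
    intro u hu ρ hρ
    refine summable_norm_mul_exp_of_summable (e := fun x : β × (ℕ × ℂ) => x.2) (hb u hu) ?_
    -- On the circle of radius `e^ρ` the hypothesis is needed only at the point `-e^ρ`.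
    rw [← logBranch_zero_neg_exp]
    refine hs u hu _ (by simp [Complex.exp_ne_zero]) ?_
    rw [norm_neg, Complex.norm_real, Real.norm_eq_abs, Real.abs_exp, Real.log_exp]
    exact hρ
  have hmain := fun u hu => expSeries_summable_and_differentiableOn
    (e := fun x : β × (ℕ × ℂ) => x.2) (hb u hu) hI (hs' u hu)
  refine ⟨fun u hu => (hmain u hu).1, fun u hu => (hmain u hu).2, fun u hu s hsI => ?_⟩
  -- Grouped by `b`, the series is a sum of finite exponential polynomials, each of which is
  -- equivariant by itself.
  have hsum : ∀ u ∈ U, ∀ s : ℂ, s.re ∈ I → M.coeffSeries φ w u s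
      = ∑' b, ∑ᶠ i, M.matrixCoeff (φ b) (w b) u i * expMonomial i s := by
    intro u hu s hsI
    rw [coeffSeries, ((hmain u hu).1 s hsI).tsum_prod]
    refine tsum_congr fun b => tsum_eq_finsum ?_
    exact (M.finite_matrixCoeff (hφ b) (w b) u).subset fun i hi => left_ne_zero_of_mul hi
  rw [hsum _ (hU u hu) _ (by simpa using hsI), hsum u hu s hsI]
  exact tsum_congr fun b => M.matrixCoeff_equivariant (hφ b) (w b) u s

end TwistedModule

/-! ## Comparison of the monodromies -/

section Monodromy

theorem eqOn_of_eqOn_isOpen {f h : ℂ → ℂ} {U V : Set ℂ} (hU : IsOpen U) (hUc : IsPreconnected U)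
    (hf : DifferentiableOn ℂ f U) (hh : DifferentiableOn ℂ h U) (hV : IsOpen V) (hVU : V ⊆ U)
    (hne : V.Nonempty) (hfh : Set.EqOn f h V) : Set.EqOn f h U := by
  obtain ⟨z, hz⟩ := hne
  exact (hf.analyticOnNhd hU).eqOn_of_preconnected_of_eventuallyEq (hh.analyticOnNhd hU) hUc
    (hVU hz) (hfh.eventuallyEq_of_mem (hV.mem_nhds hz))

theorem isOpen_re_gt (a : ℝ) : IsOpen {z : ℂ | a < z.re} :=
  isOpen_lt continuous_const Complex.continuous_re

theorem isOpen_im_gt (a : ℝ) : IsOpen {z : ℂ | a < z.im} :=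
  isOpen_lt continuous_const Complex.continuous_im

theorem isOpen_im_lt (a : ℝ) : IsOpen {z : ℂ | z.im < a} :=
  isOpen_lt Complex.continuous_im continuous_const

theorem lt_norm_of_sq {z : ℂ} {t : ℝ} (h : t ^ 2 < z.re ^ 2 + z.im ^ 2) : t < ‖z‖ := by
  refine lt_of_pow_lt_pow_left₀ 2 (norm_nonneg z) ?_
  rw [Complex.sq_norm, Complex.normSq_apply]
  linarith

theorem norm_lt_of_sq {z : ℂ} {t : ℝ} (ht : 0 ≤ t) (h : z.re ^ 2 + z.im ^ 2 < t ^ 2) :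
    ‖z‖ < t := by
  refine lt_of_pow_lt_pow_left₀ 2 ht ?_
  rw [Complex.sq_norm, Complex.normSq_apply]
  linarith

theorem norm_pos_of_re_pos {z : ℂ} (h : 0 < z.re) : 0 < ‖z‖ :=
  h.trans_le (Complex.re_le_norm z)

theorem differentiableOn_comp_log_add {P : ℂ → ℂ} {I : Set ℝ} {U : Set ℂ} {c : ℂ} (hI : IsOpen I)
    (hP : DifferentiableOn ℂ P {s | s.re ∈ I}) (w : ℂ) (hc : c.re = 0)
    (hU : ∀ z ∈ U, 0 < (z - w).re ∧ Real.log ‖z - w‖ ∈ I) :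
    DifferentiableOn ℂ (fun z => P (Complex.log (z - w) + c)) U := by
  intro z hz
  obtain ⟨h1, h2⟩ := hU z hz
  have h3 : DifferentiableAt ℂ P (Complex.log (z - w) + c) :=
    hP.differentiableAt ((hI.preimage Complex.continuous_re).mem_nhds (by
      simpa [Complex.log_re, hc] using h2))
  have h4 : DifferentiableAt ℂ (fun z => Complex.log (z - w) + c) z :=
    (((differentiableAt_id).sub_const w).clog (Or.inl h1)).add_const c
  exact (h3.comp z h4).differentiableWithinAt

theorem abs_arg₀_sub_lt {z w : ℂ} (hz : 0 < z.re) (hw : 0 < w.re)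
    (h : (0 < z.im ∧ 0 < w.im) ∨ (z.im < 0 ∧ w.im < 0)) :
    |arg₀ z - arg₀ w| < Real.pi / 2 := by
  have h1 := abs_lt.1 (Complex.abs_arg_lt_pi_div_two_iff.2 (Or.inl hz))
  have h2 := abs_lt.1 (Complex.abs_arg_lt_pi_div_two_iff.2 (Or.inl hw))
  rw [abs_lt]
  rcases h with ⟨h3, h4⟩ | ⟨h3, h4⟩
  · rw [arg₀_eq_of_im_nonneg h3.le, arg₀_eq_of_im_nonneg h4.le]
    have h5 := Complex.arg_nonneg_iff.2 h3.le
    have h6 := Complex.arg_nonneg_iff.2 h4.le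
    constructor <;> linarith
  · rw [arg₀_eq_of_im_neg h3, arg₀_eq_of_im_neg h4]
    have h5 := Complex.arg_neg_iff.2 h3
    have h6 := Complex.arg_neg_iff.2 h4
    constructor <;> linarith

variable {t : ℝ} {ζ : ℂ}

/-- Continuation across the cut `z - ζ ∈ ℝ₊`, where `ζ = -it`. -/
theorem eqOn_of_monodromy_around_point (ht : 0 < t) (hζ : ζ = -(t * Complex.I))
    {Pa Ia Iu fa fu : ℂ → ℂ}
    (hPa : DifferentiableOn ℂ Pa {s | s.re ∈ Set.Ioi (Real.log t)})
    (hIa : DifferentiableOn ℂ Ia {s | s.re ∈ Set.Iio (Real.log t)})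
    (hIau : ∀ s : ℂ, s.re ∈ Set.Iio (Real.log t) → Ia (s + 2 * Real.pi * Complex.I) = Iu s)
    (hfPa : ∀ z, t < ‖z‖ → |arg₀ (z - ζ) - arg₀ z| < Real.pi / 2 → fa z = Pa (logBranch 0 z))
    (hfIa : ∀ z, 0 < ‖z - ζ‖ → ‖z - ζ‖ < t → fa z = Ia (logBranch 0 (z - ζ)))
    (hfIu : ∀ z, 0 < ‖z - ζ‖ → ‖z - ζ‖ < t → fu z = Iu (logBranch 0 (z - ζ)))
    (hfu : DifferentiableOn ℂ fu {z | -t < z.im ∧ z.im < 0}) {z : ℂ} (hre : t < z.re)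
    (him : -t < z.im) (him' : z.im < 0) :
    fu z = Pa (Complex.log z + 2 * Real.pi * Complex.I) := by
  have hζre : ζ.re = 0 := by simp [hζ]
  have hζim : ζ.im = -t := by simp [hζ]
  have hc : (2 * Real.pi * Complex.I : ℂ).re = 0 := by simp
  have hPd : ∀ U : Set ℂ, (∀ z ∈ U, 0 < z.re ∧ t < ‖z‖) →
      DifferentiableOn ℂ (fun z => Pa (Complex.log z + 2 * Real.pi * Complex.I)) U := by
    intro U hU
    have := differentiableOn_comp_log_add (U := U) isOpen_Ioi hPa 0 hc
      (fun z hz => by simpa using ⟨(hU z hz).1, Real.log_lt_log ht (hU z hz).2⟩)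
    simpa using this
  -- The ball of radius `t / 10` around this point of the cut lies both in `|z| > t` and in `0 < |z
  -- - ζ| < t`, so product and iterate can be compared there.
  set z₀ : ℂ := ζ + (4 * t / 5 : ℝ) with hz₀
  have hball : ∀ z ∈ Metric.ball z₀ (t / 10), (7 * t / 10 < z.re ∧ z.re < 9 * t / 10) ∧
      (-(11 * t / 10) < z.im ∧ z.im < -(9 * t / 10)) := by
    intro z hz
    rw [Metric.mem_ball, dist_eq_norm] at hz
    have h1 := abs_lt.1 ((Complex.abs_re_le_norm _).trans_lt hz)
    have h2 := abs_lt.1 ((Complex.abs_im_le_norm _).trans_lt hz)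
    simp only [hz₀, Complex.sub_re, Complex.add_re, hζre, Complex.ofReal_re, Complex.sub_im,
      Complex.add_im, hζim, Complex.ofReal_im] at h1 h2
    refine ⟨⟨?_, ?_⟩, ?_, ?_⟩ <;> linarith
  have hball' : ∀ z ∈ Metric.ball z₀ (t / 10), 0 < z.re ∧ t < ‖z‖ ∧ 0 < (z - ζ).re ∧
      0 < ‖z - ζ‖ ∧ ‖z - ζ‖ < t := by
    intro z hz
    obtain ⟨⟨h1, h2⟩, h3, h4⟩ := hball z hz
    have h5 : 0 < (z - ζ).re := by
      rw [Complex.sub_re, hζre]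
      linarith
    refine ⟨by linarith, lt_norm_of_sq ?_, h5, norm_pos_of_re_pos h5, norm_lt_of_sq ht.le ?_⟩
    · nlinarith
    · rw [Complex.sub_re, Complex.sub_im, hζre, hζim]
      nlinarith
  have hdist : ∀ y : ℝ, |y| < t / 10 → z₀ + y * Complex.I ∈ Metric.ball z₀ (t / 10) := by
    intro y hy
    rw [Metric.mem_ball, dist_eq_norm, add_sub_cancel_left]
    simpa using hy
  -- Below the cut both sides equal `fa`, with all points in the lower half planes of `z` and `z -
  -- ζ`; this explains the two `2πi`. Both sides are analytic across the cut.
  have step : Set.EqOn (fun z => Pa (Complex.log z + 2 * Real.pi * Complex.I))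
      (fun z => Ia (Complex.log (z - ζ) + 2 * Real.pi * Complex.I)) (Metric.ball z₀ (t / 10)) := by
    refine eqOn_of_eqOn_isOpen (V := Metric.ball z₀ (t / 10) ∩ {z | z.im < -t}) Metric.isOpen_ball
      (convex_ball _ _).isPreconnected (hPd _ fun z hz => ⟨(hball' z hz).1, (hball' z hz).2.1⟩)
      (differentiableOn_comp_log_add isOpen_Iio hIa ζ hc fun z hz => ?_)
      (Metric.isOpen_ball.inter (isOpen_im_lt _)) Set.inter_subset_left
      ⟨z₀ + (-(t / 20) : ℝ) * Complex.I, hdist _ ?_, ?_⟩ ?_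
    · obtain ⟨-, -, h1, h2, h3⟩ := hball' z hz
      exact ⟨h1, Real.log_lt_log h2 h3⟩
    · rw [abs_neg, abs_of_pos (by linarith)]
      linarith
    · simp [hz₀, hζim]
      linarith
    · rintro z ⟨hz, hz'⟩
      rw [Set.mem_ofPred_eq] at hz'
      obtain ⟨h1, h2, h3, h4, h5⟩ := hball' z hz
      have h6 : (z - ζ).im < 0 := by
        rw [Complex.sub_im, hζim]
        linarith
      have h7 : z.im < 0 := by linarith
      simp only
      rw [← logBranch_zero_of_im_neg h7, ← logBranch_zero_of_im_neg h6,
        ← hfPa z h2 (abs_arg₀_sub_lt h3 h1 (Or.inr ⟨h6, h7⟩)), hfIa z h4 h5]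
  -- `D₁` is a thin strip just above the cut that meets the ball; it overlaps `D₂`, where the result
  -- is wanted. Both lie in `|z| > t` and between the two cuts.
  set D₁ : Set ℂ := {z | 3 * t / 5 < z.re} ∩ ({z | -t < z.im} ∩ {z | z.im < -(4 * t / 5)}) with hD₁
  set D₂ : Set ℂ := {z | t < z.re} ∩ ({z | -t < z.im} ∩ {z | z.im < 0}) with hD₂
  have hD : Set.EqOn fu (fun z => Pa (Complex.log z + 2 * Real.pi * Complex.I)) (D₁ ∪ D₂) := by
    refine eqOn_of_eqOn_isOpen (V := Metric.ball z₀ (t / 10) ∩ {z | -t < z.im}) ?_ ?_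
      (hfu.mono ?_) (hPd _ ?_) (Metric.isOpen_ball.inter (isOpen_im_gt _)) ?_
      ⟨z₀ + (t / 20 : ℝ) * Complex.I, hdist _ ?_, ?_⟩ ?_
    · exact ((isOpen_re_gt _).inter ((isOpen_im_gt _).inter (isOpen_im_lt _))).union
        ((isOpen_re_gt _).inter ((isOpen_im_gt _).inter (isOpen_im_lt _)))
    · refine IsPreconnected.union (⟨2 * t, -(9 * t / 10)⟩ : ℂ) ?_ ?_ ?_ ?_
      · simp only [hD₁, Set.mem_inter_iff, Set.mem_ofPred_eq]
        refine ⟨?_, ?_, ?_⟩ <;> linarith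
      · simp only [hD₂, Set.mem_inter_iff, Set.mem_ofPred_eq]
        refine ⟨?_, ?_, ?_⟩ <;> linarith
      · exact ((convex_halfSpace_re_gt _).inter
          ((convex_halfSpace_im_gt _).inter (convex_halfSpace_im_lt _))).isPreconnected
      · exact ((convex_halfSpace_re_gt _).inter
          ((convex_halfSpace_im_gt _).inter (convex_halfSpace_im_lt _))).isPreconnected
    · rintro z (⟨-, h1, h2⟩ | ⟨-, h1, h2⟩)
      · rw [Set.mem_ofPred_eq] at *
        exact ⟨h1, by linarith⟩
      · exact ⟨h1, h2⟩
    · rintro z (⟨h0, h1, h2⟩ | ⟨h0, h1, h2⟩) <;> rw [Set.mem_ofPred_eq] at *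
      · exact ⟨by linarith, lt_norm_of_sq (by nlinarith)⟩
      · exact ⟨by linarith, h0.trans_le (Complex.re_le_norm z)⟩
    · rintro z ⟨hz, h1⟩
      obtain ⟨⟨h2, -⟩, -, h4⟩ := hball z hz
      refine Or.inl ⟨?_, h1, ?_⟩ <;> rw [Set.mem_ofPred_eq] <;> linarith
    · rw [abs_of_pos (by linarith)]
      linarith
    · simp [hz₀, hζim]
      linarith
    · rintro z ⟨hz, hz'⟩
      rw [Set.mem_ofPred_eq] at hz'
      obtain ⟨h1, h2, h3, h4, h5⟩ := hball' z hz
      have h6 : 0 ≤ (z - ζ).im := by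
        rw [Complex.sub_im, hζim]
        linarith
      -- Above the cut `log (z - ζ)` is already the preferred branch, and the monodromy of the
      -- iterate absorbs the extra `2πi`, turning `Ia` into `Iu`.
      have h8 := step hz
      simp only at h8
      simp only
      rw [h8, hfIu z h4 h5, logBranch_zero_of_im_nonneg h6, hIau]
      rw [Complex.log_re]
      exact Real.log_lt_log h4 h5
  exact hD (Or.inr ⟨hre, him, him'⟩)

/-- The monodromy along a large circle is the product of the monodromies around `ζ = -it` and
around `0`. -/
theorem monodromy_comparison (ht : 0 < t) (hζ : ζ = -(t * Complex.I))
    {Pa Pb Ru Rb Ia Iu fa fu fb F : ℂ → ℂ}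
    (hPa : DifferentiableOn ℂ Pa {s | s.re ∈ Set.Ioi (Real.log t)})
    (hPb : DifferentiableOn ℂ Pb {s | s.re ∈ Set.Ioi (Real.log t)})
    (hRb : DifferentiableOn ℂ Rb {s | s.re ∈ Set.Iio (Real.log t)})
    (hRub : ∀ s : ℂ, s.re ∈ Set.Iio (Real.log t) → Ru (s + 2 * Real.pi * Complex.I) = Rb s)
    (hIa : DifferentiableOn ℂ Ia {s | s.re ∈ Set.Iio (Real.log t)})
    (hIau : ∀ s : ℂ, s.re ∈ Set.Iio (Real.log t) → Ia (s + 2 * Real.pi * Complex.I) = Iu s)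
    (hfPa : ∀ z, t < ‖z‖ → |arg₀ (z - ζ) - arg₀ z| < Real.pi / 2 → fa z = Pa (logBranch 0 z))
    (hfPb : ∀ z, t < ‖z‖ → |arg₀ (z - ζ) - arg₀ z| < Real.pi / 2 → fb z = Pb (logBranch 0 z))
    (hfRu : ∀ z, 0 < ‖z‖ → ‖z‖ < t → fu z = Ru (logBranch 0 z))
    (hfRb : ∀ z, 0 < ‖z‖ → ‖z‖ < t → fb z = Rb (logBranch 0 z))
    (hfIa : ∀ z, 0 < ‖z - ζ‖ → ‖z - ζ‖ < t → fa z = Ia (logBranch 0 (z - ζ)))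
    (hfIu : ∀ z, 0 < ‖z - ζ‖ → ‖z - ζ‖ < t → fu z = Iu (logBranch 0 (z - ζ)))
    (hfu : DifferentiableOn ℂ fu {z | -t < z.im ∧ z.im < 0})
    (hF : AnalyticAt ℂ F t) (hFb : ∀ᶠ z in 𝓝 (t : ℂ), 0 ≤ z.im → fb z = F z) {s : ℂ}
    (hs : Real.log t < s.re) : Pa (s + 2 * Real.pi * Complex.I) = Pb s := by
  -- In the application the suffixes `a`, `u`, `b` belong to the vectors `g₁ g₂ u`, `g₂ u`, `u`. `F`
  -- continues `fb` downwards across the cut `z ∈ ℝ₊` at the point `t`, where the regions of the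
  -- product and of the reversed product touch.
  have hc : (2 * Real.pi * Complex.I : ℂ).re = 0 := by simp
  have hζre : ζ.re = 0 := by simp [hζ]
  have hζim : ζ.im = -t := by simp [hζ]
  obtain ⟨ε₀, hε₀, hball₀⟩ := Metric.eventually_nhds_iff_ball.1 (hF.eventually_analyticAt.and hFb)
  set ε := min ε₀ t with hεdef
  have hε : 0 < ε := lt_min hε₀ ht
  have hεt : ε ≤ t := min_le_right _ _
  have hball : ∀ z ∈ Metric.ball (t : ℂ) ε, AnalyticAt ℂ F z ∧ (0 ≤ z.im → fb z = F z) :=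
    fun z hz => hball₀ z (Metric.ball_subset_ball (min_le_left _ _) hz)
  have hFd : ∀ U ⊆ Metric.ball (t : ℂ) ε, DifferentiableOn ℂ F U := fun U hU z hz =>
    (hball z (hU hz)).1.differentiableAt.differentiableWithinAt
  have hreim : ∀ z ∈ Metric.ball (t : ℂ) ε, 0 < z.re ∧ -t < z.im := by
    intro z hz
    rw [Metric.mem_ball, dist_eq_norm] at hz
    have h1 := abs_lt.1 ((Complex.abs_re_le_norm _).trans_lt hz)
    have h2 := abs_lt.1 ((Complex.abs_im_le_norm _).trans_lt hz)
    simp only [Complex.sub_re, Complex.ofReal_re, Complex.sub_im, Complex.ofReal_im] at h1 h2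
    constructor <;> linarith
  have hpt : ∀ σ : ℝ, |σ| = 1 → (⟨t - ε / 4, σ * (ε / 4)⟩ : ℂ) ∈ Metric.ball (t : ℂ) ε ∧
      (⟨t - ε / 4, σ * (ε / 4)⟩ : ℂ) ∈ Metric.ball (0 : ℂ) t := by
    intro σ hσ
    have hσ2 : σ ^ 2 = 1 := by rw [← sq_abs, hσ, one_pow]
    constructor
    · rw [Metric.mem_ball, dist_eq_norm]
      refine norm_lt_of_sq hε.le ?_
      simp only [Complex.sub_re, Complex.ofReal_re, Complex.sub_im, Complex.ofReal_im, sub_zero,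
        mul_pow, hσ2]
      nlinarith
    · rw [mem_ball_zero_iff]
      refine norm_lt_of_sq ht.le ?_
      simp only [mul_pow, hσ2]
      nlinarith
  -- Inside `|z| < t` the continuation is given by the reversed product, which is analytic across
  -- the cut in terms of the principal logarithm.
  have h2a : Set.EqOn F (fun z => Rb (Complex.log z))
      (Metric.ball (t : ℂ) ε ∩ Metric.ball 0 t) := by
    have hRd := differentiableOn_comp_log_add (U := Metric.ball (t : ℂ) ε ∩ Metric.ball 0 t)
      isOpen_Iio hRb 0 (c := 0) rfl (fun z hz => by
        have h1 := (hreim z hz.1).1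
        have h2 := mem_ball_zero_iff.1 hz.2
        rw [sub_zero]
        exact ⟨h1, Real.log_lt_log (norm_pos_of_re_pos h1) h2⟩)
    simp only [sub_zero, add_zero] at hRd
    refine eqOn_of_eqOn_isOpen
      (V := (Metric.ball (t : ℂ) ε ∩ Metric.ball 0 t) ∩ {z | 0 < z.im})
      (Metric.isOpen_ball.inter Metric.isOpen_ball)
      ((convex_ball _ _).inter (convex_ball _ _)).isPreconnected (hFd _ Set.inter_subset_left) hRd
      ((Metric.isOpen_ball.inter Metric.isOpen_ball).inter (isOpen_im_gt _)) Set.inter_subset_left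
      ⟨_, hpt 1 abs_one, ?_⟩ ?_
    · rw [Set.mem_ofPred_eq]
      linarith
    · rintro z ⟨⟨h1, h2⟩, h3⟩
      rw [Set.mem_ofPred_eq] at h3
      rw [← (hball z h1).2 h3.le, hfRb z (norm_pos_of_re_pos (hreim z h1).1)
        (mem_ball_zero_iff.1 h2), logBranch_zero_of_im_nonneg h3.le]
  -- Below the cut the preferred logarithm is larger by `2πi`, and the monodromy of the reversed
  -- product changes `Rb` into `Ru`.
  have h2b : Set.EqOn F fu (Metric.ball (t : ℂ) ε ∩ {z | z.im < 0}) := by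
    refine eqOn_of_eqOn_isOpen
      (V := (Metric.ball (t : ℂ) ε ∩ {z | z.im < 0}) ∩ Metric.ball 0 t)
      (Metric.isOpen_ball.inter (isOpen_im_lt _))
      ((convex_ball _ _).inter (convex_halfSpace_im_lt _)).isPreconnected
      (hFd _ Set.inter_subset_left) (hfu.mono fun z hz => ⟨(hreim z hz.1).2, hz.2⟩)
      ((Metric.isOpen_ball.inter (isOpen_im_lt _)).inter Metric.isOpen_ball) Set.inter_subset_left
      ⟨_, ⟨(hpt (-1) (by simp)).1, ?_⟩, (hpt (-1) (by simp)).2⟩ ?_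
    · rw [Set.mem_ofPred_eq]
      linarith
    · rintro z ⟨⟨h1, h2⟩, h3⟩
      rw [Set.mem_ofPred_eq] at h2
      have h4 := norm_pos_of_re_pos (hreim z h1).1
      have h5 := mem_ball_zero_iff.1 h3
      rw [h2a ⟨h1, h3⟩, hfRu z h4 h5, logBranch_zero_of_im_neg h2, hRub]
      rw [Complex.log_re]
      exact Real.log_lt_log h4 h5
  -- A ball centred on the cut in which every point has real part greater than `t`. The path leaves
  -- the disc `|z| < t` and returns to the upper half plane through it.
  set c₃ : ℂ := ((t + ε / 2 : ℝ) : ℂ) with hc₃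
  have hU₃ : ∀ z ∈ Metric.ball c₃ (ε / 2), z ∈ Metric.ball (t : ℂ) ε ∧ t < z.re ∧ t < ‖z‖ := by
    intro z hz
    have h0 := hz
    rw [Metric.mem_ball, dist_eq_norm] at hz
    have h1 := abs_lt.1 ((Complex.abs_re_le_norm _).trans_lt hz)
    simp only [hc₃, Complex.sub_re, Complex.ofReal_re] at h1
    have h2 : t < z.re := by linarith
    refine ⟨?_, h2, h2.trans_le (Complex.re_le_norm z)⟩
    refine Metric.ball_subset_ball' ?_ h0
    rw [dist_eq_norm, hc₃, ← Complex.ofReal_sub, add_sub_cancel_left, Complex.norm_real,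
      Real.norm_eq_abs, abs_of_pos (by linarith)]
    linarith
  have hpt₃ : ∀ σ : ℝ, |σ| = 1 → (⟨t + ε / 2, σ * (ε / 4)⟩ : ℂ) ∈ Metric.ball c₃ (ε / 2) := by
    intro σ hσ
    have hσ2 : σ ^ 2 = 1 := by rw [← sq_abs, hσ, one_pow]
    rw [Metric.mem_ball, dist_eq_norm]
    refine norm_lt_of_sq (by linarith) ?_
    simp only [hc₃, Complex.sub_re, Complex.ofReal_re, Complex.sub_im, Complex.ofReal_im, sub_zero,
      mul_pow, hσ2]
    nlinarith
  have h2c : Set.EqOn F (fun z => Pa (Complex.log z + 2 * Real.pi * Complex.I))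
      (Metric.ball c₃ (ε / 2)) := by
    have hPd := differentiableOn_comp_log_add (U := Metric.ball c₃ (ε / 2)) isOpen_Ioi hPa 0 hc
      (fun z hz => by
        rw [sub_zero]
        exact ⟨ht.trans (hU₃ z hz).2.1, Real.log_lt_log ht (hU₃ z hz).2.2⟩)
    simp only [sub_zero] at hPd
    refine eqOn_of_eqOn_isOpen (V := Metric.ball c₃ (ε / 2) ∩ {z | z.im < 0}) Metric.isOpen_ball
      (convex_ball _ _).isPreconnected (hFd _ fun z hz => (hU₃ z hz).1) hPd
      (Metric.isOpen_ball.inter (isOpen_im_lt _)) Set.inter_subset_left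
      ⟨_, hpt₃ (-1) (by simp), ?_⟩ ?_
    · rw [Set.mem_ofPred_eq]
      linarith
    · rintro z ⟨h1, h2⟩
      rw [h2b ⟨(hU₃ z h1).1, h2⟩]
      exact eqOn_of_monodromy_around_point ht hζ hPa hIa hIau hfPa hfIa hfIu hfu (hU₃ z h1).2.1
        (hreim z (hU₃ z h1).1).2 h2
  -- The path has closed up: above the cut `F` is again `fb`, now expressed by the product series
  -- `Pb`.
  have hV : ∀ z ∈ Metric.ball c₃ (ε / 2) ∩ {z | 0 < z.im},
      Pa (Complex.log z + 2 * Real.pi * Complex.I) = Pb (Complex.log z) := by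
    rintro z ⟨h1, h2⟩
    rw [Set.mem_ofPred_eq] at h2
    have h3 := hU₃ z h1
    have h4 : 0 < z.re := ht.trans h3.2.1
    have h5 := h2c h1
    simp only at h5
    rw [← h5, ← (hball z h3.1).2 h2.le, hfPb z h3.2.2 (abs_arg₀_sub_lt ?_ h4 (Or.inl ⟨?_, h2⟩)),
      logBranch_zero_of_im_nonneg h2.le]
    · rw [Complex.sub_re, hζre]
      linarith
    · rw [Complex.sub_im, hζim]
      linarith
  have hopen : IsOpen ({s : ℂ | Complex.exp s ∈ Metric.ball c₃ (ε / 2) ∩ {z | 0 < z.im}} ∩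
      ({s | -Real.pi < s.im} ∩ {s | s.im < Real.pi})) :=
    ((Metric.isOpen_ball.inter (isOpen_im_gt _)).preimage Complex.continuous_exp).inter
      ((isOpen_im_gt _).inter (isOpen_im_lt _))
  refine eqOn_of_eqOn_isOpen (f := fun s => Pa (s + 2 * Real.pi * Complex.I))
    (isOpen_re_gt (Real.log t)) (convex_halfSpace_re_gt _).isPreconnected
    (hPa.comp (by fun_prop) fun s hs => ?_) hPb hopen ?_ ?_ ?_ hs
  · simpa [hc] using hs
  · rintro s ⟨⟨h1, -⟩, -⟩
    have h2 := (hU₃ _ h1).2.2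
    rw [Complex.norm_exp] at h2
    have h3 := Real.log_lt_log ht h2
    rwa [Real.log_exp] at h3
  · have h1 := hpt₃ 1 abs_one
    set z : ℂ := ⟨t + ε / 2, 1 * (ε / 4)⟩
    have h2 : 0 < z.im := by
      change 0 < 1 * (ε / 4)
      linarith
    have h3 : z ≠ 0 := fun h => by
      rw [h] at h2
      simp at h2
    refine ⟨Complex.log z, ?_, ?_, ?_⟩
    · rw [Set.mem_ofPred_eq, Complex.exp_log h3]
      exact ⟨h1, h2⟩
    · rw [Set.mem_ofPred_eq, Complex.log_im]
      exact Complex.neg_pi_lt_arg z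
    · rw [Set.mem_ofPred_eq, Complex.log_im]
      exact Complex.arg_lt_pi_iff.2 (Or.inr h2.ne')
  · rintro s ⟨h1, h2, h3⟩
    have h4 := hV _ h1
    rw [Complex.log_exp h2 (le_of_lt h3)] at h4
    exact h4

end Monodromy

/-! ## Monodromy of twisted intertwining operators -/

section ProductTerm

variable {V : Type*} [AddCommGroup V] [Module ℂ V] {𝒱 : VertexOperatorAlgebra V}
  {g : 𝒱.Aut} {W : Type*} [AddCommGroup W] [Module ℂ W] (M : TwistedModule 𝒱 g W)
  {C : Type*} [AddCommGroup C] [Module ℂ C]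

/-- When `u` acts last, the functional is constant and the vectors vary. This is one of the two
forms of `coeffSeries` that are needed. -/
theorem TwistedModule.productTerm_outer (φ : Module.Dual ℂ W) (u : V) (p q : ℤ) (z y : ℂ)
    (s : LogSeries W) (x : (ℂ × (ℕ × ℂ)) × (ℕ × ℂ)) :
    productTerm φ (M.Y u) p z M.proj s q y (Equiv.prodAssoc _ _ _ x)
      = M.matrixCoeff φ (M.proj x.1.1 (logTerm q y s x.1.2)) u x.2
        * expMonomial x.2 (logBranch p z) := by
  simp only [productTerm, Equiv.prodAssoc_apply]
  rw [logTerm_eq p, map_smul, smul_eq_mul, mul_comm, M.matrixCoeff_apply]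

/-- The functional that sends `w` to the terms of `⟨ψ, Z(y) πₙ w⟩`, where `l` is the chosen value of
`log y`. -/
noncomputable def TwistedModule.termDual (ψ : Module.Dual ℂ C) (Z : W →ₗ[ℂ] LogSeries C) (l : ℂ)
    (b : ℂ × (ℕ × ℂ)) : Module.Dual ℂ W :=
  (expMonomial b.2 l • ψ ∘ₗ logCoeff Z b.2.1 b.2.2) ∘ₗ M.proj b.1

theorem TwistedModule.termDual_mem (ψ : Module.Dual ℂ C) (Z : W →ₗ[ℂ] LogSeries C) (l : ℂ)
    (b : ℂ × (ℕ × ℂ)) : M.termDual ψ Z l b ∈ gradedDual M.grading :=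
  dual_comp_gradedProj_mem M.isInternal _ _

/-- The permutation `((n, j), i) ↦ (n, (i, j))`. -/
def innerEquiv (α β γ : Type*) : (α × β) × γ ≃ α × γ × β where
  toFun x := (x.1.1, x.2, x.1.2)
  invFun x := ((x.1, x.2.2), x.2.1)
  left_inv _ := rfl
  right_inv _ := rfl

/-- When `u` acts first, the outer operator is absorbed into varying functionals and the vector is
constant. This covers both the reversed product and the iterate. -/
theorem TwistedModule.productTerm_inner (ψ : Module.Dual ℂ C) (Z : W →ₗ[ℂ] LogSeries C) (u : V)
    (w : W) (p q : ℤ) (z y : ℂ) (x : (ℂ × (ℕ × ℂ)) × (ℕ × ℂ)) :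
    productTerm ψ Z p z M.proj (M.Y u w) q y (innerEquiv _ _ _ x)
      = M.matrixCoeff (M.termDual ψ Z (logBranch p z) x.1) w u x.2
        * expMonomial x.2 (logBranch q y) := by
  simp only [productTerm, innerEquiv, Equiv.coe_fn_mk, logTerm_eq, map_smul]
  rw [Finsupp.smul_apply, Pi.smul_apply, map_smul, M.matrixCoeff_apply, termDual]
  simp only [LinearMap.comp_apply, LinearMap.smul_apply, logCoeff, LinearMap.proj_apply,
    Finsupp.lapply_apply, smul_eq_mul]
  ring

end ProductTerm

section Arg

theorem arg₀_of_im_pos {z : ℂ} (hz : 0 < z.im) : 0 < arg₀ z ∧ arg₀ z < Real.pi := by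
  rw [arg₀_eq_of_im_nonneg hz.le]
  refine ⟨lt_of_le_of_ne (Complex.arg_nonneg_iff.2 hz.le) fun h => ?_, ?_⟩
  · rw [eq_comm, Complex.arg_eq_zero_iff] at h
    exact hz.ne' h.2
  · exact Complex.arg_lt_pi_iff.2 (Or.inr hz.ne')

theorem arg₀_of_im_neg {z : ℂ} (hz : z.im < 0) : Real.pi < arg₀ z ∧ arg₀ z < 2 * Real.pi := by
  rw [arg₀_eq_of_im_neg hz]
  have h1 := Complex.arg_neg_iff.2 hz
  have h2 := Complex.neg_pi_lt_arg z
  constructor <;> linarith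

theorem arg₀_neg_mul_I {t : ℝ} (ht : 0 < t) : arg₀ (-(t * Complex.I)) = 3 * Real.pi / 2 := by
  have h : (-(t * Complex.I) : ℂ) = (t : ℂ) * -Complex.I := by ring
  rw [arg₀_eq_of_im_neg (by simpa using ht), h, Complex.arg_real_mul _ ht, Complex.arg_neg_I]
  ring

end Arg

section SingleValued

variable {f : ℂ × ℂ → ℂ} {t : ℝ}

/-- The strip lies strictly between the cuts `Im z = 0` and `Im z = -t`, so none of the arguments
jumps there. -/
theorem IsSingleValuedBranch.differentiableOn_strip (hf : IsSingleValuedBranch f) (t : ℝ) :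
    DifferentiableOn ℂ (fun z => f (z, -(t * Complex.I))) {z | -t < z.im ∧ z.im < 0} := by
  set ζ : ℂ := -(t * Complex.I) with hζ
  have hζim : ζ.im = -t := by simp [hζ]
  rintro z ⟨hz1, hz2⟩
  have hz0 : z ≠ 0 := fun h => by
    rw [h] at hz2
    simp at hz2
  have hζ0 : ζ ≠ 0 := fun h => by
    rw [h] at hζim
    simp at hζim
    linarith
  have hzζ : z ≠ ζ := fun h => by
    rw [h, hζim] at hz1
    exact lt_irrefl _ hz1
  obtain ⟨F, hF, hfF⟩ := hf (z, ζ) ⟨hz0, hζ0, hzζ⟩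
  have hpair : AnalyticAt ℂ (fun y : ℂ => (y, ζ)) z :=
    AnalyticAt.prod analyticAt_id analyticAt_const
  have h1 : DifferentiableAt ℂ (fun y => F (y, ζ)) z :=
    (hF.comp_of_eq hpair rfl).differentiableAt
  have h2 : (fun y => f (y, ζ)) =ᶠ[𝓝 z] fun y => F (y, ζ) := by
    filter_upwards [hpair.continuousAt.eventually hfF, (isOpen_im_gt (-t)).mem_nhds hz1,
      (isOpen_im_lt 0).mem_nhds hz2] with y hy h3 h4
    have him : ∀ x : ℂ, -t < x.im → 0 < (x - ζ).im := fun x hx => by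
      rw [Complex.sub_im, hζim]
      linarith
    refine hy ?_ (by simpa using Real.pi_pos) ?_
    · have h5 := arg₀_of_im_neg hz2
      have h6 := arg₀_of_im_neg h4
      rw [abs_lt]
      constructor <;> linarith
    · have h5 := arg₀_of_im_pos (him z hz1)
      have h6 := arg₀_of_im_pos (him y h3)
      rw [abs_lt]
      constructor <;> linarith
  exact (h1.congr_of_eventuallyEq h2).differentiableWithinAt

/-- The point `t` is on the cut `z ∈ ℝ₊`, which is attached to the upper half plane. Hence `F`
agrees with the branch only for `Im z ≥ 0` and continues it across the cut. -/
theorem IsSingleValuedBranch.exists_analyticAt (hf : IsSingleValuedBranch f) (ht : 0 < t) :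
    ∃ F : ℂ → ℂ, AnalyticAt ℂ F t ∧
      ∀ᶠ z in 𝓝 (t : ℂ), 0 ≤ z.im → f (z, -(t * Complex.I)) = F z := by
  set ζ : ℂ := -(t * Complex.I) with hζ
  have hζim : ζ.im = -t := by simp [hζ]
  have ht0 : (t : ℂ) ≠ 0 := Complex.ofReal_ne_zero.2 ht.ne'
  have hζ0 : ζ ≠ 0 := fun h => by
    rw [h] at hζim
    simp at hζim
    linarith
  have htζ : (t : ℂ) ≠ ζ := fun h => by
    have := congrArg Complex.im h
    rw [hζim, Complex.ofReal_im] at this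
    linarith
  obtain ⟨F, hF, hfF⟩ := hf (t, ζ) ⟨ht0, hζ0, htζ⟩
  have hpair : AnalyticAt ℂ (fun y : ℂ => (y, ζ)) t :=
    AnalyticAt.prod analyticAt_id analyticAt_const
  refine ⟨fun z => F (z, ζ), hF.comp_of_eq hpair rfl, ?_⟩
  filter_upwards [hpair.continuousAt.eventually hfF,
    (isOpen_re_gt 0).mem_nhds (show 0 < (t : ℂ).re by simpa using ht)] with y hy h3 h4
  have him : ∀ x : ℂ, 0 ≤ x.im → 0 < (x - ζ).im := fun x hx => by
    rw [Complex.sub_im, hζim]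
    linarith
  refine hy ?_ (by simpa using Real.pi_pos) ?_
  · rw [arg₀_eq_of_im_nonneg h4, arg₀_eq_of_im_nonneg (by simp), Complex.arg_ofReal_of_nonneg ht.le,
      sub_zero]
    have := Complex.abs_arg_lt_pi_div_two_iff.2 (Or.inl h3)
    linarith [Real.pi_pos]
  · have h5 := arg₀_of_im_pos (him y h4)
    have h6 := arg₀_of_im_pos (him t (by simp))
    rw [abs_lt]
    constructor <;> linarith

end SingleValued

/-! ### Automorphisms and the weight grading -/

namespace VertexOperatorAlgebra

variable {V : Type*} [AddCommGroup V] [Module ℂ V] (𝒱 : VertexOperatorAlgebra V)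

/-- Automorphisms preserve the grading. -/
theorem aut_mem_grading (g : 𝒱.Aut) {n : ℤ} {v : V} (hv : v ∈ 𝒱.grading n) :
    g.1 v ∈ 𝒱.grading n := by
  obtain ⟨-, h2, h3⟩ := g.2
  have hL : ∀ (m : ℤ) (x : V), x ∈ 𝒱.grading m → 𝒱.mode 𝒱.conformal 1 x = (m : ℂ) • x :=
    fun m x hx => 𝒱.L_zero m x hx
  have h4 : 𝒱.mode 𝒱.conformal 1 (g.1 v) = (n : ℂ) • g.1 v := by
    rw [← map_smul, ← hL n v hv, h3, h2]
  have h5 : ∀ m ≠ n, gradedProj 𝒱.grading 𝒱.isInternal m (g.1 v) = 0 := by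
    intro m hm
    obtain ⟨F, hF, hw⟩ := gradedProj_eq_sum 𝒱.isInternal (g.1 v)
    -- `L(0) - n` kills `g v` because `g` commutes with `L(0)`; on the component of weight `k` it is
    -- multiplication by `k - n`.
    have h6 : ∑ k ∈ F, ((k : ℂ) - n) • gradedProj 𝒱.grading 𝒱.isInternal k (g.1 v) = 0 := by
      simp only [sub_smul, Finset.sum_sub_distrib, ← Finset.smul_sum]
      rw [← hw, ← h4, sub_eq_zero]
      conv_rhs => rw [hw, map_sum]
      exact Finset.sum_congr rfl fun k _ => (hL k _ (gradedProj_mem _ k _)).symm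
    have h7 := congrArg (gradedProj 𝒱.grading 𝒱.isInternal m) h6
    simp only [map_sum, map_smul, gradedProj_gradedProj, map_zero, smul_ite, smul_zero,
      Finset.sum_ite_eq] at h7
    split_ifs at h7 with h8
    · rcases smul_eq_zero.1 h7 with h9 | h9
      · exact absurd (by exact_mod_cast sub_eq_zero.1 h9) hm
      · exact h9
    · exact hF m h8
  have h6 : g.1 v - gradedProj 𝒱.grading 𝒱.isInternal n (g.1 v) = 0 := by
    refine eq_zero_of_gradedProj_eq_zero 𝒱.isInternal fun m => ?_
    rw [map_sub, gradedProj_gradedProj]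
    split_ifs with h7
    · rw [h7, sub_self]
    · rw [h5 m h7, sub_zero]
  rw [sub_eq_zero.1 h6]
  exact gradedProj_mem _ _ _

end VertexOperatorAlgebra

namespace TwistedIntertwiningOperator

variable {V W₁ W₂ W₃ : Type*} [AddCommGroup V] [Module ℂ V]
  [AddCommGroup W₁] [Module ℂ W₁] [AddCommGroup W₂] [Module ℂ W₂]
  [AddCommGroup W₃] [Module ℂ W₃] {𝒱 : VertexOperatorAlgebra V} {g₁ g₂ g₃ : 𝒱.Aut}
  {M₁ : TwistedModule 𝒱 g₁ W₁} {M₂ : TwistedModule 𝒱 g₂ W₂} {M₃ : TwistedModule 𝒱 g₃ W₃}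
  (𝒴 : TwistedIntertwiningOperator M₁ M₂ M₃)

/-- The series `⟨φ, Y(u, e ^ s) 𝒴(w₁, -it) w₂⟩`. -/
noncomputable def productSeries (φ : Module.Dual ℂ W₃) (w₁ : W₁) (w₂ : W₂) (t : ℝ) (u : V)
    (s : ℂ) : ℂ :=
  M₃.coeffSeries (β := ℂ × (ℕ × ℂ)) (fun _ => φ)
    (fun b => M₃.proj b.1 (logTerm 0 (-(t * Complex.I)) (𝒴.Y w₁ w₂) b.2)) u s

theorem productSeries_continuation {φ : Module.Dual ℂ W₃} (hφ : φ ∈ gradedDual M₃.grading)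
    (w₁ : W₁) (w₂ : W₂) {t : ℝ} (ht : 0 < t) (N : ℤ) :
    (∀ u ∈ 𝒱.grading N, ∀ s : ℂ, s.re ∈ Set.Ioi (Real.log t) →
      Summable fun x : (ℂ × (ℕ × ℂ)) × (ℕ × ℂ) => M₃.matrixCoeff φ
        (M₃.proj x.1.1 (logTerm 0 (-(t * Complex.I)) (𝒴.Y w₁ w₂) x.1.2)) u x.2
          * expMonomial x.2 s) ∧
      (∀ u ∈ 𝒱.grading N, DifferentiableOn ℂ (𝒴.productSeries φ w₁ w₂ t u)
        {s | s.re ∈ Set.Ioi (Real.log t)}) ∧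
      ∀ u ∈ 𝒱.grading N, ∀ s : ℂ, s.re ∈ Set.Ioi (Real.log t) →
        𝒴.productSeries φ w₁ w₂ t (g₃.1 u) (s + 2 * Real.pi * Complex.I)
          = 𝒴.productSeries φ w₁ w₂ t u s := by
  have := 𝒱.finiteDimensional N
  have key : ∀ u ∈ 𝒱.grading N, ∀ z : ℂ, z ≠ 0 → Real.log ‖z‖ ∈ Set.Ioi (Real.log t) →
      Summable fun x : (ℂ × (ℕ × ℂ)) × (ℕ × ℂ) => M₃.matrixCoeff φ
        (M₃.proj x.1.1 (logTerm 0 (-(t * Complex.I)) (𝒴.Y w₁ w₂) x.1.2)) u x.2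
          * expMonomial x.2 (logBranch 0 z) := by
    intro u _ z hz hzI
    have h1 : t < ‖z‖ := (Real.log_lt_log_iff ht (norm_pos_iff.2 hz)).1 hzI
    obtain ⟨f, -, -, hf⟩ := 𝒴.duality u w₁ w₂ φ hφ
    have h2 := ((hf z (-(t * Complex.I))).1 (by simpa [abs_of_pos ht] using h1)
      (by simpa using ht.ne')).1
    rw [← (Equiv.prodAssoc _ _ _).summable_iff] at h2
    exact h2.congr fun x => M₃.productTerm_outer φ u 0 0 z _ _ x
  exact TwistedModule.coeffSeries_continuation (M := M₃) (U := 𝒱.grading N)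
    (φ := fun _ : ℂ × (ℕ × ℂ) => φ)
    (w := fun b => M₃.proj b.1 (logTerm 0 (-(t * Complex.I)) (𝒴.Y w₁ w₂) b.2))
    (fun u hu => 𝒱.aut_mem_grading g₃ hu) (fun _ => hφ) isOpen_Ioi key

/-- The choice `ζ = -it`, of argument `3π/2`, makes the angular conditions automatic. The disc `|z|
< t` lies above the cut `z - ζ ∈ ℝ₊`, so `arg (z - ζ) ∈ (0, π)` there. The disc `|z - ζ| < t` lies
below `z ∈ ℝ₊`, so `arg z ∈ (π, 2π)` there. -/
theorem productSeries_monodromy {φ : Module.Dual ℂ W₃} (hφ : φ ∈ gradedDual M₃.grading)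
    (w₁ : W₁) (w₂ : W₂) {t : ℝ} (ht : 0 < t) {N : ℤ} {u : V} (hu : u ∈ 𝒱.grading N) {s : ℂ}
    (hs : Real.log t < s.re) :
    𝒴.productSeries φ w₁ w₂ t (g₁.1 (g₂.1 u)) (s + 2 * Real.pi * Complex.I)
      = 𝒴.productSeries φ w₁ w₂ t u s := by
  have := 𝒱.finiteDimensional N
  have hu₂ := 𝒱.aut_mem_grading g₂ hu
  have hu₁ := 𝒱.aut_mem_grading g₁ hu₂
  set ζ : ℂ := -(t * Complex.I) with hζ
  have hζn : ‖ζ‖ = t := by simp [hζ, abs_of_pos ht]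
  have hζim : ζ.im = -t := by simp [hζ]
  have hζarg : arg₀ ζ = 3 * Real.pi / 2 := arg₀_neg_mul_I ht
  have hlog : ∀ z : ℂ, z ≠ 0 → Real.log ‖z‖ ∈ Set.Iio (Real.log t) → ‖z‖ < t := fun z hz h =>
    (Real.log_lt_log_iff (norm_pos_iff.2 hz) ht).1 h
  have hP := 𝒴.productSeries_continuation hφ w₁ w₂ ht N
  have hR := TwistedModule.coeffSeries_continuation (M := M₂) (U := 𝒱.grading N)
    (φ := M₂.termDual φ (𝒴.Y w₁) (logBranch 0 ζ)) (w := fun _ => w₂)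
    (fun u hu => 𝒱.aut_mem_grading g₂ hu) (M₂.termDual_mem φ _ _) (isOpen_Iio (a := Real.log t))
    fun u _ z hz hzI => by
      obtain ⟨f, -, -, hf⟩ := 𝒴.duality u w₁ w₂ φ hφ
      have h2 := ((hf z ζ).2.1 (by rw [hζn]; exact hlog z hz hzI) (norm_pos_iff.2 hz)).1
      rw [← (innerEquiv _ _ _).summable_iff] at h2
      exact h2.congr fun x => M₂.productTerm_inner φ (𝒴.Y w₁) u w₂ 0 0 ζ z x
  have hI := TwistedModule.coeffSeries_continuation (M := M₁) (U := 𝒱.grading N)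
    (φ := M₁.termDual φ (𝒴.Y.flip w₂) (logBranch 0 ζ)) (w := fun _ => w₁)
    (fun u hu => 𝒱.aut_mem_grading g₁ hu) (M₁.termDual_mem φ _ _) (isOpen_Iio (a := Real.log t))
    fun u _ z hz hzI => by
      obtain ⟨f, -, -, hf⟩ := 𝒴.duality u w₁ w₂ φ hφ
      have h2 := ((hf (z + ζ) ζ).2.2 (by rw [hζn, add_sub_cancel_right]; exact hlog z hz hzI)
        (by rw [add_sub_cancel_right]; exact norm_pos_iff.2 hz)).1
      rw [← (innerEquiv _ _ _).summable_iff, add_sub_cancel_right] at h2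
      exact h2.congr fun x => M₁.productTerm_inner φ (𝒴.Y.flip w₂) u w₁ 0 0 ζ z x
  have key : ∀ u : V, ∃ f : ℂ × ℂ → ℂ, IsSingleValuedBranch f ∧
      (∀ z, t < ‖z‖ → |arg₀ (z - ζ) - arg₀ z| < Real.pi / 2 →
        f (z, ζ) = 𝒴.productSeries φ w₁ w₂ t u (logBranch 0 z)) ∧
      (∀ z, 0 < ‖z‖ → ‖z‖ < t → f (z, ζ) = M₂.coeffSeries
        (M₂.termDual φ (𝒴.Y w₁) (logBranch 0 ζ)) (fun _ => w₂) u (logBranch 0 z)) ∧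
      (∀ z, 0 < ‖z - ζ‖ → ‖z - ζ‖ < t → f (z, ζ) = M₁.coeffSeries
        (M₁.termDual φ (𝒴.Y.flip w₂) (logBranch 0 ζ)) (fun _ => w₁) u (logBranch 0 (z - ζ))) := by
    intro u
    obtain ⟨f, hfs, -, hf⟩ := 𝒴.duality u w₁ w₂ φ hφ
    refine ⟨f, hfs, fun z h1 h2 => ?_, fun z h1 h2 => ?_, fun z h1 h2 => ?_⟩
    · have h3 := ((hf z ζ).1 (by rwa [hζn]) (by rwa [hζn])).2 h2
      rw [← (Equiv.prodAssoc _ _ _).hasSum_iff] at h3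
      rw [← h3.tsum_eq]
      exact tsum_congr fun x => M₃.productTerm_outer φ u 0 0 z ζ _ x
    · have h4 : 0 < (z - ζ).im := by
        have := (abs_lt.1 ((Complex.abs_im_le_norm z).trans_lt h2)).1
        rw [Complex.sub_im, hζim]
        linarith
      have h5 := arg₀_of_im_pos h4
      have h3 := ((hf z ζ).2.1 (by rwa [hζn]) h1).2 (by rw [hζarg]; linarith)
        (by rw [hζarg]; linarith)
      rw [← (innerEquiv _ _ _).hasSum_iff] at h3
      rw [← h3.tsum_eq]
      exact tsum_congr fun x => M₂.productTerm_inner φ (𝒴.Y w₁) u w₂ 0 0 ζ z x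
    · have h4 : z.im < 0 := by
        have := (abs_lt.1 ((Complex.abs_im_le_norm _).trans_lt h2)).2
        rw [Complex.sub_im, hζim] at this
        linarith
      have h5 := arg₀_of_im_neg h4
      have h3 := ((hf z ζ).2.2 (by rwa [hζn]) h1).2 (by
        rw [hζarg, abs_lt]
        constructor <;> linarith)
      rw [← (innerEquiv _ _ _).hasSum_iff] at h3
      rw [← h3.tsum_eq]
      exact tsum_congr fun x => M₁.productTerm_inner φ (𝒴.Y.flip w₂) u w₁ 0 0 ζ (z - ζ) x
  obtain ⟨fa, -, hfPa, -, hfIa⟩ := key (g₁.1 (g₂.1 u))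
  obtain ⟨fu, hfus, -, hfRu, hfIu⟩ := key (g₂.1 u)
  obtain ⟨fb, hfbs, hfPb, hfRb, -⟩ := key u
  obtain ⟨F, hF, hFb⟩ := hfbs.exists_analyticAt ht
  exact monodromy_comparison ht hζ (hP.2.1 _ hu₁) (hP.2.1 _ hu) (hR.2.1 _ hu) (hR.2.2 _ hu)
    (hI.2.1 _ hu₁) (hI.2.2 _ hu₂) hfPa hfPb hfRu hfRb hfIa hfIu
    (hfus.differentiableOn_strip t) hF hFb hs

end TwistedIntertwiningOperator

/-! ## Laurent coefficients and residues -/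

section Laurent

theorem circleIntegral_zpow_mul_zpow (c : ℂ) {R : ℝ} (hR : 0 < R) (m n : ℤ) :
    (∮ z in C(c, R), (z - c) ^ (-n - 1) * (z - c) ^ m)
      = if m = n then 2 * Real.pi * Complex.I else 0 := by
  have h1 : (∮ z in C(c, R), (z - c) ^ (-n - 1) * (z - c) ^ m)
      = ∮ z in C(c, R), (z - c) ^ (m - n - 1) := by
    refine circleIntegral.integral_congr hR.le fun z hz => ?_
    have : z - c ≠ 0 := sub_ne_zero.2 (Metric.ne_of_mem_sphere hz hR.ne')
    rw [← zpow_add₀ this]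
    congr 1
    ring
  rw [h1]
  split_ifs with hmn
  · subst hmn
    simp only [sub_self, zero_sub, zpow_neg_one]
    exact circleIntegral.integral_sub_center_inv c hR.ne'
  · exact circleIntegral.integral_sub_zpow_of_ne (by omega) c c R

/-- The coefficients of an absolutely convergent Laurent series with repeated exponents. -/
theorem hasSum_laurent_coeff {ι : Type*} {a : ι → ℂ} {m : ι → ℤ} {c : ℂ} {R : ℝ} (hR : 0 < R)
    {f : ℂ → ℂ} (h : ∀ z ∈ Metric.sphere c R, HasSum (fun x => a x * (z - c) ^ m x) (f z)) (n : ℤ) :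
    HasSum (fun x => if m x = n then a x else 0)
      ((2 * Real.pi * Complex.I)⁻¹ * ∮ z in C(c, R), (z - c) ^ (-n - 1) * f z) := by
  -- Termwise integration needs a countable index set; an absolutely convergent series has countable
  -- support.
  wlog hι : Countable ι generalizing ι
  · have hc : (Function.support fun x => a x).Countable := by
      have h1 := (h (c + R) (by simp [abs_of_pos hR])).summable.countable_support
      refine h1.mono fun x hx => mul_ne_zero hx (zpow_ne_zero _ ?_)
      simpa using hR.ne'
    have := this (ι := Function.support fun x => a x) (a := fun x => a x) (m := fun x => m x)
      (fun z hz => ((hasSum_subtype_iff_of_support_subset (f := fun x => a x * (z - c) ^ m x)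
        fun x hx => left_ne_zero_of_mul hx).2 (h z hz))) hc.to_subtype
    refine (hasSum_subtype_iff_of_support_subset (f := fun x => if m x = n then a x else 0)
      fun x hx => ?_).1 this
    rw [Function.mem_support] at hx ⊢
    exact fun h0 => hx (by simp [h0])
  have hcirc : ∀ θ, circleMap c R θ - c ≠ 0 := fun θ =>
    sub_ne_zero.2 (circleMap_ne_center hR.ne')
  have hnorm : ∀ θ, ‖circleMap c R θ - c‖ = R := fun θ => by
    simp [abs_of_pos hR]
  have hcont : Continuous fun θ => circleMap c R θ - c :=
    (continuous_circleMap c R).sub continuous_const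
  have h1 : HasSum (fun x => ∮ z in C(c, R), (z - c) ^ (-n - 1) * (a x * (z - c) ^ m x))
      (∮ z in C(c, R), (z - c) ^ (-n - 1) * f z) := by
    refine intervalIntegral.hasSum_integral_of_dominated_convergence
      (fun x _ => R * (R ^ (-n - 1) * (‖a x‖ * R ^ m x))) (fun x => ?_) (fun x => ?_) ?_ ?_ ?_
    · refine Continuous.aestronglyMeasurable ?_
      simp only [deriv_circleMap, smul_eq_mul]
      refine ((continuous_circleMap 0 R).mul continuous_const).mul
        ((hcont.zpow₀ _ fun θ => Or.inl (hcirc θ)).mul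
          (continuous_const.mul (hcont.zpow₀ _ fun θ => Or.inl (hcirc θ))))
    · refine Eventually.of_forall fun θ _ => le_of_eq ?_
      simp only [deriv_circleMap, norm_smul, norm_mul, norm_zpow, hnorm, norm_circleMap_zero,
        Complex.norm_I, mul_one, abs_of_pos hR]
    · refine Eventually.of_forall fun θ _ => ?_
      have h2 := (h (circleMap c R θ) (circleMap_mem_sphere c hR.le θ)).summable.norm
      simp only [norm_mul, norm_zpow, hnorm] at h2
      exact (h2.mul_left _).mul_left _
    · exact intervalIntegrable_const
    · exact Eventually.of_forall fun θ _ =>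
        ((h (circleMap c R θ) (circleMap_mem_sphere c hR.le θ)).mul_left _).const_smul _
  have h2 := h1.mul_left (2 * Real.pi * Complex.I)⁻¹
  have h4 : (fun x => if m x = n then a x else 0) = fun x => (2 * Real.pi * Complex.I)⁻¹
      * ∮ z in C(c, R), (z - c) ^ (-n - 1) * (a x * (z - c) ^ m x) := ?_
  · rw [h4]
    exact h2
  funext x
  have h3 : ∀ z, (z - c) ^ (-n - 1) * (a x * (z - c) ^ m x)
      = a x * ((z - c) ^ (-n - 1) * (z - c) ^ m x) := fun z => by ring
  simp only [h3]
  rw [circleIntegral.integral_const_mul, circleIntegral_zpow_mul_zpow c hR]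
  split_ifs
  · field_simp
  · simp

theorem circleIntegral_sub_zpow_outside {b : ℂ} {r : ℝ} (hr : 0 ≤ r) (hb : r < ‖b‖) (n : ℤ) :
    (∮ z in C(0, r), (z - b) ^ n) = 0 := by
  have hne : ∀ z ∈ Metric.closedBall (0 : ℂ) r, z - b ≠ 0 := by
    intro z hz h
    rw [sub_eq_zero] at h
    rw [mem_closedBall_zero_iff, h] at hz
    linarith
  have hd : ∀ z ∈ Metric.closedBall (0 : ℂ) r, DifferentiableAt ℂ (fun z : ℂ => (z - b) ^ n) z :=
    fun z hz => (differentiableAt_id.sub_const b).zpow (Or.inl (hne z hz))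
  exact Complex.circleIntegral_eq_zero_of_differentiable_on_off_countable hr Set.countable_empty
    (fun z hz => (hd z hz).continuousAt.continuousWithinAt)
    fun z hz => hd z (Metric.ball_subset_closedBall hz.1)

/-- The difference of the integrals of `H(z) / (z - b)^k` over two circles around `0` is the
integral over a small circle around `b`. -/
theorem circleIntegral_sub_eq_circleIntegral {b : ℂ} {r R ε : ℝ} (hr : 0 < r) (hrb : r < ‖b‖)
    (hbR : ‖b‖ < R) (hε : 0 < ε) (hεb : ε < ‖b‖) (k : ℕ) :
    ∀ H : ℂ → ℂ, DifferentiableOn ℂ H {0}ᶜ →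
    (∮ z in C(0, R), H z * ((z - b) ^ k)⁻¹) - (∮ z in C(0, r), H z * ((z - b) ^ k)⁻¹)
      = ∮ z in C(b, ε), H z * ((z - b) ^ k)⁻¹ := by
  have hR : 0 < R := hr.trans (hrb.trans hbR)
  have hopen : IsOpen ({0}ᶜ : Set ℂ) := isOpen_compl_singleton
  have hsphereε : ∀ z ∈ Metric.closedBall b ε, z ∈ ({0}ᶜ : Set ℂ) := by
    intro z hz h0
    rw [Set.mem_singleton_iff] at h0
    rw [h0, mem_closedBall_iff_norm, zero_sub, norm_neg] at hz
    linarith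
  induction k with
  | zero =>
    intro H hH
    simp only [pow_zero, inv_one, mul_one]
    have hd : ∀ z ≠ 0, DifferentiableAt ℂ H z := fun z hz =>
      hH.differentiableAt (hopen.mem_nhds hz)
    rw [Complex.circleIntegral_eq_of_differentiable_on_annulus_off_countable hr
      (hrb.trans hbR).le Set.countable_empty, sub_self,
      Complex.circleIntegral_eq_zero_of_differentiable_on_off_countable hε.le Set.countable_empty
      (fun z hz => (hd z (hsphereε z hz)).continuousAt.continuousWithinAt)
      fun z hz => hd z (hsphereε z (Metric.ball_subset_closedBall hz.1))]
    · rintro z ⟨-, hz⟩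
      refine (hd z fun h => hz ?_).continuousAt.continuousWithinAt
      rw [h]
      exact Metric.mem_ball_self hr
    · rintro z ⟨⟨-, hz⟩, -⟩
      refine hd z fun h => hz ?_
      rw [h]
      exact Metric.mem_closedBall_self hr.le
  | succ k ih =>
    intro H hH
    have hb0 : b ≠ 0 := norm_pos_iff.1 (hr.trans hrb)
    -- Writing `H = H(b) + (z - b) · dslope H b` lowers the order of the pole by one and leaves a
    -- pure power of `z - b`.
    have hD : DifferentiableOn ℂ (dslope H b) {0}ᶜ :=
      (Complex.differentiableOn_dslope (hopen.mem_nhds hb0)).2 hH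
    have key : ∀ (c : ℂ) (ρ : ℝ), 0 ≤ ρ → (∀ z ∈ Metric.sphere c ρ, z ≠ 0 ∧ z ≠ b) →
        (∮ z in C(c, ρ), H z * ((z - b) ^ (k + 1))⁻¹)
          = (∮ z in C(c, ρ), dslope H b z * ((z - b) ^ k)⁻¹)
            + H b * ∮ z in C(c, ρ), (z - b) ^ (-(k + 1) : ℤ) := by
      intro c ρ hρ hz
      rw [← circleIntegral.integral_const_mul, ← circleIntegral.integral_add]
      · refine circleIntegral.integral_congr hρ fun z hzs => ?_
        have h1 := sub_ne_zero.2 (hz z hzs).2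
        have h2 : H z = (z - b) * dslope H b z + H b := by
          have := sub_smul_dslope H b z
          rw [smul_eq_mul] at this
          rw [this]
          ring
        have h3 : (z - b) ^ (-(k + 1) : ℤ) = ((z - b) ^ (k + 1))⁻¹ := by
          rw [zpow_neg]
          norm_cast
        rw [h2, h3]
        field_simp
        ring
      · refine ContinuousOn.circleIntegrable hρ fun z hzs => ?_
        have h1 := sub_ne_zero.2 (hz z hzs).2
        have h2 := (hD.differentiableAt (hopen.mem_nhds (hz z hzs).1)).continuousAt
        have h3 : ContinuousAt (fun z => (z - b) ^ k) z := by fun_prop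
        exact (h2.mul (h3.inv₀ (pow_ne_zero k h1))).continuousWithinAt
      · refine ContinuousOn.circleIntegrable hρ fun z hzs => ?_
        have h1 := sub_ne_zero.2 (hz z hzs).2
        refine (continuousAt_const.mul ?_).continuousWithinAt
        exact (continuousAt_id.sub continuousAt_const).zpow₀ _ (Or.inl h1)
    have hs : ∀ ρ : ℝ, 0 < ρ → ρ ≠ ‖b‖ → ∀ z ∈ Metric.sphere (0 : ℂ) ρ, z ≠ 0 ∧ z ≠ b := by
      intro ρ hρ hρb z hz
      rw [mem_sphere_zero_iff_norm] at hz
      refine ⟨fun h => ?_, fun h => hρb (by rw [← hz, h])⟩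
      rw [h, norm_zero] at hz
      exact hρ.ne hz
    rw [key 0 R hR.le (hs R hR hbR.ne'), key 0 r hr.le (hs r hr hrb.ne),
      key b ε hε.le fun z hz => ⟨hsphereε z (Metric.sphere_subset_closedBall hz),
        Metric.ne_of_mem_sphere hz hε.ne'⟩, ← ih _ hD,
      circleIntegral_sub_zpow_outside hr.le hrb]
    have h4 : (∮ z in C(0, R), (z - b) ^ (-(k + 1) : ℤ))
        = ∮ z in C(b, ε), (z - b) ^ (-(k + 1) : ℤ) := by
      rcases Nat.eq_zero_or_pos k with rfl | hk
      · simp only [Nat.cast_zero, zero_add, zpow_neg_one]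
        rw [circleIntegral.integral_sub_center_inv b hε.ne',
          circleIntegral.integral_sub_inv_of_mem_ball (mem_ball_zero_iff.2 hbR)]
      · rw [circleIntegral.integral_sub_zpow_of_ne (by omega),
          circleIntegral.integral_sub_zpow_of_ne (by omega)]
    rw [h4]
    ring

end Laurent

/-! ### Periodic functions of the logarithm -/

section LogPeriodic

theorem arg₀_mem (z : ℂ) : 0 ≤ arg₀ z ∧ arg₀ z < 2 * Real.pi := by
  rcases le_or_gt 0 z.im with h | h
  · rw [arg₀_eq_of_im_nonneg h]
    exact ⟨Complex.arg_nonneg_iff.2 h, by linarith [Complex.arg_le_pi z, Real.pi_pos]⟩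
  · have := arg₀_of_im_neg h
    exact ⟨by linarith [Real.pi_pos], this.2⟩

theorem logBranch_zero_exp {s : ℂ} (h0 : 0 ≤ s.im) (h1 : s.im < 2 * Real.pi) :
    logBranch 0 (Complex.exp s) = s := by
  obtain ⟨p, hp⟩ := exists_eq_logBranch s
  have him : s.im = arg₀ (Complex.exp s) + 2 * Real.pi * p := by
    conv_lhs => rw [hp]
    simp [logBranch]
  have h2 := arg₀_mem (Complex.exp s)
  have hp0 : p = 0 := by
    have h3 : (p : ℝ) < 1 := by nlinarith [Real.pi_pos]
    have h4 : (-1 : ℝ) < p := by nlinarith [Real.pi_pos]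
    have h5 : p < 1 := by exact_mod_cast h3
    have h6 : -1 < p := by exact_mod_cast h4
    omega
  rw [hp0] at hp
  exact hp.symm

theorem eq_of_periodic_of_exp_eq {E : ℂ → ℂ} (hper : ∀ s, E (s + 2 * Real.pi * Complex.I) = E s)
    {s s' : ℂ} (h : Complex.exp s = Complex.exp s') : E s = E s' := by
  have hper' : Function.Periodic E (2 * Real.pi * Complex.I) := hper
  obtain ⟨n, hn⟩ := Complex.exp_eq_exp_iff_exists_int.1 h
  rw [hn]
  exact hper'.int_mul n s'

/-- Across the negative axis the principal logarithm is replaced by `log (-z) + πi`; periodicity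
makes the choice irrelevant. -/
theorem differentiableOn_comp_log_of_periodic {E : ℂ → ℂ}
    (hper : ∀ s, E (s + 2 * Real.pi * Complex.I) = E s) (hE : Differentiable ℂ E) :
    DifferentiableOn ℂ (fun z => E (Complex.log z)) {0}ᶜ := by
  intro z hz
  refine DifferentiableAt.differentiableWithinAt ?_
  by_cases hs : z ∈ Complex.slitPlane
  · exact (hE _).comp z (differentiableAt_id.clog hs)
  · have hs' : -z ∈ Complex.slitPlane := by
      rw [Complex.mem_slitPlane_iff] at hs ⊢
      push Not at hs
      left
      rw [Complex.neg_re]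
      refine neg_pos.2 (lt_of_le_of_ne hs.1 fun h => hz (Complex.ext h hs.2))
    have h1 : DifferentiableAt ℂ (fun z => E (Complex.log (-z) + Real.pi * Complex.I)) z :=
      (hE _).comp z (((differentiableAt_id.neg).clog hs').add_const _)
    refine h1.congr_of_eventuallyEq ?_
    filter_upwards [isOpen_compl_singleton.mem_nhds hz] with y hy
    refine eq_of_periodic_of_exp_eq hper ?_
    rw [Complex.exp_add, Complex.exp_pi_mul_I, Complex.exp_log hy,
      Complex.exp_log (neg_ne_zero.2 hy)]
    ring

end LogPeriodic

/-- The coefficients of an exponential polynomial are determined by its values on a horizontal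
line. -/
theorem eq_zero_of_finsum_mul_expMonomial_eq_zero_on_line {c : ℕ × ℂ → ℂ} (hc : c.support.Finite)
    (y : ℝ) (h : ∀ x : ℝ, ∑ᶠ i, c i * expMonomial i (x + y * Complex.I) = 0) : c = 0 := by
  refine eq_zero_of_finsum_mul_expMonomial_eq_zero hc ?_
  have hd : Differentiable ℂ fun s => ∑ᶠ i, c i * expMonomial i s := by
    have : (fun s => ∑ᶠ i, c i * expMonomial i s)
        = fun s => ∑ i ∈ hc.toFinset, c i * expMonomial i s := by
      funext s
      refine finsum_eq_sum_of_support_subset _ fun i hi => ?_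
      simpa using left_ne_zero_of_mul hi
    rw [this]
    unfold expMonomial
    fun_prop
  have h1 : AnalyticOnNhd ℂ (fun s => ∑ᶠ i, c i * expMonomial i s) Set.univ :=
    hd.differentiableOn.analyticOnNhd isOpen_univ
  have h2 : ∃ᶠ s in 𝓝[≠] ((y : ℂ) * Complex.I), ∑ᶠ i, c i * expMonomial i s = 0 := by
    have ht : Tendsto (fun x : ℝ => (x : ℂ) + y * Complex.I) (𝓝[≠] 0)
        (𝓝[≠] ((y : ℂ) * Complex.I)) := by
      refine tendsto_nhdsWithin_iff.2 ⟨?_, ?_⟩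
      · have : Continuous fun x : ℝ => (x : ℂ) + y * Complex.I := by fun_prop
        exact (this.tendsto' 0 _ (by simp)).mono_left nhdsWithin_le_nhds
      · filter_upwards [self_mem_nhdsWithin] with x hx
        simpa using hx
    exact ht.frequently (Eventually.of_forall h).frequently
  intro s
  exact h1.eqOn_of_preconnected_of_frequently_eq (g := fun _ => 0) analyticOnNhd_const
    isPreconnected_univ (Set.mem_univ _) h2 (Set.mem_univ s)

theorem arg₀_of_re_neg {z : ℂ} (hz : z.re < 0) :
    Real.pi / 2 < arg₀ z ∧ arg₀ z < 3 * Real.pi / 2 := by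
  have h1 : ¬ |z.arg| ≤ Real.pi / 2 := fun h => (Complex.abs_arg_le_pi_div_two_iff.1 h).not_gt hz
  rcases le_or_gt 0 z.im with h | h
  · rw [arg₀_eq_of_im_nonneg h]
    rw [abs_of_nonneg (Complex.arg_nonneg_iff.2 h)] at h1
    exact ⟨not_le.1 h1, by linarith [Complex.arg_le_pi z, Real.pi_pos]⟩
  · rw [arg₀_eq_of_im_neg h]
    rw [abs_of_neg (Complex.arg_neg_iff.2 h)] at h1
    exact ⟨by linarith [Complex.neg_pi_lt_arg z, Real.pi_pos], by linarith⟩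

/-! ## The commutator of `L(0)` with twisted vertex operators -/

section Sums

theorem HasSum.of_forall_eq {ι : Type*} {f f' : ι → ℂ} {a a' : ℂ} (h : HasSum f a)
    (hf : ∀ x, f x = f' x) (ha : a = a') : HasSum f' a' := by
  rw [← ha, ← funext hf]
  exact h

theorem hasSum_of_finite_fibers {α κ : Type*} {f : α × κ → ℂ} {F : Finset α}
    (h1 : ∀ n ∉ F, ∀ j, f (n, j) = 0) (h2 : ∀ n, (Function.support fun j => f (n, j)).Finite) :
    HasSum f (∑ᶠ j, ∑ n ∈ F, f (n, j)) := by
  classical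
  have hfin : (Function.support f).Finite := by
    refine (F.finite_toSet.biUnion fun n _ => (h2 n).image (Prod.mk n)).subset ?_
    rintro ⟨n, j⟩ hx
    simp only [Set.mem_iUnion]
    refine ⟨n, ?_, j, hx, rfl⟩
    by_contra hn
    exact hx (h1 n hn j)
  have hs : Summable f := summable_of_hasFiniteSupport hfin
  have hs' : Summable fun x : κ × α => f (x.2, x.1) :=
    (Equiv.prodComm κ α).summable_iff.2 hs
  have h3 : ∑' x, f x = ∑ᶠ j, ∑ n ∈ F, f (n, j) := by
    rw [← (Equiv.prodComm κ α).tsum_eq f]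
    refine (hs'.tsum_prod).trans ?_
    have h4 : ∀ j, ∑' n, f (n, j) = ∑ n ∈ F, f (n, j) := fun j =>
      tsum_eq_sum fun n hn => h1 n hn j
    simp only [h4]
    refine tsum_eq_finsum ?_
    refine (F.finite_toSet.biUnion fun n _ => h2 n).subset fun j hj => ?_
    obtain ⟨n, hn, h5⟩ := Finset.exists_ne_zero_of_sum_ne_zero hj
    simp only [Set.mem_iUnion]
    exact ⟨n, hn, h5⟩
  rw [← h3]
  exact hs.hasSum

/-- Coefficient extraction for a series in `z ^ {α + m}`, `m ∈ ℤ`. -/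
theorem hasSum_coeff_of_integral_exponents {β : Type*} {a : β × (ℕ × ℂ) → ℂ} {α : ℂ}
    (ha : ∀ x, a x ≠ 0 → x.2.1 = 0 ∧ ∃ m : ℤ, x.2.2 = α + m) {R : ℝ} (hR : 0 < R) {f : ℂ → ℂ}
    (h : ∀ z ∈ Metric.sphere (0 : ℂ) R,
      HasSum (fun x => a x * expMonomial x.2 (logBranch 0 z)) (f z)) (n : ℤ) :
    HasSum (fun b => a (b, (0, α + n))) ((2 * Real.pi * Complex.I)⁻¹ *
      ∮ z in C(0, R), z ^ (-n - 1) * (Complex.exp (-(α * logBranch 0 z)) * f z)) := by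
  -- The floor reads off the integer `m` from the exponent `α + m`; its value is irrelevant for
  -- terms with zero coefficient.
  have h1 : ∀ z ∈ Metric.sphere (0 : ℂ) R,
      HasSum (fun x => a x * (z - 0) ^ ⌊(x.2.2 - α).re⌋)
        (Complex.exp (-(α * logBranch 0 z)) * f z) := by
    intro z hz
    have hz0 : z ≠ 0 := Metric.ne_of_mem_sphere hz hR.ne'
    have h2 : (fun x => a x * (z - 0) ^ ⌊(x.2.2 - α).re⌋) = fun x =>
        Complex.exp (-(α * logBranch 0 z)) * (a x * expMonomial x.2 (logBranch 0 z)) := by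
      funext x
      by_cases hx : a x = 0
      · simp [hx]
      obtain ⟨h3, m, h4⟩ := ha x hx
      have h5 : Complex.exp (logBranch 0 z) ^ m = z ^ m := by rw [exp_logBranch 0 hz0]
      rw [expMonomial, h3, h4, add_sub_cancel_left, Complex.intCast_re, Int.floor_intCast, sub_zero,
        ← h5, ← Complex.exp_int_mul, pow_zero, mul_one, add_mul, Complex.exp_add, Complex.exp_neg]
      field_simp
    rw [h2]
    exact (h z hz).mul_left _
  have h6 := hasSum_laurent_coeff hR h1 n
  simp only [sub_zero] at h6
  have hinj : Function.Injective fun b : β => (b, ((0 : ℕ), α + n)) := fun b b' h =>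
    congrArg Prod.fst h
  rw [← hinj.hasSum_iff] at h6
  · simpa [Function.comp_def] using h6
  · rintro x hx
    rw [ite_eq_right_iff]
    intro h7
    by_contra h8
    obtain ⟨h9, m, h10⟩ := ha x h8
    rw [h10, add_sub_cancel_left, Complex.intCast_re, Int.floor_intCast] at h7
    refine hx ⟨x.1, ?_⟩
    rw [← h7, ← h10, ← h9]

end Sums

namespace TwistedModule

variable {V : Type*} [AddCommGroup V] [Module ℂ V] {𝒱 : VertexOperatorAlgebra V}
  {g : 𝒱.Aut} {W : Type*} [AddCommGroup W] [Module ℂ W] (M : TwistedModule 𝒱 g W)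

theorem eq_zero_of_gradedDual {w : W} (h : ∀ φ ∈ gradedDual M.grading, φ w = 0) : w = 0 := by
  refine eq_zero_of_gradedProj_eq_zero M.isInternal fun n => ?_
  refine (Module.forall_dual_apply_eq_zero_iff ℂ _).1 fun ψ => ?_
  exact h _ (dual_comp_gradedProj_mem M.isInternal ψ n)

/-- Twisted vertex operators of eigenvectors have no logarithms, and their exponents are determined
modulo `ℤ` by the eigenvalue. -/
theorem exponents_of_eigenvector {u : V} {l : ℂ} (hu : g.1 u = l • u) {w : W} {k : ℕ} {n : ℂ}
    (h : M.Y u w k n ≠ 0) :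
    k = 0 ∧ Complex.exp (n * (2 * Real.pi * Complex.I)) * l = 1 := by
  by_contra hcon
  refine h (M.eq_zero_of_gradedDual fun φ hφ => ?_)
  by_contra h1
  have h2 := equivariant_support (g := (g.1 : V →ₗ[ℂ] V)) (c := M.matrixCoeff φ w) (l := l)
    (M.finite_matrixCoeff hφ w) (M.matrixCoeff_equivariant hφ w) 1 u (by simp [hu]) (k, n) h1
  exact hcon ⟨by simpa using h2.1, h2.2⟩

/-- Since `g ω = ω`, the eigenvalue is `1`. -/
theorem exponents_conformal {w : W} {k : ℕ} {n : ℂ} (h : M.Y 𝒱.conformal w k n ≠ 0) :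
    k = 0 ∧ ∃ m : ℤ, n = 0 + m := by
  have h1 := M.exponents_of_eigenvector (l := 1) (by rw [one_smul]; exact g.2.2.1) h
  refine ⟨h1.1, ?_⟩
  rw [mul_one, Complex.exp_eq_one_iff] at h1
  obtain ⟨-, m, hm⟩ := h1
  exact ⟨m, by rw [zero_add]; exact mul_right_cancel₀ Complex.two_pi_I_ne_zero hm⟩

/-- The operator `L(0)`. -/
noncomputable def LZero : Module.End ℂ W := logCoeff (M.Y 𝒱.conformal) 0 (-2)

theorem LZero_apply (w : W) : M.LZero w = M.Y 𝒱.conformal w 0 (-2) := rfl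

/-- The homogeneous subspaces are the generalized eigenspaces of `L(0)`. -/
theorem mem_grading_iff {n : ℂ} {w : W} :
    w ∈ M.grading n ↔ w ∈ M.LZero.maxGenEigenspace n := by
  have h1 : ∀ (n : ℂ) (w : W), w ∈ M.grading n → w ∈ M.LZero.maxGenEigenspace n := by
    intro n w hw
    obtain ⟨K, -, hK⟩ := M.L_zero n w hw
    exact (Module.End.mem_maxGenEigenspace _ _ _).2 ⟨K, hK⟩
  refine ⟨h1 n w, fun hw => ?_⟩
  obtain ⟨F, hF, hsum⟩ := gradedProj_eq_sum M.isInternal w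
  have h2 : w - gradedProj M.grading M.isInternal n w = 0 := by
    -- The difference lies in the generalized eigenspace of `n` and in the sum of those of the other
    -- weights, which meet in zero.
    have hdis := M.LZero.independent_maxGenEigenspace n
    refine (Submodule.disjoint_def.1 hdis) _ ?_ ?_
    · exact Submodule.sub_mem _ hw (h1 _ _ (gradedProj_mem _ _ _))
    · have h3 : w - gradedProj M.grading M.isInternal n w
          = ∑ m ∈ F.erase n, gradedProj M.grading M.isInternal m w := by
        by_cases hn : n ∈ F
        · rw [sub_eq_iff_eq_add, Finset.sum_erase_add _ _ hn]
          exact hsum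
        · rw [Finset.erase_eq_of_notMem hn, hF n hn, sub_zero]
          exact hsum
      rw [h3]
      refine Submodule.sum_mem _ fun m hm => ?_
      exact Submodule.mem_iSup_of_mem m (Submodule.mem_iSup_of_mem (Finset.ne_of_mem_erase hm)
        (h1 _ _ (gradedProj_mem _ _ _)))
  rw [sub_eq_zero.1 h2]
  exact gradedProj_mem _ _ _

theorem dual_comp_LZero_mem {φ : Module.Dual ℂ W} (hφ : φ ∈ gradedDual M.grading) :
    φ ∘ₗ M.LZero ∈ gradedDual M.grading := by
  refine Set.Finite.subset hφ ?_
  rintro n ⟨w, hw, h⟩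
  refine ⟨M.LZero w, ?_, h⟩
  rw [mem_grading_iff] at hw ⊢
  exact Module.End.mapsTo_maxGenEigenspace_of_comm (Commute.refl _) n hw

theorem finite_mul_expMonomial {c : ℕ × ℂ → ℂ} (hc : c.support.Finite) (s : ℂ) :
    (Function.support fun i => c i * expMonomial i s).Finite :=
  hc.subset fun _ hi => left_ne_zero_of_mul hi

/-- The correlation function of `Y(ω, z)`, `Y(v, -τ)` as a function of `log z`. -/
theorem exists_conformal_correlation (v : V) (w : W) {φ : Module.Dual ℂ W}
    (hφ : φ ∈ gradedDual M.grading) {τ : ℝ} (hτ : 0 < τ) :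
    ∃ (E : ℂ → ℂ) (t : ℕ), Differentiable ℂ E ∧
      (∀ z : ℂ, τ < ‖z‖ → HasSum (fun x : (ℂ × (ℕ × ℂ)) × (ℕ × ℂ) =>
      M.matrixCoeff φ (M.proj x.1.1 (logTerm 0 (-(τ : ℂ)) (M.Y v w) x.1.2)) 𝒱.conformal x.2
        * expMonomial x.2 (logBranch 0 z)) (E (logBranch 0 z) * ((z - (-(τ : ℂ))) ^ t)⁻¹)) ∧
      (∀ z : ℂ, 0 < ‖z‖ → ‖z‖ < τ → HasSum (fun x : (ℂ × (ℕ × ℂ)) × (ℕ × ℂ) =>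
      M.matrixCoeff (M.termDual φ (M.Y v) (logBranch 0 (-(τ : ℂ))) x.1) w 𝒱.conformal x.2
        * expMonomial x.2 (logBranch 0 z)) (E (logBranch 0 z) * ((z - (-(τ : ℂ))) ^ t)⁻¹)) ∧
      ∀ z : ℂ, 0 < ‖z - -(τ : ℂ)‖ → ‖z - -(τ : ℂ)‖ < τ → HasSum (fun x : ℤ × ℤ × (ℕ × ℂ) =>
      M.matrixCoeff φ w (gradedProj 𝒱.grading 𝒱.isInternal x.1 (𝒱.mode 𝒱.conformal x.2.1 v)) x.2.2
        * expMonomial x.2.2 (logBranch 0 (-(τ : ℂ))) * (z - (-(τ : ℂ))) ^ (-x.2.1 - 1))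
        (E (logBranch 0 z) * ((z - (-(τ : ℂ))) ^ t)⁻¹) := by
  set y : ℂ := -(τ : ℂ) with hy
  have hyn : ‖y‖ = τ := by simp [hy, abs_of_pos hτ]
  set ly := logBranch 0 y with hly
  obtain ⟨N, a, r, q, t, hdu⟩ := M.duality 𝒱.conformal v w φ hφ
  -- With `z₂ = -τ` fixed, the numerator of the correlation function is an entire function of `log
  -- z₁`.
  set E : ℂ → ℂ := fun s => ∑ i ∈ Finset.range (N + 1), ∑ j ∈ Finset.range (N + 1),
    ∑ k ∈ Finset.range (N + 1), ∑ l ∈ Finset.range (N + 1),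
      a i j k l * Complex.exp (r i * s) * Complex.exp (q j * ly) * s ^ k * ly ^ l with hE
  have hEd : Differentiable ℂ E := by
    rw [hE]
    fun_prop
  have hfpp : ∀ z : ℂ, (∑ i ∈ Finset.range (N + 1), ∑ j ∈ Finset.range (N + 1),
      ∑ k ∈ Finset.range (N + 1), ∑ l ∈ Finset.range (N + 1),
        a i j k l * Complex.exp (r i * logBranch 0 z) * Complex.exp (q j * ly)
          * logBranch 0 z ^ k * ly ^ l * ((z - y) ^ t)⁻¹)
        = E (logBranch 0 z) * ((z - y) ^ t)⁻¹ := by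
    intro z
    simp only [hE, Finset.sum_mul]
  refine ⟨E, t, hEd, ?_, ?_, ?_⟩
  · intro z hz
    have h1 := (hdu 0 z y).1 (by rwa [hyn]) (by rwa [hyn])
    rw [← (Equiv.prodAssoc _ _ _).hasSum_iff, ← hly, hfpp] at h1
    exact h1.of_forall_eq (fun x => M.productTerm_outer φ 𝒱.conformal 0 0 z y _ x) rfl
  · intro z hz hz'
    have h1 := (hdu 0 z y).2.1 (by rwa [hyn]) hz
    rw [← (innerEquiv _ _ _).hasSum_iff, ← hly, hfpp] at h1
    exact h1.of_forall_eq (fun x => M.productTerm_inner φ (M.Y v) 𝒱.conformal w 0 0 y z x) rfl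
  · intro z hz hz'
    -- Since `-τ` has argument `π`, the angular condition for the iterate holds throughout the disc.
    have h0 : z.re < 0 := by
      have := (abs_lt.1 ((Complex.abs_re_le_norm _).trans_lt hz')).2
      simp only [hy, Complex.sub_re, Complex.neg_re, Complex.ofReal_re] at this
      linarith
    have hargz : Real.pi / 2 < arg₀ z ∧ arg₀ z < 3 * Real.pi / 2 := arg₀_of_re_neg h0
    have hargy : arg₀ y = Real.pi := by
      rw [arg₀_eq_of_im_nonneg (by simp [hy]), hy, ← Complex.ofReal_neg,
        Complex.arg_ofReal_of_neg (by linarith)]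
    have h1 := ((hdu 0 z y).2.2 (by rwa [hyn]) hz).2 (by
      rw [hargy, abs_lt]
      constructor <;> linarith)
    rw [← hly, hfpp] at h1
    refine h1.of_forall_eq (fun x => ?_) rfl
    rw [logTerm_eq, map_smul, map_smul, map_smul, LinearMap.smul_apply,
      Finsupp.smul_apply, Pi.smul_apply, map_smul, smul_eq_mul, smul_eq_mul, M.matrixCoeff_apply]
    ring

/-- For `Re s > log τ`, `E` is the product series times `(e^s + τ)^t`, and that series has trivial
monodromy because `g ω = ω`. The identity theorem extends the period to all `s`. -/
theorem conformal_correlation_periodic (v : V) (w : W) {φ : Module.Dual ℂ W}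
    (hφ : φ ∈ gradedDual M.grading) {τ : ℝ} (hτ : 0 < τ) {E : ℂ → ℂ} {t : ℕ}
    (hEd : Differentiable ℂ E)
    (hprod : ∀ z : ℂ, τ < ‖z‖ → HasSum (fun x : (ℂ × (ℕ × ℂ)) × (ℕ × ℂ) =>
      M.matrixCoeff φ (M.proj x.1.1 (logTerm 0 (-(τ : ℂ)) (M.Y v w) x.1.2)) 𝒱.conformal x.2
        * expMonomial x.2 (logBranch 0 z)) (E (logBranch 0 z) * ((z - (-(τ : ℂ))) ^ t)⁻¹)) (s : ℂ) :
    E (s + 2 * Real.pi * Complex.I) = E s := by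
  set y : ℂ := -(τ : ℂ) with hy
  have hyn : ‖y‖ = τ := by simp [hy, abs_of_pos hτ]
  have hω : g.1 𝒱.conformal = 𝒱.conformal := g.2.2.1
  have := 𝒱.finiteDimensional 2
  have hcont := coeffSeries_continuation (M := M) (U := 𝒱.grading 2)
    (φ := fun _ : ℂ × (ℕ × ℂ) => φ) (w := fun b => M.proj b.1 (logTerm 0 y (M.Y v w) b.2))
    (I := Set.Ioi (Real.log τ)) (fun u hu => 𝒱.aut_mem_grading g hu) (fun _ => hφ) isOpen_Ioi
    (fun u _ z hz hzI => by
      obtain ⟨N', a', r', q', t', hdu'⟩ := M.duality u v w φ hφ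
      have h1 : τ < ‖z‖ := (Real.log_lt_log_iff hτ (norm_pos_iff.2 hz)).1 hzI
      have h2 := ((hdu' 0 z y).1 (by rwa [hyn]) (by rwa [hyn])).summable
      rw [← (Equiv.prodAssoc _ _ _).summable_iff] at h2
      exact h2.congr fun x => M.productTerm_outer φ u 0 0 z y _ x)
  set Φ := M.coeffSeries (fun _ : ℂ × (ℕ × ℂ) => φ)
    (fun b => M.proj b.1 (logTerm 0 y (M.Y v w) b.2)) 𝒱.conformal with hΦ
  have hΦE : Set.EqOn E (fun s => Φ s * (Complex.exp s - y) ^ t) {s | Real.log τ < s.re} := by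
    refine eqOn_of_eqOn_isOpen (isOpen_re_gt _) (convex_halfSpace_re_gt _).isPreconnected
      hEd.differentiableOn ((hcont.2.1 _ 𝒱.conformal_mem).mul (by fun_prop))
      ((isOpen_re_gt _).inter ((isOpen_im_gt 0).inter (isOpen_im_lt (2 * Real.pi))))
      Set.inter_subset_left ⟨⟨Real.log τ + 1, Real.pi⟩, ?_, ?_, ?_⟩ ?_
    · exact lt_add_one (Real.log τ)
    · exact Real.pi_pos
    · change Real.pi < 2 * Real.pi
      linarith [Real.pi_pos]
    · rintro s ⟨h1, h2, h3⟩
      have h4 := logBranch_zero_exp (le_of_lt h2) h3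
      have h5 : τ < ‖Complex.exp s‖ := by
        rw [Complex.norm_exp]
        exact (Real.log_lt_iff_lt_exp hτ).1 h1
      have h6 := (hprod _ h5).tsum_eq
      rw [h4] at h6
      have h7 : Complex.exp s - y ≠ 0 := fun h => by
        rw [sub_eq_zero] at h
        rw [h, hyn] at h5
        exact lt_irrefl _ h5
      change E s = (∑' x, _) * _
      rw [h6]
      field_simp
  have hE1 : Set.EqOn (fun s => E (s + 2 * Real.pi * Complex.I)) E {s | Real.log τ < s.re} := by
    intro s hs
    have hs' : s + 2 * Real.pi * Complex.I ∈ {s : ℂ | Real.log τ < s.re} := by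
      simpa using hs
    have h1 := hcont.2.2 _ 𝒱.conformal_mem s hs
    rw [hω] at h1
    simp only
    rw [hΦE hs, hΦE hs']
    simp only
    rw [Complex.exp_add, Complex.exp_two_pi_mul_I, mul_one, hΦ, h1]
  refine eqOn_of_eqOn_isOpen (f := fun s => E (s + 2 * Real.pi * Complex.I)) isOpen_univ
    isPreconnected_univ ?_ hEd.differentiableOn (isOpen_re_gt (Real.log τ)) (Set.subset_univ _)
    ⟨⟨Real.log τ + 1, 0⟩, lt_add_one (Real.log τ)⟩ hE1 (Set.mem_univ s)
  exact (hEd.comp (by fun_prop)).differentiableOn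

/-- Removes the intermediate projections; used with `φ ∘ L(0)` for the residue on the large circle.
-/
theorem hasSum_dual_proj_logTerm (v : V) (w : W) {φ : Module.Dual ℂ W}
    (hφ : φ ∈ gradedDual M.grading) (y : ℂ) :
    HasSum (fun j : ℂ × (ℕ × ℂ) => φ (M.proj j.1 (logTerm 0 y (M.Y v w) j.2)))
      (∑ᶠ i, M.matrixCoeff φ w v i * expMonomial i (logBranch 0 y)) := by
  obtain ⟨F, hF, hsum⟩ := gradedDual_apply_eq_sum M.isInternal hφ
  refine (hasSum_of_finite_fibers (F := F) (fun n hn j => hF n hn _) fun n => ?_).of_forall_eq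
    (fun _ => rfl) (finsum_congr fun j => ?_)
  · refine (M.finite_components v w n).subset fun j hj h => hj ?_
    simp only [logTerm_eq, map_smul]
    change _ • φ (gradedProj M.grading M.isInternal n _) = 0
    rw [h, map_zero, smul_zero]
  · rw [M.matrixCoeff_apply, mul_comm, ← smul_eq_mul, ← map_smul, ← logTerm_eq, hsum]
    rfl

theorem hasSum_termDual (v : V) (w : W) {φ : Module.Dual ℂ W} (hφ : φ ∈ gradedDual M.grading)
    (l : ℂ) :
    HasSum (fun j => M.termDual φ (M.Y v) l j w)
      (∑ᶠ i, M.matrixCoeff φ w v i * expMonomial i l) := by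
  have h1 : ∀ j : ℂ × (ℕ × ℂ), M.termDual φ (M.Y v) l j w
      = M.matrixCoeff φ (M.proj j.1 w) v j.2 * expMonomial j.2 l := fun j => mul_comm _ _
  obtain ⟨F, hF, hsum⟩ := gradedProj_eq_sum M.isInternal w
  refine (hasSum_of_finite_fibers (F := F) (fun n hn j => ?_) fun n => ?_).of_forall_eq
    (fun _ => rfl) (finsum_congr fun j => ?_)
  · rw [h1]
    have : M.proj n w = 0 := hF n hn
    rw [this, M.matrixCoeff_apply]
    simp
  · simp only [h1]
    exact finite_mul_expMonomial (M.finite_matrixCoeff hφ _ v) l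
  · simp only [h1]
    rw [← Finset.sum_mul]
    congr 1
    conv_rhs => rw [hsum]
    simp only [M.matrixCoeff_apply, map_sum, Finsupp.finsetSum_apply, Finset.sum_apply]
    rfl

theorem hasSum_matrixCoeff_gradedProj (v : V) (w : W) {φ : Module.Dual ℂ W}
    (hφ : φ ∈ gradedDual M.grading) (l : ℂ) :
    HasSum (fun x : ℤ × (ℕ × ℂ) => M.matrixCoeff φ w
      (gradedProj 𝒱.grading 𝒱.isInternal x.1 v) x.2 * expMonomial x.2 l)
      (∑ᶠ i, M.matrixCoeff φ w v i * expMonomial i l) := by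
  obtain ⟨F, hF, hsum⟩ := gradedProj_eq_sum 𝒱.isInternal v
  set c := M.matrixCoeff φ w with hc
  have h1 : ∀ u, (c u).support.Finite := M.finite_matrixCoeff hφ w
  clear_value c
  have h2 : ∀ n ∉ F, ∀ j : ℕ × ℂ, c (gradedProj 𝒱.grading 𝒱.isInternal n v) j
      * expMonomial j l = 0 := fun n hn j => by
    rw [hF n hn, map_zero, Pi.zero_apply, zero_mul]
  have h3 := hasSum_of_finite_fibers (f := fun x : ℤ × (ℕ × ℂ) =>
    c (gradedProj 𝒱.grading 𝒱.isInternal x.1 v) x.2 * expMonomial x.2 l) h2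
    fun n => finite_mul_expMonomial (h1 (gradedProj 𝒱.grading 𝒱.isInternal n v)) l
  refine h3.of_forall_eq (fun _ => rfl) (finsum_congr fun j => ?_)
  simp only
  rw [← Finset.sum_mul]
  congr 1
  conv_rhs => rw [hsum, map_sum, Finset.sum_apply]

/-- `L(0)` is the coefficient of `z^{-2}` in `Y(ω, z)`, hence the residue against `z`. -/
theorem hasSum_LZero_coeff {b : ℂ × (ℕ × ℂ) → Module.Dual ℂ W} {x : ℂ × (ℕ × ℂ) → W} {ρ : ℝ}
    (hρ : 0 < ρ) {f : ℂ → ℂ}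
    (hs : ∀ z ∈ Metric.sphere (0 : ℂ) ρ, HasSum (fun j : (ℂ × (ℕ × ℂ)) × (ℕ × ℂ) =>
      M.matrixCoeff (b j.1) (x j.1) 𝒱.conformal j.2 * expMonomial j.2 (logBranch 0 z)) (f z)) :
    HasSum (fun j => b j (M.LZero (x j)))
      ((2 * Real.pi * Complex.I)⁻¹ * ∮ z in C(0, ρ), z * f z) := by
  have h1 := hasSum_coeff_of_integral_exponents (α := 0) (fun j hj => ?_) hρ hs (-2)
  · refine h1.of_forall_eq (fun j => ?_) ?_
    · rw [M.matrixCoeff_apply, LZero_apply]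
      norm_num
    · norm_num
  · rw [M.matrixCoeff_apply] at hj
    exact M.exponents_conformal fun h => hj (by rw [h, map_zero])

theorem hasSum_mode_coeff {v : V} {w : W} {φ : Module.Dual ℂ W} {ρ : ℝ} (hρ : 0 < ρ) {f : ℂ → ℂ}
    {y l : ℂ}
    (hs : ∀ z ∈ Metric.sphere y ρ, HasSum (fun x : ℤ × ℤ × (ℕ × ℂ) => M.matrixCoeff φ w
      (gradedProj 𝒱.grading 𝒱.isInternal x.1 (𝒱.mode 𝒱.conformal x.2.1 v)) x.2.2
        * expMonomial x.2.2 l * (z - y) ^ (-x.2.1 - 1)) (f z)) (n : ℤ) :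
    HasSum (fun x : ℤ × (ℕ × ℂ) => M.matrixCoeff φ w
      (gradedProj 𝒱.grading 𝒱.isInternal x.1 (𝒱.mode 𝒱.conformal n v)) x.2 * expMonomial x.2 l)
      ((2 * Real.pi * Complex.I)⁻¹ * ∮ z in C(y, ρ), (z - y) ^ n * f z) := by
  have h1 := hasSum_laurent_coeff hρ hs (-n - 1)
  have hinj : Function.Injective fun x : ℤ × (ℕ × ℂ) => (x.1, n, x.2) := by
    rintro ⟨a, b⟩ ⟨a', b'⟩ h
    simpa using h
  rw [← hinj.hasSum_iff] at h1
  · refine h1.of_forall_eq (fun x => by simp) ?_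
    congr 3
    funext z
    congr 2
    ring
  · rintro ⟨a, m, b⟩ hx
    rw [ite_eq_right_iff]
    intro h2
    have h3 : -m - 1 = -n - 1 := h2
    have h4 : n = m := by omega
    exact absurd ⟨(a, b), by rw [h4]⟩ hx

/-- The commutator formula for `L(0)`, as an identity of matrix coefficients at `z = -τ`, from the
residues of `z₁ ⟨φ, Y(ω, z₁) Y(v, z) w⟩`. -/
theorem LZero_commutator_series (v : V) (w : W) {φ : Module.Dual ℂ W}
    (hφ : φ ∈ gradedDual M.grading) {τ : ℝ} (hτ : 0 < τ) :
    (∑ᶠ i, M.matrixCoeff (φ ∘ₗ M.LZero) w v i * expMonomial i (logBranch 0 (-(τ : ℂ))))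
      - ∑ᶠ i, M.matrixCoeff φ (M.LZero w) v i * expMonomial i (logBranch 0 (-(τ : ℂ)))
    = (∑ᶠ i, M.matrixCoeff φ w (𝒱.mode 𝒱.conformal 1 v) i
        * expMonomial i (logBranch 0 (-(τ : ℂ))))
      + -(τ : ℂ) * ∑ᶠ i, M.matrixCoeff φ w (𝒱.mode 𝒱.conformal 0 v) i
        * expMonomial i (logBranch 0 (-(τ : ℂ))) := by
  set y : ℂ := -(τ : ℂ) with hy
  have hyn : ‖y‖ = τ := by simp [hy, abs_of_pos hτ]
  obtain ⟨E, t, hEd, hprod, hrev, hite⟩ := M.exists_conformal_correlation v w hφ hτ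
  have hper := M.conformal_correlation_periodic v w hφ hτ hEd hprod
  rw [← hy] at hprod hrev hite
  set ly := logBranch 0 y with hly
  have hEl : ∀ z : ℂ, z ≠ 0 → E (logBranch 0 z) = E (Complex.log z) := fun z hz =>
    eq_of_periodic_of_exp_eq hper (by rw [exp_logBranch 0 hz, Complex.exp_log hz])
  have hHd : DifferentiableOn ℂ (fun z => z * E (Complex.log z)) {0}ᶜ :=
    differentiableOn_id.mul (differentiableOn_comp_log_of_periodic hper hEd)
  -- The circles of radius `2τ` and `τ/2` around `0` carry the two orders of the product, and the
  -- one around `y` carries the iterate.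
  have hres := circleIntegral_sub_eq_circleIntegral (b := y) (r := τ / 2) (R := 2 * τ) (ε := τ / 2)
    (by linarith) (by linarith) (by linarith) (by linarith) (by linarith) t _ hHd
  have hA := M.hasSum_LZero_coeff (ρ := 2 * τ) (b := fun _ => φ)
    (x := fun j => M.proj j.1 (logTerm 0 y (M.Y v w) j.2)) (by linarith) fun z hz => hprod z (by
      rw [mem_sphere_zero_iff_norm.1 hz]
      linarith)
  have hB := M.hasSum_LZero_coeff (ρ := τ / 2) (b := M.termDual φ (M.Y v) ly) (x := fun _ => w)
    (by linarith) fun z hz => hrev z (by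
      rw [mem_sphere_zero_iff_norm.1 hz]
      linarith) (by
      rw [mem_sphere_zero_iff_norm.1 hz]
      linarith)
  have hC := M.hasSum_mode_coeff (ρ := τ / 2) (l := ly) (by linarith) fun z hz => hite z (by
      rw [← dist_eq_norm, Metric.mem_sphere.1 hz]
      linarith) (by
      rw [← dist_eq_norm, Metric.mem_sphere.1 hz]
      linarith)
  have hne : ∀ z ∈ Metric.sphere y (τ / 2), z ≠ 0 ∧ z - y ≠ 0 := by
    refine fun z hz => ⟨fun h0 => ?_, sub_ne_zero.2 (Metric.ne_of_mem_sphere hz (by linarith))⟩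
    rw [Metric.mem_sphere, dist_eq_norm, h0, zero_sub, norm_neg, hyn] at hz
    linarith
  have hint : ∀ n : ℤ, ContinuousOn (fun z => (z - y) ^ n * (E (logBranch 0 z) * ((z - y) ^ t)⁻¹))
      (Metric.sphere y (τ / 2)) := by
    intro n
    have h1 : ContinuousOn (fun z => (z - y) ^ n * (E (Complex.log z) * ((z - y) ^ t)⁻¹))
        (Metric.sphere y (τ / 2)) := by
      have h2 : ContinuousOn (fun z => E (Complex.log z)) (Metric.sphere y (τ / 2)) :=
        (differentiableOn_comp_log_of_periodic hper hEd).continuousOn.mono fun z hz => (hne z hz).1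
      have h3 : ContinuousOn (fun z : ℂ => z - y) (Metric.sphere y (τ / 2)) := by fun_prop
      exact (h3.zpow₀ n fun z hz => Or.inl (hne z hz).2).mul
        (h2.mul ((h3.pow t).inv₀ fun z hz => pow_ne_zero t (hne z hz).2))
    exact h1.congr fun z hz => by
      rw [hEl z (hne z hz).1]
  rw [← hA.unique (M.hasSum_dual_proj_logTerm v w (M.dual_comp_LZero_mem hφ) y),
    ← hB.unique (M.hasSum_termDual v (M.LZero w) hφ ly),
    ← (hC 1).unique (M.hasSum_matrixCoeff_gradedProj (𝒱.mode 𝒱.conformal 1 v) w hφ ly),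
    ← (hC 0).unique (M.hasSum_matrixCoeff_gradedProj (𝒱.mode 𝒱.conformal 0 v) w hφ ly),
    ← mul_sub, mul_left_comm, ← mul_add, ← circleIntegral.integral_const_mul,
    ← circleIntegral.integral_add]
  · congr 1
    have h1 : ∀ (c : ℂ) (ρ : ℝ), 0 < ρ → (∀ z ∈ Metric.sphere c ρ, z ≠ 0) →
        (∮ z in C(c, ρ), z * (E (logBranch 0 z) * ((z - y) ^ t)⁻¹))
          = ∮ z in C(c, ρ), z * E (Complex.log z) * ((z - y) ^ t)⁻¹ := by
      intro c ρ hρ hz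
      refine circleIntegral.integral_congr hρ.le fun z hzs => ?_
      rw [hEl z (hz z hzs), mul_assoc]
    rw [h1 _ _ (by linarith) fun z hz => Metric.ne_of_mem_sphere hz (by linarith),
      h1 _ _ (by linarith) fun z hz => Metric.ne_of_mem_sphere hz (by linarith), hres,
      ← h1 _ _ (by linarith) fun z hz => (hne z hz).1]
    -- Here `z = (z - y) + y` splits the residue into the modes `ω₁ = L(0)` and `ω₀ = L(-1)` acting
    -- on `v`.
    refine circleIntegral.integral_congr (by linarith) fun z _ => ?_
    simp only [zpow_one, zpow_zero]
    ring
  · exact (hint 1).circleIntegrable (by linarith)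
  · exact (continuousOn_const.mul (hint 0)).circleIntegrable (by linarith)

/-- The commutator formula `[L(0), v_m] = (m + N) v_m` for the coefficient `v_m` of `x ^ m` in
`Y(v, x)`, where `v` is an eigenvector of `g` of weight `N`. -/
theorem LZero_commutator {v : V} {N : ℤ} (hv : v ∈ 𝒱.grading N) {l : ℂ} (hgv : g.1 v = l • v)
    (w : W) (i : ℕ × ℂ) :
    M.LZero (M.Y v w i.1 i.2)
      = M.Y v (M.LZero w) i.1 i.2 + (N + i.2) • M.Y v w i.1 i.2 := by
  rw [← sub_eq_zero]
  refine M.eq_zero_of_gradedDual fun φ hφ => ?_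
  set cA := M.matrixCoeff (φ ∘ₗ M.LZero) w v with hcA
  set cB := M.matrixCoeff φ (M.LZero w) v with hcB
  set cC := M.matrixCoeff φ w v with hcC
  have hA : cA.support.Finite := M.finite_matrixCoeff (M.dual_comp_LZero_mem hφ) w v
  have hB : cB.support.Finite := M.finite_matrixCoeff hφ _ v
  have hC : cC.support.Finite := M.finite_matrixCoeff hφ w v
  have hCN : (Function.support fun i => (N + i.2) * cC i).Finite :=
    hC.subset fun i hi => right_ne_zero_of_mul hi
  have hBC : (Function.support fun i => cB i + (N + i.2) * cC i).Finite :=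
    (hB.union hCN).subset fun i hi => by
      by_contra h
      simp only [Set.mem_union, Function.mem_support, not_or, not_not] at h
      exact hi (by simp only [h.1, h.2, add_zero])
  have hsupp : (Function.support fun i => cA i - (cB i + (N + i.2) * cC i)).Finite :=
    (hA.union hBC).subset fun i hi => by
      by_contra h
      simp only [Set.mem_union, Function.mem_support, not_or, not_not] at h
      exact hi (by simp only [h.1, h.2, sub_zero])
  have key := eq_zero_of_finsum_mul_expMonomial_eq_zero_on_line hsupp Real.pi fun x => by
    have hτ := Real.exp_pos x
    have h1 := M.LZero_commutator_series v w hφ hτ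
    have hl : logBranch 0 (-((Real.exp x : ℝ) : ℂ)) = x + Real.pi * Complex.I :=
      logBranch_zero_neg_exp x
    have hexp : Complex.exp (x + Real.pi * Complex.I) = -((Real.exp x : ℝ) : ℂ) := by
      rw [Complex.exp_add, Complex.exp_pi_mul_I, ← Complex.ofReal_exp]
      ring
    rw [hl] at h1
    set s : ℂ := x + Real.pi * Complex.I
    have hL0 : 𝒱.mode 𝒱.conformal 1 v = (N : ℂ) • v := 𝒱.L_zero N v hv
    have h2 : ∑ᶠ i, M.matrixCoeff φ w (𝒱.mode 𝒱.conformal 1 v) i * expMonomial i s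
        = ∑ᶠ i, N * cC i * expMonomial i s := by
      rw [hL0, map_smul]
      rfl
    -- The `L(-1)` term is `z d/dz` of the series; multiplication by `z` shifts the exponent by one.
    -- No logarithmic term contributes, as `v` is an eigenvector.
    have h3 : -((Real.exp x : ℝ) : ℂ) * ∑ᶠ i, M.matrixCoeff φ w (𝒱.mode 𝒱.conformal 0 v) i
        * expMonomial i s = ∑ᶠ i, i.2 * cC i * expMonomial i s := by
      rw [← hexp, ← smul_eq_mul, smul_finsum,
        ← finsum_comp_equiv (f := fun i : ℕ × ℂ => i.2 * cC i * expMonomial i s)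
            ((Equiv.refl ℕ).prodCongr (Equiv.addRight (1 : ℂ)))]
      refine finsum_congr fun ⟨k, n⟩ => ?_
      have h4 : M.Y v w (k + 1) (n + 1) = 0 := by
        by_contra h5
        exact absurd (M.exponents_of_eigenvector hgv h5).1 (by omega)
      have h5 := M.L_neg_one v w k n
      rw [h4, smul_zero, add_zero] at h5
      simp only [hcC, M.matrixCoeff_apply, Equiv.prodCongr_apply, Equiv.coe_refl, Prod.map_apply,
        id_eq, Equiv.coe_addRight, smul_eq_mul]
      rw [h5, map_smul, smul_eq_mul, expMonomial, expMonomial]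
      simp only [add_mul, one_mul, Complex.exp_add]
      ring
    rw [h2, h3] at h1
    have h6 : ∀ i, (cA i - (cB i + (N + i.2) * cC i)) * expMonomial i s
        = cA i * expMonomial i s - (cB i * expMonomial i s
          + (N * cC i * expMonomial i s + i.2 * cC i * expMonomial i s)) := fun i => by ring
    simp only [h6]
    have hf : ∀ c : ℕ × ℂ → ℂ, c.support.Finite →
        (Function.support fun i => c i * expMonomial i s).Finite := fun c hc =>
      finite_mul_expMonomial hc s
    have hC1 : (Function.support fun i : ℕ × ℂ => (N : ℂ) * cC i).Finite :=
      hC.subset fun i hi => right_ne_zero_of_mul hi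
    have hC2 : (Function.support fun i : ℕ × ℂ => i.2 * cC i).Finite :=
      hC.subset fun i hi => right_ne_zero_of_mul hi
    have hC3 := finsum_add_distrib (hf _ hC1) (hf _ hC2)
    have hC4 := (hf _ hC1).union (hf _ hC2)
    have hC5 : (Function.support fun i : ℕ × ℂ =>
        (N : ℂ) * cC i * expMonomial i s + i.2 * cC i * expMonomial i s).Finite :=
      hC4.subset (Function.support_add _ _)
    have hB5 : (Function.support fun i : ℕ × ℂ => cB i * expMonomial i s
        + ((N : ℂ) * cC i * expMonomial i s + i.2 * cC i * expMonomial i s)).Finite :=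
      ((hf _ hB).union hC5).subset (Function.support_add _ _)
    rw [finsum_sub_distrib (hf _ hA) hB5, finsum_add_distrib (hf _ hB) hC5, hC3]
    linear_combination h1
  have h7 := congrFun key i
  simp only [Pi.zero_apply] at h7
  rw [map_sub, map_add, map_smul, smul_eq_mul]
  exact h7

/-- Homogeneity: the coefficient of `x ^ m` in `Y(v, x)` maps `W_[n]` to `W_[n + N + m]`, if `v` is an
eigenvector of `g` of weight `N`. -/
theorem Y_mem_grading {v : V} {N : ℤ} (hv : v ∈ 𝒱.grading N) {l : ℂ} (hgv : g.1 v = l • v)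
    {n : ℂ} {w : W} (hw : w ∈ M.grading n) (i : ℕ × ℂ) :
    M.Y v w i.1 i.2 ∈ M.grading (n + N + i.2) := by
  rw [mem_grading_iff, Module.End.mem_maxGenEigenspace] at hw ⊢
  obtain ⟨K, hK⟩ := hw
  refine ⟨K, ?_⟩
  -- By the commutator formula, `L(0) - (n + N + m)` after the mode equals the mode after `L(0) -
  -- n`.
  have h : ∀ (K : ℕ) (w : W), ((M.LZero - (n + N + i.2) • (1 : Module.End ℂ W)) ^ K)
      (M.Y v w i.1 i.2) = M.Y v (((M.LZero - n • (1 : Module.End ℂ W)) ^ K) w) i.1 i.2 := by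
    intro K
    induction K with
    | zero => simp
    | succ K ih =>
      intro w
      rw [pow_succ, pow_succ, Module.End.mul_apply, Module.End.mul_apply, ← ih]
      congr 1
      simp only [LinearMap.sub_apply, LinearMap.smul_apply, Module.End.one_apply, map_sub,
        map_smul, Finsupp.sub_apply, Finsupp.smul_apply, Pi.sub_apply, Pi.smul_apply]
      rw [M.LZero_commutator hv hgv]
      module
  rw [h, hK]
  simp

end TwistedModule

/-! ## The product formula for the automorphisms -/

theorem logBranch_zero_neg_mul_I (x : ℝ) :
    logBranch 0 (-((Real.exp x : ℝ) * Complex.I)) = x + (3 * Real.pi / 2 : ℝ) * Complex.I := by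
  rw [logBranch, arg₀_neg_mul_I (Real.exp_pos x)]
  simp

namespace TwistedIntertwiningOperator

variable {V W₁ W₂ W₃ : Type*} [AddCommGroup V] [Module ℂ V]
  [AddCommGroup W₁] [Module ℂ W₁] [AddCommGroup W₂] [Module ℂ W₂]
  [AddCommGroup W₃] [Module ℂ W₃] {𝒱 : VertexOperatorAlgebra V} {g₁ g₂ g₃ : 𝒱.Aut}
  {M₁ : TwistedModule 𝒱 g₁ W₁} {M₂ : TwistedModule 𝒱 g₂ W₂} {M₃ : TwistedModule 𝒱 g₃ W₃}
  (𝒴 : TwistedIntertwiningOperator M₁ M₂ M₃)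

/-- The vectors of weight `N` all of whose products with `𝒴` vanish. -/
def productKernel (N : ℤ) : Submodule ℂ V where
  carrier := {v | v ∈ 𝒱.grading N ∧ ∀ φ ∈ gradedDual M₃.grading, ∀ w₁ w₂ (t : ℝ), 0 < t →
    ∀ s : ℂ, Real.log t < s.re → 𝒴.productSeries φ w₁ w₂ t v s = 0}
  zero_mem' := ⟨Submodule.zero_mem _, fun φ _ w₁ w₂ t _ s _ => by
    simp [productSeries, TwistedModule.coeffSeries]⟩
  add_mem' := by
    rintro u v ⟨hu, hu'⟩ ⟨hv, hv'⟩
    refine ⟨Submodule.add_mem _ hu hv, fun φ hφ w₁ w₂ t ht s hs => ?_⟩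
    have h := (𝒴.productSeries_continuation hφ w₁ w₂ ht N).1
    have h1 := (h u hu s hs).tsum_add (h v hv s hs)
    have h2 := hu' φ hφ w₁ w₂ t ht s hs
    have h3 := hv' φ hφ w₁ w₂ t ht s hs
    rw [productSeries, TwistedModule.coeffSeries] at h2 h3 ⊢
    simp only [map_add, Pi.add_apply, add_mul]
    rw [h1, h2, h3, add_zero]
  smul_mem' := by
    rintro c v ⟨hv, hv'⟩
    refine ⟨Submodule.smul_mem _ c hv, fun φ hφ w₁ w₂ t ht s hs => ?_⟩
    have h2 := hv' φ hφ w₁ w₂ t ht s hs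
    rw [productSeries, TwistedModule.coeffSeries] at h2 ⊢
    simp only [map_smul, Pi.smul_apply, smul_eq_mul, mul_assoc]
    rw [tsum_mul_left, h2, mul_zero]

theorem productKernel_invariant {N : ℤ} {v : V} (hv : v ∈ 𝒴.productKernel N) :
    g₃.1 v ∈ 𝒴.productKernel N := by
  obtain ⟨hv, hv'⟩ := hv
  refine ⟨𝒱.aut_mem_grading g₃ hv, fun φ hφ w₁ w₂ t ht s hs => ?_⟩
  have hs' : Real.log t < (s - 2 * Real.pi * Complex.I).re := by simpa using hs
  have h := (𝒴.productSeries_continuation hφ w₁ w₂ ht N).2.2 v hv _ hs'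
  rwa [sub_add_cancel, hv' φ hφ w₁ w₂ t ht _ hs'] at h

/-- The product series of `g₃⁻¹ g₁ g₂ u` and of `u` have the same continuation at `s + 2πi`, once by
`g₃`-equivariance and once by the comparison of loops. -/
theorem sub_mem_productKernel {N : ℤ} {u : V} (hu : u ∈ 𝒱.grading N) :
    (g₃⁻¹).1 (g₁.1 (g₂.1 u)) - u ∈ 𝒴.productKernel N := by
  set x := (g₃⁻¹).1 (g₁.1 (g₂.1 u)) with hx
  have hxN : x ∈ 𝒱.grading N :=
    𝒱.aut_mem_grading _ (𝒱.aut_mem_grading _ (𝒱.aut_mem_grading _ hu))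
  have hgx : g₃.1 x = g₁.1 (g₂.1 u) := LinearEquiv.apply_symm_apply g₃.1 _
  refine ⟨Submodule.sub_mem _ hxN hu, fun φ hφ w₁ w₂ t ht s hs => ?_⟩
  have h := 𝒴.productSeries_continuation hφ w₁ w₂ ht N
  have h1 := (h.1 x hxN s hs).tsum_sub (h.1 u hu s hs)
  have h2 := h.2.2 x hxN s hs
  rw [hgx, 𝒴.productSeries_monodromy hφ w₁ w₂ ht hu hs] at h2
  rw [productSeries, TwistedModule.coeffSeries] at h2 ⊢
  simp only [map_sub, Pi.sub_apply, sub_mul]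
  rw [h1, sub_eq_zero]
  exact h2.symm

/-- An eigenvector of `g₃` all of whose products with `𝒴` vanish acts as zero on the coefficients of
`𝒴`. -/
theorem Y_coeff_eq_zero_of_mem_productKernel {N : ℤ} {v : V} (hv : v ∈ 𝒴.productKernel N) {l : ℂ}
    (hl : l ≠ 0) (hgv : g₃.1 v = l • v) (w₁ : W₁) (w₂ : W₂) (i j : ℕ × ℂ) :
    M₃.Y v (𝒴.Y w₁ w₂ i.1 i.2) j.1 j.2 = 0 := by
  obtain ⟨hvN, hvP⟩ := hv
  obtain ⟨α, hα⟩ : ∃ α : ℂ, Complex.exp (α * (2 * Real.pi * Complex.I)) * l = 1 := by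
    refine ⟨-Complex.log l / (2 * Real.pi * Complex.I), ?_⟩
    rw [div_mul_cancel₀ _ Complex.two_pi_I_ne_zero, Complex.exp_neg, Complex.exp_log hl,
      inv_mul_cancel₀ hl]
  have hexp : ∀ (w : W₃) (k : ℕ) (n : ℂ), M₃.Y v w k n ≠ 0 → k = 0 ∧ ∃ m : ℤ, n = α + m := by
    intro w k n h
    obtain ⟨h1, h2⟩ := M₃.exponents_of_eigenvector hgv h
    refine ⟨h1, ?_⟩
    obtain ⟨m, hm⟩ := Complex.exp_eq_exp_iff_exists_int.1
      (mul_right_cancel₀ hl (h2.trans hα.symm))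
    refine ⟨m, mul_right_cancel₀ Complex.two_pi_I_ne_zero ?_⟩
    rw [hm]
    ring
  by_contra hne
  obtain ⟨hj, m, hm⟩ := hexp _ _ _ hne
  rw [hj, hm] at hne
  refine hne (eq_zero_of_gradedProj_eq_zero M₃.isInternal fun ν => ?_)
  refine (Module.forall_dual_apply_eq_zero_iff ℂ _).1 fun ψ => ?_
  set φ : Module.Dual ℂ W₃ := ψ ∘ₗ gradedProj M₃.grading M₃.isInternal ν
  have hφ : φ ∈ gradedDual M₃.grading := dual_comp_gradedProj_mem M₃.isInternal ψ ν
  set n₀ : ℂ := ν - N - (α + m) with hn₀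
  -- `φ` sees only weight `ν`, so only the intermediate weight `n₀ = ν - N - (α + m)` contributes.
  have hhom : ∀ n ≠ n₀, ∀ w : W₃, φ (M₃.Y v (M₃.proj n w) 0 (α + m)) = 0 := by
    intro n hn w
    have h1 := M₃.Y_mem_grading hvN hgv (gradedProj_mem M₃.isInternal n w) (0, α + m)
    change ψ (gradedProj M₃.grading M₃.isInternal ν _) = 0
    rw [TwistedModule.proj, gradedProj_of_mem M₃.isInternal h1, if_neg, map_zero]
    intro h2
    refine hn ?_
    rw [hn₀, h2]
    ring
  set c : ℕ × ℂ → ℂ := fun i => φ (M₃.Y v (M₃.proj n₀ (𝒴.Y w₁ w₂ i.1 i.2)) 0 (α + m)) with hc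
  have hcfin : c.support.Finite := (𝒴.finite_components w₁ w₂ n₀).subset fun i hi h => by
    refine hi ?_
    simp only [hc, h]
    simp
  have hc0 : c = 0 := by
    -- As `t = e^x` varies, the preferred logarithm of `-it` runs through the line `Im s = 3π/2`.
    refine eq_zero_of_finsum_mul_expMonomial_eq_zero_on_line hcfin (3 * Real.pi / 2) fun x => ?_
    rw [← logBranch_zero_neg_mul_I]
    set t := Real.exp x
    have ht : 0 < t := Real.exp_pos x
    have hs : ∀ z ∈ Metric.sphere (0 : ℂ) (2 * t), HasSum
        (fun b : (ℂ × (ℕ × ℂ)) × (ℕ × ℂ) => M₃.matrixCoeff φ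
          (M₃.proj b.1.1 (logTerm 0 (-(t * Complex.I)) (𝒴.Y w₁ w₂) b.1.2)) v b.2
            * expMonomial b.2 (logBranch 0 z)) 0 := by
      intro z hz
      have hre : Real.log t < (logBranch 0 z).re := by
        rw [logBranch_re, mem_sphere_zero_iff_norm.1 hz]
        exact Real.log_lt_log ht (by linarith)
      have h1 := ((𝒴.productSeries_continuation hφ w₁ w₂ ht N).1 v hvN _ hre).hasSum
      have h2 := hvP φ hφ w₁ w₂ t ht _ hre
      rw [productSeries, TwistedModule.coeffSeries] at h2
      rwa [h2] at h1
    have h3 := hasSum_coeff_of_integral_exponents (α := α) (fun b hb => ?_)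
      (by linarith : 0 < 2 * t) hs m
    · have hinj : Function.Injective fun i : ℕ × ℂ => (n₀, i) := fun i i' h => congrArg Prod.snd h
      rw [← hinj.hasSum_iff] at h3
      · have h4 := h3.tsum_eq
        have h5 : (∮ _ in C(0, 2 * t), (0 : ℂ)) = 0 := by simp [circleIntegral]
        simp only [mul_zero, h5] at h4
        rw [← h4, ← tsum_eq_finsum (L := .unconditional _)
          (TwistedModule.finite_mul_expMonomial hcfin _)]
        refine tsum_congr fun i => ?_
        simp only [Function.comp_apply, M₃.matrixCoeff_apply, hc, logTerm_eq, map_smul,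
          Finsupp.smul_apply, Pi.smul_apply, smul_eq_mul]
        exact mul_comm _ _
      · rintro ⟨n, i⟩ hi
        exact hhom n (fun h => hi ⟨i, by rw [h]⟩) _
    · rw [M₃.matrixCoeff_apply] at hb
      exact hexp _ _ _ fun h => hb (by rw [h, map_zero])
  obtain ⟨F, -, hF⟩ := gradedProj_eq_sum M₃.isInternal (𝒴.Y w₁ w₂ i.1 i.2)
  change φ (M₃.Y v (𝒴.Y w₁ w₂ i.1 i.2) 0 (α + m)) = 0
  rw [hF]
  simp only [map_sum, Finsupp.finsetSum_apply, Finset.sum_apply]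
  refine Finset.sum_eq_zero fun n _ => ?_
  by_cases hn : n = n₀
  · rw [hn]
    exact congrFun hc0 i
  · exact hhom n hn _

/-- A nonzero kernel would contain an eigenvector of `g₃`, which acts as zero on the span of the
coefficients of `𝒴`, hence on `W₃`, contrary to injectivity. -/
theorem productKernel_eq_bot (hinj : Function.Injective M₃.Y) (hsurj : 𝒴.IsSurjective) (N : ℤ) :
    𝒴.productKernel N = ⊥ := by
  by_contra hne
  have := 𝒱.finiteDimensional N
  have hle : 𝒴.productKernel N ≤ 𝒱.grading N := fun v hv => hv.1
  have : FiniteDimensional ℂ (𝒴.productKernel N) := Submodule.finiteDimensional_of_le hle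
  have : Nontrivial (𝒴.productKernel N) := Submodule.nontrivial_iff_ne_bot.2 hne
  let f : Module.End ℂ (𝒴.productKernel N) :=
    (g₃.1 : V →ₗ[ℂ] V).restrict fun v hv => 𝒴.productKernel_invariant hv
  obtain ⟨l, hl⟩ := Module.End.exists_eigenvalue f
  obtain ⟨⟨v, hv⟩, hv1, hv0⟩ := hl.exists_hasEigenvector
  have hgv : g₃.1 v = l • v := congrArg Subtype.val (Module.End.mem_eigenspace_iff.1 hv1)
  have hv0' : v ≠ 0 := fun h => hv0 (Subtype.ext h)
  have hl0 : l ≠ 0 := fun h => by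
    rw [h, zero_smul] at hgv
    exact hv0' (g₃.1.map_eq_zero_iff.1 hgv)
  refine hv0' (hinj ?_)
  rw [map_zero]
  ext w k n
  have h1 : (⊤ : Submodule ℂ W₃) ≤ LinearMap.ker (logCoeff (M₃.Y v) k n) := by
    rw [← hsurj, Submodule.span_le]
    rintro _ ⟨w₁, w₂, k', n', rfl⟩
    exact 𝒴.Y_coeff_eq_zero_of_mem_productKernel hv hl0 hgv w₁ w₂ (k', n') (k, n)
  exact h1 (Submodule.mem_top : w ∈ ⊤)

end TwistedIntertwiningOperator

theorem mainTheorem6 {V W₁ W₂ W₃ : Type*} [AddCommGroup V] [Module ℂ V]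
    [AddCommGroup W₁] [Module ℂ W₁] [AddCommGroup W₂] [Module ℂ W₂]
    [AddCommGroup W₃] [Module ℂ W₃] (𝒱 : VertexOperatorAlgebra V) (g₁ g₂ g₃ : 𝒱.Aut)
    (M₁ : TwistedModule 𝒱 g₁ W₁) (M₂ : TwistedModule 𝒱 g₂ W₂) (M₃ : TwistedModule 𝒱 g₃ W₃)
    (𝒴 : TwistedIntertwiningOperator M₁ M₂ M₃)
    (hinj : Function.Injective M₃.Y) (hsurj : 𝒴.IsSurjective) :
    g₃ = g₁ * g₂ := by
  have key : ∀ (N : ℤ) (u : V), u ∈ 𝒱.grading N → g₃.1 u = g₁.1 (g₂.1 u) := by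
    intro N u hu
    have h := 𝒴.sub_mem_productKernel hu
    rw [𝒴.productKernel_eq_bot hinj hsurj, Submodule.mem_bot, sub_eq_zero] at h
    conv_lhs => rw [← h]
    exact LinearEquiv.apply_symm_apply g₃.1 _
  refine Subtype.ext (LinearEquiv.ext fun u => ?_)
  obtain ⟨F, -, hF⟩ := gradedProj_eq_sum 𝒱.isInternal u
  rw [hF, map_sum, map_sum]
  exact Finset.sum_congr rfl fun N _ => key N _ (gradedProj_mem 𝒱.isInternal N u)
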